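/- Let $\zeta$ be the Riemann zeta function. Its non-trivial zeros are the zeros $\rho$ with $0<\Re\rho<1$, and $\sum_\rho f(\rho):=\lim_{T\to\infty}\sum_{|\Im\rho|<T}f(\rho)$ denotes summation over them. All powers are principal. Assume that every non-trivial zero of $\zeta$ is simple. For an integer $k\ge1$ define $\mu_k(n)$ by $\zeta(s)^{-k}=\sum_{n\ge1}\mu_k(n)n^{-s}$ for $\Re s>1$, i.e. $\mu_k$ is the $k$-fold Dirichlet convolution of the Möbius function $\mu$. For $c>0$ and $|\operatorname{Arg}x|<\pi/2$ let $$V(x\,|\,\bar 0_k)=\frac1{2\pi i}\int_{c-i\infty}^{c+i\infty}\Gamma(s)^k x^{-s}\,ds$$ be the Steen function with $k$ zero parameters, and put $$\mathfrak R_0(x)=\frac1{(k-1)!}\lim_{s\to0}\frac{d^{k-1}}{ds^{k-1}}\Big(s^k\,\Gamma\big(\tfrac s2\big)^k x^{-s}\Big),$$ $$R_\rho(x)=\frac1{(k-1)!}\lim_{s\to\rho}\frac{d^{k-1}}{ds^{k-1}}\Big((s-\rho)^k\,\pi^{-ks/2}\,\Gamma\big(\tfrac s2\big)^k\,\zeta(1-s)^{-k}(\sqrt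 x)^{-s}\Big),$$ $$U_{\mathbb Q,-k}(x)=\sum_{n=1}^\infty\frac{\mu_k(n)}n\Big[2V\Big(\frac{\pi^kx}{n^2}\,\Big|\,\bar0_k\Big)-\mathfrak R_0\Big(\frac{\pi^{k/2}\sqrt x}{n}\Big)\Big]+\frac12\sum_\rho R_\rho(x).$$ The functional equation of $\zeta^{-k}$ is $\Lambda(s)^k=\Lambda(1-s)^k$, where $\Lambda(s)=\pi^{-s/2}\Gamma(s/2)\zeta(1-s)^{-1}$, for all $s$ at which no factor on either side has a pole. (a) Let $k\ge1$ and suppose that $\sum_\rho R_\rho(x)$ converges for every real $x>0$. Then, for every $c>0$, the series over $n$ in $U_{\mathbb Q,-k}(x)$ converges absolutely for all $x\neq0$ with $|\operatorname{Arg}x|<\pi/2$, and the functional equation of $\zeta^{-k}$ is equivalent to the theta relation $$U_{\mathbb Q,-k}\Big(\frac1x\Big)=\sqrt x\;U_{\mathbb Q,-k}(x)$$ for all $x\ne0$ with $|\operatorname{Arg}x|<\pi/2$ for which the series over $\rho$ in $U_{\mathbb Q,-k}(x)$ and $U_{\mathbb Q,-k}(1/x)$ converge (in particular for all $x>0$).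 (b) Suppose that, for $k=1$, $\sum_\rho R_\rho(x)$ converges for every real $x>0$. Then the functional equation of $\zeta^{-1}$ is equivalent to the Hardy–Littlewood–Ramanujan identity: for every real $x>0$ the three series below converge and $$\sum_{n=1}^\infty\frac{\mu(n)}n e^{-x/n^2}=\sqrt{\frac\pi x}\sum_{n=1}^\infty\frac{\mu(n)}n e^{-\pi^2/(n^2x)}-\frac1{2\sqrt\pi}\sum_\rho\Big(\frac\pi{\sqrt x}\Big)^{\rho}\,\frac{\Gamma\big(\frac{1-\rho}2\big)}{\zeta'(\rho)}.$$ -/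

import Mathlib

noncomputable section

namespace ThetaZeta

open Filter Topology

/-- The non-trivial zeros of `ζ`: those in the critical strip `0 < Re s < 1`. -/
def nontrivialZeros : Set ℂ := {ρ | riemannZeta ρ = 0 ∧ 0 < ρ.re ∧ ρ.re < 1}

theorem finite_zerosUpTo (T : ℝ) : {ρ | ρ ∈ nontrivialZeros ∧ |ρ.im| < T}.Finite := by
  have hK : IsCompact (Set.Icc (0 : ℝ) 1 ×ℂ Set.Icc (-T) T) :=
    isCompact_Icc.reProdIm isCompact_Icc
  refine hK.inter_riemannZetaZeros_finite.subset ?_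
  rintro ρ ⟨⟨h0, h1, h2⟩, h3⟩
  have h4 := abs_lt.mp h3
  refine ⟨?_, mem_riemannZetaZeros.mpr h0⟩
  rw [Complex.mem_reProdIm]
  exact ⟨⟨h1.le, h2.le⟩, ⟨h4.1.le, h4.2.le⟩⟩

/-- The finite set of non-trivial zeros `ρ` with `|Im ρ| < T`. -/
def zerosUpTo (T : ℝ) : Finset ℂ := (finite_zerosUpTo T).toFinset

/-- `∑_ρ f ρ = S`, the sum over the (distinct) non-trivial zeros of `ζ` being taken symmetrically:
it is the limit of the sums over `|Im ρ| < T` as `T → ∞`. -/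
def HasZeroSum (f : ℂ → ℂ) (S : ℂ) : Prop :=
  Tendsto (fun T : ℝ => ∑ ρ ∈ zerosUpTo T, f ρ) atTop (𝓝 S)

/-- The series `∑_ρ f ρ` over the non-trivial zeros converges. -/
def ZeroSumConverges (f : ℂ → ℂ) : Prop := ∃ S, HasZeroSum f S

/-- The value of `∑_ρ f ρ` (meaningful when the series converges). -/
def zeroSum (f : ℂ → ℂ) : ℂ := limUnder atTop (fun T : ℝ => ∑ ρ ∈ zerosUpTo T, f ρ)

/-- The generalized Möbius function `μ_k`: the `k`-fold Dirichlet convolution of `μ`. -/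
def mu (k : ℕ) : ArithmeticFunction ℤ := ArithmeticFunction.moebius ^ k

open ArithmeticFunction in
/-- `∑ μ_k(n) n^{-s} = ζ(s)^{-k}` for `Re s > 1`, which determines `μ_k`. -/
theorem LSeriesHasSum_mu (k : ℕ) {s : ℂ} (hs : 1 < s.re) :
    LSeriesHasSum (fun n => (mu k n : ℂ)) s ((riemannZeta s ^ k)⁻¹) := by
  have key : ∀ k : ℕ, LSeriesSummable (fun n => (mu k n : ℂ)) s ∧
      LSeries (fun n => (mu k n : ℂ)) s = (riemannZeta s ^ k)⁻¹ := by
    intro k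
    have hμs : LSeriesSummable (fun n => ((moebius n : ℤ) : ℂ)) s :=
      LSeriesSummable_moebius_iff.mpr hs
    have hμ : LSeries (fun n => ((moebius n : ℤ) : ℂ)) s = (riemannZeta s)⁻¹ := by
      have h := LSeries_zeta_mul_Lseries_moebius hs
      rw [LSeries_zeta_eq_riemannZeta hs] at h
      exact eq_inv_of_mul_eq_one_right h
    induction k with
    | zero =>
      have h1 : (fun n => (mu 0 n : ℂ)) = LSeries.delta := by
        funext n
        simp [mu, ArithmeticFunction.one_apply, LSeries.delta]
      rw [h1]
      refine ⟨?_, by simp [LSeries_delta]⟩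
      refine summable_of_hasFiniteSupport ((Set.finite_singleton 1).subset ?_)
      intro n hn
      by_contra h
      exact hn (by simp_all [LSeries.term_def, LSeries.delta])
    | succ k ih =>
      have h2 : (fun n => (mu (k + 1) n : ℂ)) =
          fun n => (((mu k : ArithmeticFunction ℤ) : ArithmeticFunction ℂ) *
            ((moebius : ArithmeticFunction ℤ) : ArithmeticFunction ℂ)) n := by
        funext n
        simp [mu, pow_succ, ArithmeticFunction.mul_apply, ArithmeticFunction.intCoe_apply]
      have ha : LSeriesSummable
          (fun n => ((mu k : ArithmeticFunction ℤ) : ArithmeticFunction ℂ) n) s := by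
        simpa [ArithmeticFunction.intCoe_apply] using ih.1
      have hb : LSeriesSummable
          (fun n => ((moebius : ArithmeticFunction ℤ) : ArithmeticFunction ℂ) n) s := by
        simpa [ArithmeticFunction.intCoe_apply] using hμs
      rw [h2]
      refine ⟨LSeriesSummable_mul ha hb, ?_⟩
      rw [LSeries_mul' ha hb]
      simp only [ArithmeticFunction.intCoe_apply]
      rw [ih.2, hμ, pow_succ, mul_inv]
  have h := (key k).1.LSeriesHasSum
  rwa [(key k).2] at h

/-- The Steen function
`V(x | a_1, …, a_n) = (1 / 2πi) ∫_{(c)} ∏_j Γ(s + a_j) x^{-s} ds`,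
along the line `Re s = c`, which has to lie to the right of all poles of the `Γ(s + a_j)`. -/
def steenV (c : ℝ) {n : ℕ} (a : Fin n → ℂ) (x : ℂ) : ℂ :=
  (1 / (2 * Real.pi) : ℂ) * ∫ t : ℝ,
    (∏ j, Complex.Gamma ((c + t * Complex.I) + a j)) * x ^ (-(c + t * Complex.I))

/-- `(1/(k-1)!) lim_{s → 0} d^{k-1}/ds^{k-1} (s^k Γ(s/2)^k x^{-s})`. -/
def residueZero (k : ℕ) (x : ℂ) : ℂ :=
  (1 / ((k - 1).factorial : ℂ)) * limUnder (𝓝[≠] (0 : ℂ))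
    (iteratedDeriv (k - 1) fun s : ℂ => s ^ k * Complex.Gamma (s / 2) ^ k * x ^ (-s))

/-- `(1/(k-1)!) lim_{s → ρ} d^{k-1}/ds^{k-1}
((s-ρ)^k π^{-ks/2} Γ(s/2)^k ζ(1-s)^{-k} (√x)^{-s})`. -/
def residueRho (k : ℕ) (x ρ : ℂ) : ℂ :=
  (1 / ((k - 1).factorial : ℂ)) * limUnder (𝓝[≠] ρ)
    (iteratedDeriv (k - 1) fun s : ℂ =>
      (s - ρ) ^ k * (Real.pi : ℂ) ^ (-(k * s) / 2) * Complex.Gamma (s / 2) ^ k *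
        (riemannZeta (1 - s) ^ k)⁻¹ * (x ^ (1 / 2 : ℂ)) ^ (-s))

/-- The `n`-th term
`(μ_k(n)/n) [2 V(π^k x / n² | 0,…,0) - 𝔯₀(π^{k/2} √x / n)]` of the series in `U`. -/
def uTerm (k : ℕ) (c : ℝ) (x : ℂ) (n : ℕ) : ℂ :=
  (mu k n : ℂ) / n *
    (2 * steenV c (fun _ : Fin k => (0 : ℂ)) ((Real.pi : ℂ) ^ k * x / (n : ℂ) ^ 2) -
      residueZero k ((Real.pi : ℂ) ^ ((k : ℂ) / 2) * x ^ (1 / 2 : ℂ) / n))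

/-- The function `U_{ℚ,-k}`. The term `n = 0` of the series vanishes. -/
def U (k : ℕ) (c : ℝ) (x : ℂ) : ℂ :=
  (∑' n : ℕ, uTerm k c x n) + 1 / 2 * zeroSum (residueRho k x)

/-- `Λ(s) = π^{-s/2} Γ(s/2) ζ(1-s)^{-1}`. -/
def Lam (s : ℂ) : ℂ :=
  (Real.pi : ℂ) ^ (-s / 2) * Complex.Gamma (s / 2) * (riemannZeta (1 - s))⁻¹

/-- The functional equation of `ζ^{-k}`, `Λ(s)^k = Λ(1-s)^k`, at every `s` at which no factor
on either side has a pole. -/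
def FunctionalEquation (k : ℕ) : Prop :=
  ∀ s : ℂ, (∀ m : ℕ, s ≠ -(2 * m)) → (∀ m : ℕ, 1 - s ≠ -(2 * m)) →
    riemannZeta s ≠ 0 → riemannZeta (1 - s) ≠ 0 → Lam s ^ k = Lam (1 - s) ^ k

/-- The theta relation `U(1/x) = √x U(x)` on `|Arg x| < π/2`, wherever the two series over
the zeros which it contains converge. -/
def ThetaRelation (k : ℕ) (c : ℝ) : Prop :=
  ∀ x : ℂ, x ≠ 0 → |x.arg| < Real.pi / 2 →
    ZeroSumConverges (residueRho k x) → ZeroSumConverges (residueRho k (1 / x)) →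
      U k c (1 / x) = x ^ (1 / 2 : ℂ) * U k c x

/-- `∑_{n ≥ 1} (μ(n)/n) exp(-y/n²) = A`, as a limit of partial sums (the series converges only
conditionally). -/
def HasMoebiusExpSum (y A : ℝ) : Prop :=
  Tendsto (fun N : ℕ => ∑ n ∈ Finset.Icc 1 N,
    (ArithmeticFunction.moebius n : ℝ) / n * Real.exp (-y / (n : ℝ) ^ 2)) atTop (𝓝 A)

/-- The Hardy–Littlewood–Ramanujan identity at `x`: its three series converge, and their sums
`A`, `B`, `S` satisfy `A = √(π/x) B - S / (2√π)`. -/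
def HLRIdentity (x : ℝ) : Prop :=
  ∃ (A B : ℝ) (S : ℂ), HasMoebiusExpSum x A ∧ HasMoebiusExpSum (Real.pi ^ 2 / x) B ∧
    HasZeroSum (fun ρ => ((Real.pi / Real.sqrt x : ℝ) : ℂ) ^ ρ *
      (Complex.Gamma ((1 - ρ) / 2) / deriv riemannZeta ρ)) S ∧
    (A : ℂ) = (Real.sqrt (Real.pi / x) : ℂ) * B - 1 / (2 * (Real.sqrt Real.pi : ℂ)) * S

end ThetaZeta

end

/-! Both sides of each equivalence are proved outright, so each one links two true statements. The
functional equation is the symmetry of the completed zeta function: away from s = 0 and s = 1, Λ(s)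
equals `symLam s`, a quotient of visibly symmetric factors with denominator the entire function `xi`
(`Lam_eq_symLam`). The real work is the theta relation, and it comes from moving contours.

Put w = (log x)/2 and let J(w) be the integral of Λ(s)^k e^{-sw} over Re s = -1 (`lamIntegral`).
After s ↦ s/2, the term 2V(π^k x/n²) is an integral of Γ(s/2)^k over Re s = 2c. Subtracting its
residue at 0 moves the line to Re s = -1 (`integral_gammaKernel_sub`). There 1 - s has real part 2,
so the Dirichlet series of ζ(1-s)^{-k} converges absolutely and may be summed under the integral.
The series over n is therefore absolutely convergent with sum J(w)/(2π) (`hasSum_uTerm`), whatever c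
is.

Now shift J from Re s = -1 to Re s = 2. Only the non-trivial zeros are crossed, and s ↦ 1 - s
carries the new line back to the old one, giving e^{-w} J(-w) - J(w) = 2π ∑ R_ρ(x)
(`lamIntegral_neg_sub`). Writing this for x and for 1/x expresses the difference of the two series
over n, as well as ∑ R_ρ(1/x), through ∑ R_ρ(x). The weight 1/2 on the zero sum is exactly what
turns these relations into the theta relation.

The shift needs horizontal segments on which 1/ζ is under control. Γ(s/2) decays like e^{-η|t|} for
each η < π/4, while |e^{-sw}| grows at most like e^{|Im w||t|} with |Im w| < π/4, so a
subexponential bound for 1/ζ along some heights tending to infinity is enough. A minimum modulus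
argument provides it (`exists_heights`): divide out the nearby zeros by Blaschke factors, bound the
zero-free quotient from below by Borel–Carathéodory, and choose the height by the pigeonhole
principle.

For (b), V is e^{-z} and the residue at 0 is 2 when k = 1. The absolutely convergent series then has
terms (μ(n)/n)(2e^{-x/n²} - 2), and dropping the -2 requires ∑ μ(n)/n = 0. This form of the prime
number theorem is proved by a Fejér kernel Tauberian theorem (`tendsto_zero_of_laplace`) and the
non-vanishing of ζ on Re s = 1. The substitutions x ↦ x/π and ρ ↦ 1 - ρ finish the identity. -/

noncomputable section

namespace ThetaZeta

open Filter Topology Complex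

/-! ### The residue theorem on rectangles -/

/-- `r` is the residue of `F` at `p`, read off from a finite principal part. -/
def HasRes (F : ℂ → ℂ) (p r : ℂ) : Prop :=
  ∃ (k : ℕ) (a : ℕ → ℂ) (h : ℂ → ℂ), AnalyticAt ℂ h p ∧
    ∀ᶠ s in 𝓝[≠] p,
      F s = r * (s - p)⁻¹ + ∑ i ∈ Finset.range k, a i * ((s - p) ^ (i + 2))⁻¹ + h s

/-- The integral of `F` over the positively oriented boundary of `[a, b] × [c, d]`. -/
def rectIntegral (F : ℂ → ℂ) (a b c d : ℝ) : ℂ :=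
  (∫ x in a..b, F (x + c * I)) - (∫ x in a..b, F (x + d * I)) +
    I * (∫ y in c..d, F (b + y * I)) - I * ∫ y in c..d, F (a + y * I)

/-- The boundary of the rectangle `[a, b] × [c, d]`. -/
def rectBoundary (a b c d : ℝ) : Set ℂ :=
  {z | (z.re ∈ Set.Icc a b ∧ (z.im = c ∨ z.im = d)) ∨
    (z.im ∈ Set.Icc c d ∧ (z.re = a ∨ z.re = b))}

section rect

variable {a b c d : ℝ} {F G : ℂ → ℂ}

lemma bottom_mem_rectBoundary (hab : a ≤ b) {x : ℝ} (hx : x ∈ Set.uIcc a b) :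
    (x + c * I : ℂ) ∈ rectBoundary a b c d := by
  rw [Set.uIcc_of_le hab] at hx
  left; simpa using hx

lemma top_mem_rectBoundary (hab : a ≤ b) {x : ℝ} (hx : x ∈ Set.uIcc a b) :
    (x + d * I : ℂ) ∈ rectBoundary a b c d := by
  rw [Set.uIcc_of_le hab] at hx
  left; simpa using hx

lemma right_mem_rectBoundary (hcd : c ≤ d) {y : ℝ} (hy : y ∈ Set.uIcc c d) :
    (b + y * I : ℂ) ∈ rectBoundary a b c d := by
  rw [Set.uIcc_of_le hcd] at hy
  right; simpa using hy

lemma left_mem_rectBoundary (hcd : c ≤ d) {y : ℝ} (hy : y ∈ Set.uIcc c d) :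
    (a + y * I : ℂ) ∈ rectBoundary a b c d := by
  rw [Set.uIcc_of_le hcd] at hy
  right; simpa using hy

lemma rectIntegral_congr (hab : a ≤ b) (hcd : c ≤ d)
    (h : ∀ z ∈ rectBoundary a b c d, F z = G z) :
    rectIntegral F a b c d = rectIntegral G a b c d := by
  unfold rectIntegral
  congr 1; congr 1; congr 1
  · exact intervalIntegral.integral_congr fun x hx => h _ (bottom_mem_rectBoundary hab hx)
  · exact intervalIntegral.integral_congr fun x hx => h _ (top_mem_rectBoundary hab hx)
  · rw [intervalIntegral.integral_congr fun x hx => h _ (right_mem_rectBoundary hcd hx)]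
  · rw [intervalIntegral.integral_congr fun x hx => h _ (left_mem_rectBoundary hcd hx)]

lemma intervalIntegrable_sides (hab : a ≤ b) (hcd : c ≤ d)
    (hF : ContinuousOn F (rectBoundary a b c d)) :
    IntervalIntegrable (fun x : ℝ => F (x + c * I)) MeasureTheory.volume a b ∧
    IntervalIntegrable (fun x : ℝ => F (x + d * I)) MeasureTheory.volume a b ∧
    IntervalIntegrable (fun y : ℝ => F (b + y * I)) MeasureTheory.volume c d ∧
    IntervalIntegrable (fun y : ℝ => F (a + y * I)) MeasureTheory.volume c d :=
  ⟨(hF.comp (by fun_prop) fun _ hx => bottom_mem_rectBoundary hab hx).intervalIntegrable,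
    (hF.comp (by fun_prop) fun _ hx => top_mem_rectBoundary hab hx).intervalIntegrable,
    (hF.comp (by fun_prop) fun _ hx => right_mem_rectBoundary hcd hx).intervalIntegrable,
    (hF.comp (by fun_prop) fun _ hx => left_mem_rectBoundary hcd hx).intervalIntegrable⟩

lemma rectIntegral_add (hab : a ≤ b) (hcd : c ≤ d)
    (hF : ContinuousOn F (rectBoundary a b c d)) (hG : ContinuousOn G (rectBoundary a b c d)) :
    rectIntegral (fun z => F z + G z) a b c d =
      rectIntegral F a b c d + rectIntegral G a b c d := by
  obtain ⟨f1, f2, f3, f4⟩ := intervalIntegrable_sides hab hcd hF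
  obtain ⟨g1, g2, g3, g4⟩ := intervalIntegrable_sides hab hcd hG
  unfold rectIntegral
  rw [intervalIntegral.integral_add f1 g1, intervalIntegral.integral_add f2 g2,
    intervalIntegral.integral_add f3 g3, intervalIntegral.integral_add f4 g4]
  ring

lemma rectIntegral_const_mul (r : ℂ) :
    rectIntegral (fun z => r * F z) a b c d = r * rectIntegral F a b c d := by
  unfold rectIntegral
  simp only [intervalIntegral.integral_const_mul]
  ring

lemma integral_horizontal_of_hasDerivAt {P f : ℂ → ℂ} {y : ℝ}
    (h : ∀ x ∈ Set.uIcc a b, HasDerivAt P (f (x + y * I)) (x + y * I))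
    (hf : IntervalIntegrable (fun x : ℝ => f (x + y * I)) MeasureTheory.volume a b) :
    ∫ x in a..b, f (x + y * I) = P (b + y * I) - P (a + y * I) := by
  refine intervalIntegral.integral_eq_sub_of_hasDerivAt
    (f := fun x : ℝ => P (x + y * I)) (fun x hx => ?_) hf
  have := (h x hx).comp_add_const (a := y * I) (x := (x : ℂ))
  simpa using this.comp_ofReal

lemma integral_vertical_of_hasDerivAt {P f : ℂ → ℂ} {x : ℝ}
    (h : ∀ y ∈ Set.uIcc c d, HasDerivAt P (f (x + y * I)) (x + y * I))
    (hf : IntervalIntegrable (fun y : ℝ => f (x + y * I)) MeasureTheory.volume c d) :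
    I * ∫ y in c..d, f (x + y * I) = P (x + d * I) - P (x + c * I) := by
  rw [← intervalIntegral.integral_const_mul]
  refine intervalIntegral.integral_eq_sub_of_hasDerivAt
    (f := fun y : ℝ => P (x + y * I)) (fun y hy => ?_) (hf.const_mul _)
  have h1 : HasDerivAt (fun y : ℝ => (x + y * I : ℂ)) I y := by
    simpa using ((hasDerivAt_id (y : ℂ)).mul_const I).comp_ofReal.const_add (x : ℂ)
  have := (h y hy).comp (h₂ := P) (h := fun y : ℝ => (x + y * I : ℂ)) y h1
  rw [mul_comm]
  exact this

lemma rectIntegral_eq_zero_of_hasDerivAt {P : ℂ → ℂ} (hab : a ≤ b) (hcd : c ≤ d)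
    (hF : ContinuousOn F (rectBoundary a b c d))
    (h : ∀ z ∈ rectBoundary a b c d, HasDerivAt P (F z) z) :
    rectIntegral F a b c d = 0 := by
  obtain ⟨f1, f2, f3, f4⟩ := intervalIntegrable_sides hab hcd hF
  unfold rectIntegral
  rw [integral_horizontal_of_hasDerivAt (fun x hx => h _ (bottom_mem_rectBoundary hab hx)) f1,
    integral_horizontal_of_hasDerivAt (fun x hx => h _ (top_mem_rectBoundary hab hx)) f2,
    integral_vertical_of_hasDerivAt (fun x hx => h _ (right_mem_rectBoundary hcd hx)) f3,
    integral_vertical_of_hasDerivAt (fun x hx => h _ (left_mem_rectBoundary hcd hx)) f4]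
  ring

lemma ne_of_mem_rectBoundary {p z : ℂ} (hp : p ∈ Set.Ioo a b ×ℂ Set.Ioo c d)
    (hz : z ∈ rectBoundary a b c d) : z ≠ p := by
  rintro rfl
  obtain ⟨⟨h1, h2⟩, h3, h4⟩ := Complex.mem_reProdIm.mp hp
  rcases hz with ⟨-, h | h⟩ | ⟨-, h | h⟩ <;> linarith

lemma log_neg_of_im_pos {z : ℂ} (hz : 0 < z.im) : Complex.log (-z) = Complex.log z - Real.pi * I := by
  have h := Complex.arg_neg_eq_arg_sub_pi_of_im_pos hz
  simp only [Complex.log, norm_neg, h]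
  push_cast; ring

lemma log_neg_of_im_neg {z : ℂ} (hz : z.im < 0) : Complex.log (-z) = Complex.log z + Real.pi * I := by
  have h := Complex.arg_neg_eq_arg_add_pi_of_im_neg hz
  simp only [Complex.log, norm_neg, h]
  push_cast; ring

lemma continuousOn_pole {p : ℂ} (hp : p ∈ Set.Ioo a b ×ℂ Set.Ioo c d) (n : ℕ) :
    ContinuousOn (fun z : ℂ => ((z - p) ^ n)⁻¹) (rectBoundary a b c d) :=
  ContinuousOn.inv₀ (by fun_prop) fun _ hz =>
    pow_ne_zero _ (sub_ne_zero.mpr (ne_of_mem_rectBoundary hp hz))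

/-- On three sides log(z - p) is a primitive. The left side meets the branch cut of that logarithm,
so log(p - z) is used there; the two branches differ by -πi and πi at the left corners, which adds
up to 2πi. -/
lemma rectIntegral_inv {p : ℂ} (hp : p ∈ Set.Ioo a b ×ℂ Set.Ioo c d) :
    rectIntegral (fun z => (z - p)⁻¹) a b c d = 2 * Real.pi * I := by
  obtain ⟨⟨h1, h2⟩, h3, h4⟩ := Complex.mem_reProdIm.mp hp
  have hab := (h1.trans h2).le
  have hcd := (h3.trans h4).le
  have hc : ContinuousOn (fun z : ℂ => (z - p)⁻¹) (rectBoundary a b c d) := by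
    simpa using continuousOn_pole hp 1
  obtain ⟨f1, f2, f3, f4⟩ := intervalIntegrable_sides hab hcd hc
  have hlog : ∀ z : ℂ, z - p ∈ slitPlane →
      HasDerivAt (fun z => Complex.log (z - p)) ((z - p)⁻¹) z := fun z hz => by
    simpa using ((hasDerivAt_id z).sub_const p).clog hz
  have hlog' : ∀ z : ℂ, p - z ∈ slitPlane →
      HasDerivAt (fun z => Complex.log (p - z)) ((z - p)⁻¹) z := fun z hz => by
    have := ((hasDerivAt_id z).const_sub p).clog hz
    rw [← neg_sub, inv_neg]
    simpa [neg_div] using this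
  unfold rectIntegral
  beta_reduce
  rw [integral_horizontal_of_hasDerivAt (P := fun z => Complex.log (z - p))
      (f := fun z => (z - p)⁻¹)
      (fun x _ => hlog _ (Or.inr (by simp; linarith))) f1,
    integral_horizontal_of_hasDerivAt (P := fun z => Complex.log (z - p))
      (f := fun z => (z - p)⁻¹) (fun x _ => hlog _ (Or.inr (by simp; linarith))) f2,
    integral_vertical_of_hasDerivAt (P := fun z => Complex.log (z - p))
      (f := fun z => (z - p)⁻¹) (fun x _ => hlog _ (Or.inl (by simp; linarith))) f3,
    integral_vertical_of_hasDerivAt (P := fun z => Complex.log (p - z))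
      (f := fun z => (z - p)⁻¹) (fun x _ => hlog' _ (Or.inl (by simp; linarith))) f4]
  have e1 : Complex.log (p - (a + d * I)) = Complex.log (a + d * I - p) - Real.pi * I := by
    rw [← neg_sub, log_neg_of_im_pos (by simp; linarith)]
  have e2 : Complex.log (p - (a + c * I)) = Complex.log (a + c * I - p) + Real.pi * I := by
    rw [← neg_sub, log_neg_of_im_neg (by simp; linarith)]
  rw [e1, e2]
  ring

/-- Poles of order at least two have single-valued primitives and contribute nothing. -/
lemma rectIntegral_principalPart {p r : ℂ} (hp : p ∈ Set.Ioo a b ×ℂ Set.Ioo c d)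
    (k : ℕ) (e : ℕ → ℂ) :
    rectIntegral (fun z => r * (z - p)⁻¹ + ∑ i ∈ Finset.range k, e i * ((z - p) ^ (i + 2))⁻¹)
      a b c d = 2 * Real.pi * I * r := by
  obtain ⟨⟨h1, h2⟩, h3, h4⟩ := Complex.mem_reProdIm.mp hp
  have hab := (h1.trans h2).le
  have hcd := (h3.trans h4).le
  have hc1 : ContinuousOn (fun z : ℂ => r * (z - p)⁻¹) (rectBoundary a b c d) := by
    simpa using (continuousOn_pole hp 1).const_mul r
  have hc2 : ContinuousOn (fun z : ℂ => ∑ i ∈ Finset.range k, e i * ((z - p) ^ (i + 2))⁻¹)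
      (rectBoundary a b c d) :=
    continuousOn_finsetSum _ fun i _ => (continuousOn_pole hp _).const_mul _
  rw [rectIntegral_add hab hcd hc1 hc2, rectIntegral_const_mul, rectIntegral_inv hp,
    rectIntegral_eq_zero_of_hasDerivAt (P := fun z => ∑ i ∈ Finset.range k,
      e i * (-((i + 1 : ℕ) : ℂ)⁻¹ * ((z - p) ^ (i + 1))⁻¹)) hab hcd hc2]
  · ring
  intro z hz
  have hne := sub_ne_zero.mpr (ne_of_mem_rectBoundary hp hz)
  refine HasDerivAt.fun_sum fun i _ => HasDerivAt.const_mul _ ?_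
  have h := ((((hasDerivAt_id z).sub_const p).fun_pow (i + 1)).fun_inv (pow_ne_zero _ hne)).const_mul
    (-((i + 1 : ℕ) : ℂ)⁻¹)
  refine h.congr_deriv ?_
  have : ((i : ℂ) + 1) ≠ 0 := by exact_mod_cast Nat.succ_ne_zero i
  push_cast
  field_simp
  simp only [id_eq]
  ring

lemma HasRes.add_analyticAt {p r : ℂ} (hF : HasRes F p r) (hG : AnalyticAt ℂ G p) :
    HasRes (fun z => F z + G z) p r := by
  obtain ⟨k, e, h, hh, hev⟩ := hF
  refine ⟨k, e, fun z => h z + G z, hh.add hG, ?_⟩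
  filter_upwards [hev] with s hs
  rw [hs]; ring

lemma HasRes.congr {p r : ℂ} (hF : HasRes F p r) (hG : ∀ᶠ z in 𝓝[≠] p, F z = G z) :
    HasRes G p r := by
  obtain ⟨k, e, h, hh, hev⟩ := hF
  refine ⟨k, e, h, hh, ?_⟩
  filter_upwards [hev, hG] with s hs h's
  rw [← h's, hs]

/-- The residue theorem on a rectangle. -/
theorem rectIntegral_eq_sum_residues (hab : a ≤ b) (hcd : c ≤ d) (P : Finset ℂ) (res : ℂ → ℂ)
    (hd : ∀ z ∈ Set.Icc a b ×ℂ Set.Icc c d, z ∉ P → DifferentiableAt ℂ F z)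
    (hP : ∀ p ∈ P, p ∈ Set.Ioo a b ×ℂ Set.Ioo c d ∧ HasRes F p (res p)) :
    rectIntegral F a b c d = 2 * Real.pi * I * ∑ p ∈ P, res p := by
  induction P using Finset.induction_on generalizing F with
  | empty =>
    have h := integral_boundary_rect_eq_zero_of_differentiableOn F (a + c * I) (b + d * I)
      (fun z hz => by
        refine (hd z ?_ (Finset.notMem_empty z)).differentiableWithinAt
        simpa [Set.uIcc_of_le hab, Set.uIcc_of_le hcd] using hz)
    simpa [rectIntegral] using h
  | insert p P hpP ih =>
    obtain ⟨hp, k, e, h, hh, hev⟩ := hP p (Finset.mem_insert_self p P)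
    set PP : ℂ → ℂ := fun z => res p * (z - p)⁻¹ +
      ∑ i ∈ Finset.range k, e i * ((z - p) ^ (i + 2))⁻¹ with hPP
    -- Subtracting the principal part at `p` and filling in the value `h p` removes this
    -- singularity, so the induction hypothesis applies to the remaining poles.
    set F₁ : ℂ → ℂ := Function.update (fun z => F z + -PP z) p (h p) with hF₁
    have hPPan : ∀ z, z ≠ p → AnalyticAt ℂ PP z := fun z hz => by
      have hz' := sub_ne_zero.mpr hz
      refine AnalyticAt.add (analyticAt_const.mul ((by fun_prop : AnalyticAt ℂ _ z).inv hz')) ?_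
      refine Finset.analyticAt_fun_sum _ fun i _ => analyticAt_const.mul
        ((by fun_prop : AnalyticAt ℂ _ z).inv (pow_ne_zero _ hz'))
    have hF₁ne : ∀ z, z ≠ p → F₁ =ᶠ[𝓝 z] fun z => F z + -PP z := fun z hz => by
      filter_upwards [isOpen_ne.mem_nhds hz] with w hw
      simp [hF₁, Function.update_of_ne hw]
    have hF₁p : F₁ =ᶠ[𝓝 p] h := by
      rw [eventually_nhdsWithin_iff] at hev
      filter_upwards [hev] with w hw
      rcases eq_or_ne w p with rfl | hwp
      · simp [hF₁]
      · simp only [hF₁, Function.update_of_ne hwp, hw hwp, hPP]; ring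
    have key := ih (F := F₁) ?_ ?_
    · rw [Finset.sum_insert hpP, mul_add, ← key, ← rectIntegral_principalPart hp k e, add_comm,
        ← rectIntegral_add hab hcd]
      · refine rectIntegral_congr hab hcd fun z hz => ?_
        simp only [hF₁, Function.update_of_ne (ne_of_mem_rectBoundary hp hz), hPP]; ring
      · intro z hz
        have hzp := ne_of_mem_rectBoundary hp hz
        have hzI : z ∈ Set.Icc a b ×ℂ Set.Icc c d := by
          rw [Complex.mem_reProdIm]
          rcases hz with ⟨h1, h2 | h2⟩ | ⟨h1, h2 | h2⟩ <;>
            simp only [Set.mem_Icc] at h1 ⊢ <;> refine ⟨⟨?_, ?_⟩, ?_, ?_⟩ <;> linarith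
        refine ContinuousAt.continuousWithinAt
          (ContinuousAt.congr ?_ (hF₁ne z hzp).symm)
        refine ((hd z hzI ?_).continuousAt).add (hPPan z hzp).continuousAt.neg
        intro hzP
        exact ne_of_mem_rectBoundary (hP z hzP).1 hz rfl
      · exact fun z hz => (hPPan z (ne_of_mem_rectBoundary hp hz)).continuousAt.continuousWithinAt
    · intro z hz hzP
      rcases eq_or_ne z p with rfl | hzp
      · exact hh.differentiableAt.congr_of_eventuallyEq hF₁p
      · refine DifferentiableAt.congr_of_eventuallyEq ?_ (hF₁ne z hzp)
        exact (hd z hz (by simp [hzp, hzP])).add (hPPan z hzp).differentiableAt.neg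
    · intro q hq
      obtain ⟨hq1, hq2⟩ := hP q (Finset.mem_insert_of_mem hq)
      have hqp : q ≠ p := fun h => hpP (h ▸ hq)
      refine ⟨hq1, (hq2.add_analyticAt (hPPan q hqp).neg).congr ?_⟩
      filter_upwards [(hF₁ne q hqp).filter_mono nhdsWithin_le_nhds] with w hw
      exact hw.symm

end rect

/-! ### Residues read off from Taylor coefficients -/

/-- The residue at a pole of order at most `k + 1`. -/
theorem hasRes_of_eq_div_pow {F g : ℂ → ℂ} {p : ℂ} (k : ℕ) (hg : AnalyticAt ℂ g p)
    (hF : ∀ᶠ s in 𝓝[≠] p, F s = g s / (s - p) ^ (k + 1)) :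
    HasRes F p (iteratedDeriv k g p / k.factorial) := by
  have hser := hg.hasFPowerSeriesAt
  set q : FormalMultilinearSeries ℂ ℂ ℂ := _ with hq
  change HasFPowerSeriesAt g q p at hser
  have hit : ∀ n, AnalyticAt ℂ ((Function.swap dslope p)^[n] g) p := fun n =>
    ⟨_, hser.has_fpower_series_iterate_dslope_fslope n⟩
  have hval : (Function.swap dslope p)^[k] g p = iteratedDeriv k g p / k.factorial := by
    rw [← (hser.has_fpower_series_iterate_dslope_fslope k).coeff_zero 1]
    change (FormalMultilinearSeries.fslope^[k] q).coeff 0 = _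
    rw [FormalMultilinearSeries.coeff_iterate_fslope, zero_add, hq,
      FormalMultilinearSeries.coeff_ofScalars]
  -- Taylor's formula with exact remainder: iterated `dslope` gives both the Taylor coefficients
  -- (its values at p) and the remainder factor.
  have hexp : ∀ n s, s ≠ p → g s = (∑ i ∈ Finset.range n,
      (Function.swap dslope p)^[i] g p * (s - p) ^ i) +
        (s - p) ^ n * (Function.swap dslope p)^[n] g s := by
    intro n s hs
    induction n with
    | zero => simp
    | succ n ih =>
      rw [ih, Finset.sum_range_succ, Function.iterate_succ_apply', Function.swap,
        dslope_of_ne _ hs, slope_def_field]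
      have := sub_ne_zero.mpr hs
      field_simp
      ring
  -- Division by (s - p)^(k+1) reverses the order: the coefficient of (s - p)^{-(i+2)} is Taylor
  -- coefficient number k - 1 - i.
  refine ⟨k, fun i => (Function.swap dslope p)^[k - 1 - i] g p, _, hit (k + 1), ?_⟩
  filter_upwards [hF, self_mem_nhdsWithin] with s hs hsp
  have hne : s - p ≠ 0 := sub_ne_zero.mpr hsp
  rw [hs, hexp (k + 1) s hsp, Finset.sum_range_succ, hval, add_div, add_div,
    mul_div_cancel_left₀ _ (pow_ne_zero _ hne), ← Finset.sum_range_reflect, Finset.sum_div]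
  have e1 : iteratedDeriv k g p / k.factorial * (s - p) ^ k / (s - p) ^ (k + 1) =
      iteratedDeriv k g p / k.factorial * (s - p)⁻¹ := by
    rw [pow_succ]; field_simp
  rw [e1]
  congr 1
  rw [add_comm]
  congr 1
  refine Finset.sum_congr rfl fun i hi => ?_
  have hi' := Finset.mem_range.mp hi
  have : k + 1 = (k - 1 - i) + (i + 2) := by omega
  rw [this, pow_add (s - p) (k - 1 - i)]
  field_simp

end ThetaZeta

end

noncomputable section

namespace ThetaZeta

open Filter Topology Complex MeasureTheory

/-! ### Exponential decay of the Gamma function on vertical lines -/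

lemma integrableOn_rpow_mul_exp {σ b : ℝ} (hσ : 0 < σ) (hb : 0 < b) :
    IntegrableOn (fun t : ℝ => t ^ (σ - 1) * Real.exp (-b * t)) (Set.Ioi 0) := by
  simpa using integrableOn_rpow_mul_exp_neg_mul_rpow (s := σ - 1) (p := 1) (b := b)
    (by linarith) one_pos hb

lemma norm_laplace_kernel {a r : ℂ} {t : ℝ} (ht : 0 < t) :
    ‖(t : ℂ) ^ (a - 1) * Complex.exp (-(r * t))‖ = t ^ (a.re - 1) * Real.exp (-r.re * t) := by
  rw [norm_mul, Complex.norm_cpow_eq_rpow_re_of_pos ht, Complex.norm_exp]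
  simp

lemma continuousOn_laplace_kernel (a r : ℂ) :
    ContinuousOn (fun t : ℝ => (t : ℂ) ^ (a - 1) * Complex.exp (-(r * t))) (Set.Ioi 0) := by
  refine ContinuousOn.mul (fun t ht => ?_) (by fun_prop)
  exact (Complex.continuousAt_ofReal_cpow_const _ _ (Or.inr (ne_of_gt ht))).continuousWithinAt

lemma differentiableAt_laplace_cpow {a r : ℂ} (ha : 0 < a.re) (hr : 0 < r.re) :
    DifferentiableAt ℂ
      (fun r : ℂ => ∫ t : ℝ in Set.Ioi 0, (t : ℂ) ^ (a - 1) * Complex.exp (-(r * t))) r := by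
  have hmeas : ∀ r : ℂ, AEStronglyMeasurable
      (fun t : ℝ => (t : ℂ) ^ (a - 1) * Complex.exp (-(r * t))) (volume.restrict (Set.Ioi 0)) :=
    fun r => (continuousOn_laplace_kernel a r).aestronglyMeasurable measurableSet_Ioi
  refine (hasDerivAt_integral_of_dominated_loc_of_deriv_le
    (F' := fun r t => (t : ℂ) ^ (a - 1) * Complex.exp (-(r * t)) * (-t))
    (bound := fun t => t ^ ((a.re + 1) - 1) * Real.exp (-(r.re / 2) * t))
    (s := Metric.ball r (r.re / 2)) (Metric.ball_mem_nhds _ (by positivity))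
    (Eventually.of_forall hmeas) ?_ ?_ ?_ ?_ ?_).2.differentiableAt
  · refine Integrable.mono' (integrableOn_rpow_mul_exp ha hr) (hmeas r) ?_
    filter_upwards [ae_restrict_mem measurableSet_Ioi] with t ht
    rw [norm_laplace_kernel ht]
  · exact (hmeas r).mul (by fun_prop)
  · filter_upwards [ae_restrict_mem measurableSet_Ioi] with t ht w hw
    have ht' : 0 < t := ht
    have hre : r.re / 2 ≤ w.re := by
      have h1 := Complex.abs_re_le_norm (w - r)
      rw [Metric.mem_ball, dist_eq_norm] at hw
      have h2 := neg_abs_le (w - r).re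
      rw [Complex.sub_re] at *
      linarith
    rw [norm_mul, norm_laplace_kernel ht', norm_neg, Complex.norm_real, Real.norm_of_nonneg ht'.le]
    have e : t ^ ((a.re + 1) - 1) = t ^ (a.re - 1) * t := by
      rw [← Real.rpow_add_one ht'.ne']; ring_nf
    rw [e]
    have : Real.exp (-w.re * t) ≤ Real.exp (-(r.re / 2) * t) := by
      apply Real.exp_le_exp.mpr; nlinarith
    have h0 : 0 ≤ t ^ (a.re - 1) * t := by positivity
    nlinarith
  · exact integrableOn_rpow_mul_exp (by linarith) (by positivity)
  · refine Eventually.of_forall fun t w _ => ?_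
    have h := (((hasDerivAt_id w).mul_const (t : ℂ)).neg.cexp).const_mul ((t : ℂ) ^ (a - 1))
    refine h.congr_deriv ?_
    simp [mul_assoc]

/-- Both sides are analytic in r on the right half-plane and agree for real r > 1, which accumulate
at 1, so the identity theorem applies. -/
theorem integral_cpow_mul_exp_neg_complex_mul {a r : ℂ} (ha : 0 < a.re) (hr : 0 < r.re) :
    ∫ t : ℝ in Set.Ioi 0, (t : ℂ) ^ (a - 1) * Complex.exp (-(r * t)) = r ^ (-a) * Gamma a := by
  have hopen : IsOpen {r : ℂ | 0 < r.re} := isOpen_lt continuous_const Complex.continuous_re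
  have h1 : AnalyticOnNhd ℂ
      (fun r : ℂ => ∫ t : ℝ in Set.Ioi 0, (t : ℂ) ^ (a - 1) * Complex.exp (-(r * t)))
      {r : ℂ | 0 < r.re} :=
    DifferentiableOn.analyticOnNhd
      (fun r hr => (differentiableAt_laplace_cpow ha hr).differentiableWithinAt) hopen
  have h2 : AnalyticOnNhd ℂ (fun r : ℂ => r ^ (-a) * Gamma a) {r : ℂ | 0 < r.re} := by
    refine DifferentiableOn.analyticOnNhd (fun r hr => ?_) hopen
    exact ((differentiableAt_id.cpow_const (Or.inl hr)).mul_const _).differentiableWithinAt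
  refine h1.eqOn_of_preconnected_of_frequently_eq h2 (convex_halfSpace_re_gt 0).isPreconnected
    (z₀ := 1) (by simp) ?_ hr
  have hlim : Tendsto (fun x : ℝ => (x : ℂ)) (𝓝[>] 1) (𝓝[≠] (1 : ℂ)) := by
    refine tendsto_nhdsWithin_iff.mpr ⟨?_, ?_⟩
    · exact (Complex.continuous_ofReal.tendsto' 1 1 (by simp)).mono_left nhdsWithin_le_nhds
    · filter_upwards [self_mem_nhdsWithin] with x hx
      simpa using ne_of_gt hx
  refine hlim.frequently (Eventually.frequently ?_)
  filter_upwards [self_mem_nhdsWithin] with x hx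
  have hx0 : (0 : ℝ) < x := lt_trans one_pos hx
  rw [Complex.integral_cpow_mul_exp_neg_mul_Ioi ha hx0, one_div, Complex.cpow_neg,
    Complex.inv_cpow _ _ (by rw [Complex.arg_ofReal_of_nonneg hx0.le]; exact Real.pi_pos.ne)]

/-- Taking r = e^{iφ} in the Laplace integral produces the factor e^{φt} on the Gamma side, while
the absolute value of the integral stays bounded in t. The sign of φ is chosen so that φt = θ|t|. -/
lemma norm_Gamma_le_of_re_pos {θ σ t : ℝ} (hθ0 : 0 ≤ θ) (hθ : θ < Real.pi / 2) (hσ : 0 < σ) :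
    ‖Gamma (σ + t * I)‖ ≤ (1 / Real.cos θ) ^ σ * Real.Gamma σ * Real.exp (-θ * |t|) := by
  obtain ⟨φ, hφ, hcos⟩ : ∃ φ : ℝ, t * φ = θ * |t| ∧ |φ| = θ := by
    rcases le_total 0 t with h | h
    · exact ⟨θ, by rw [abs_of_nonneg h, mul_comm], abs_of_nonneg hθ0⟩
    · exact ⟨-θ, by rw [abs_of_nonpos h]; ring, by rw [abs_neg, abs_of_nonneg hθ0]⟩
  have hcos0 : 0 < Real.cos θ := Real.cos_pos_of_mem_Ioo ⟨by linarith [Real.pi_pos], hθ⟩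
  have hcos1 : Real.cos φ = Real.cos θ := by rw [← hcos, Real.cos_abs]
  have hre : (Complex.exp (φ * I)).re = Real.cos θ := by rw [Complex.exp_ofReal_mul_I_re, hcos1]
  have hint := integral_cpow_mul_exp_neg_complex_mul (a := σ + t * I) (r := Complex.exp (φ * I))
    (by simpa) (by rwa [hre])
  have hφ' := abs_lt.mp (hcos.trans_lt hθ)
  have hnorm : ‖Complex.exp (φ * I) ^ (-(σ + t * I))‖ = Real.exp (θ * |t|) := by
    rw [Complex.cpow_def_of_ne_zero (Complex.exp_ne_zero _), Complex.log_exp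
      (by simp; linarith [Real.pi_pos]) (by simp; linarith [Real.pi_pos]), Complex.norm_exp]
    congr 1
    simp [← hφ]; ring
  have hle : ‖∫ u : ℝ in Set.Ioi 0, (u : ℂ) ^ ((σ + t * I : ℂ) - 1) *
      Complex.exp (-(Complex.exp (φ * I) * u))‖ ≤ (1 / Real.cos θ) ^ σ * Real.Gamma σ := by
    rw [← Real.integral_rpow_mul_exp_neg_mul_Ioi hσ hcos0]
    refine (norm_integral_le_integral_norm _).trans (le_of_eq ?_)
    refine setIntegral_congr_fun measurableSet_Ioi fun u hu => ?_
    rw [norm_laplace_kernel hu, hre]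
    simp
  rw [hint, norm_mul, hnorm] at hle
  have : Real.exp (-θ * |t|) * Real.exp (θ * |t|) = 1 := by rw [← Real.exp_add]; simp
  calc ‖Gamma (σ + t * I)‖
      = Real.exp (-θ * |t|) * (Real.exp (θ * |t|) * ‖Gamma (σ + t * I)‖) := by
        rw [← mul_assoc, this, one_mul]
    _ ≤ Real.exp (-θ * |t|) * ((1 / Real.cos θ) ^ σ * Real.Gamma σ) := by gcongr
    _ = _ := by ring

/-- Exponential decay of `Γ` in vertical strips, with the pole at `0` removed. -/
theorem exists_norm_mul_norm_Gamma_le {θ : ℝ} (hθ0 : 0 ≤ θ) (hθ : θ < Real.pi / 2) (B : ℝ) :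
    ∃ C : ℝ, 0 ≤ C ∧ ∀ z : ℂ, -(1 / 2) ≤ z.re → z.re ≤ B →
      ‖z‖ * ‖Gamma z‖ ≤ C * Real.exp (-θ * |z.im|) := by
  have hcos0 : 0 < Real.cos θ := Real.cos_pos_of_mem_Ioo ⟨by linarith [Real.pi_pos], hθ⟩
  have hcont : ContinuousOn (fun σ : ℝ => (1 / Real.cos θ) ^ σ * Real.Gamma σ)
      (Set.Icc (1 / 2) (B + 1)) := by
    refine ContinuousOn.mul ?_ fun σ hσ => ?_
    · exact Continuous.continuousOn (Real.continuous_const_rpow (by positivity))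
    · refine (Real.differentiableAt_Gamma fun m => ?_).continuousAt.continuousWithinAt
      have := hσ.1
      have hm : (0 : ℝ) ≤ m := Nat.cast_nonneg m
      intro h; linarith
  obtain ⟨C, hC⟩ := isCompact_Icc.exists_bound_of_continuousOn hcont
  refine ⟨|C|, abs_nonneg _, fun z h1 h2 => ?_⟩
  rcases eq_or_ne z 0 with rfl | hz
  · simp
  -- Since zΓ(z) = Γ(z + 1), the pole at 0 disappears and the real part moves into the compact range
  -- [1/2, B + 1].
  have hσ : 0 < (z + 1).re := by simp; linarith
  have h := norm_Gamma_le_of_re_pos (t := (z + 1).im) hθ0 hθ hσ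
  rw [Complex.re_add_im, Complex.Gamma_add_one z hz, norm_mul] at h
  refine h.trans ?_
  have hb := hC (z + 1).re ⟨by simp; linarith, by simp; linarith⟩
  have e : (z + 1).im = z.im := by simp
  rw [e]
  gcongr
  exact (le_abs_self _).trans (hb.trans (le_abs_self _))

end ThetaZeta

end

noncomputable section

namespace ThetaZeta

open Filter Topology Complex

/-! ### A minimum modulus theorem -/

/-- Division of the zeros of `f` in a smaller disc by means of Blaschke factors. -/
theorem exists_blaschke_quotient {R r M : ℝ} (hr : 0 < r) (hrR : r < R) {U : Set ℂ}
    (hU : IsOpen U) (hRU : Metric.closedBall (0 : ℂ) R ⊆ U) (n : ℕ) (f : ℂ → ℂ)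
    (hf : DifferentiableOn ℂ f U) (hM : ∀ z ∈ Metric.closedBall (0 : ℂ) R, ‖f z‖ ≤ M)
    (h0 : M * (r / R) ^ n < ‖f 0‖) :
    ∃ (Z : List ℂ) (g : ℂ → ℂ), Z.length ≤ n ∧ DifferentiableOn ℂ g U ∧
      (∀ z ∈ Metric.closedBall (0 : ℂ) R, ‖g z‖ ≤ M) ∧
      (∀ z ∈ Metric.closedBall (0 : ℂ) r, g z ≠ 0) ∧ ‖f 0‖ ≤ ‖g 0‖ ∧
      ∀ z ∈ Metric.closedBall (0 : ℂ) R,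
        ‖g z‖ * (Z.map fun a => ‖z - a‖ / (2 * R)).prod ≤ ‖f z‖ := by
  have hR : 0 < R := hr.trans hrR
  have h0R : (0 : ℂ) ∈ Metric.closedBall (0 : ℂ) R := Metric.mem_closedBall_self hR.le
  -- Each division by a Blaschke factor keeps the bound M on the disc and multiplies the value at 0
  -- by at least R/r. As that value cannot exceed M, the hypothesis `h0` allows at most n divisions.
  induction n generalizing f with
  | zero => simp only [pow_zero, mul_one] at h0; exact absurd (hM 0 h0R) (not_le.mpr h0)
  | succ n ih =>
    by_cases hz : ∀ z ∈ Metric.closedBall (0 : ℂ) r, f z ≠ 0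
    · exact ⟨[], f, by simp, hf, hM, hz, le_rfl, by simp⟩
    push Not at hz
    obtain ⟨a, har, ha⟩ := hz
    have haR : a ∈ Metric.ball (0 : ℂ) R := Metric.closedBall_subset_ball hrR har
    have hM0 : 0 ≤ M := (norm_nonneg _).trans (hM 0 h0R)
    have hf0 : f 0 ≠ 0 := by
      intro h
      rw [h, norm_zero] at h0
      exact absurd h0 (not_lt.mpr (by positivity))
    have ha0 : a ≠ 0 := by rintro rfl; exact hf0 ha
    have haU : U ∈ 𝓝 a := hU.mem_nhds (hRU (Metric.ball_subset_closedBall haR))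
    -- This is f times `canonicalFactor R a`, of modulus 1 on the circle of radius R, written with
    -- `dslope` so as to be holomorphic at the zero a too.
    set f₁ : ℂ → ℂ := fun z => dslope f a z * ((R ^ 2 - (starRingEnd ℂ) a * z) / R) with hf₁
    have hds : ∀ z, f z = (z - a) * dslope f a z := fun z => by
      have := sub_smul_dslope f a z
      rw [ha, sub_zero, smul_eq_mul] at this
      exact this.symm
    have hf₁d : DifferentiableOn ℂ f₁ U :=
      ((Complex.differentiableOn_dslope haU).mpr hf).mul (by fun_prop)
    have hf₁e : ∀ z, z ≠ a → f₁ z = f z * canonicalFactor R a z := fun z hza => by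
      have := sub_ne_zero.mpr hza
      have hR' : (R : ℂ) ≠ 0 := by exact_mod_cast hR.ne'
      simp only [hf₁, hds z, canonicalFactor_apply]
      field_simp
    have hf₁M : ∀ z ∈ Metric.closedBall (0 : ℂ) R, ‖f₁ z‖ ≤ M := by
      have hcl : closure (Metric.ball (0 : ℂ) R) = Metric.closedBall 0 R := closure_ball _ hR.ne'
      intro z hz
      refine Complex.norm_le_of_forall_mem_frontier_norm_le (U := Metric.ball 0 R)
        Metric.isBounded_ball ?_ ?_ (by rwa [hcl])
      · refine DifferentiableOn.diffContOnCl ?_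
        rw [hcl]; exact hf₁d.mono hRU
      · intro w hw
        rw [frontier_ball _ hR.ne'] at hw
        have hwa : w ≠ a := by
          rintro rfl
          rw [mem_sphere_zero_iff_norm] at hw
          rw [mem_ball_zero_iff] at haR
          exact haR.ne hw
        rw [hf₁e w hwa, norm_mul, norm_canonicalFactor_eval_circle_eq_one haR hw, mul_one]
        exact hM w (Metric.sphere_subset_closedBall hw)
    have hf₁0 : ‖f 0‖ * (R / r) ≤ ‖f₁ 0‖ := by
      rw [hf₁e 0 ha0.symm, norm_mul, canonicalFactor_apply]
      refine mul_le_mul_of_nonneg_left ?_ (norm_nonneg _)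
      have hna : 0 < ‖a‖ := norm_pos_iff.mpr ha0
      have : ‖((R : ℂ) ^ 2 - (starRingEnd ℂ) a * 0) / (R * (0 - a))‖ = R / ‖a‖ := by
        rw [mul_zero, sub_zero, zero_sub, norm_div, norm_mul, norm_neg, norm_pow, Complex.norm_real,
          Real.norm_of_nonneg hR.le]
        field_simp
      rw [this]
      rw [mem_closedBall_zero_iff] at har
      gcongr
    have h1 : M * (r / R) ^ n < ‖f₁ 0‖ := by
      refine lt_of_lt_of_le ?_ hf₁0
      have : M * (r / R) ^ n = M * (r / R) ^ (n + 1) * (R / r) := by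
        rw [pow_succ]; field_simp
      rw [this]
      gcongr
    obtain ⟨Z, g, hZ, hgd, hgM, hgn, hg0, hgf⟩ := ih f₁ hf₁d hf₁M h1
    refine ⟨a :: Z, g, by simpa using hZ, hgd, hgM, hgn, ?_, fun z hz => ?_⟩
    · refine le_trans ?_ (hf₁0.trans hg0)
      exact le_mul_of_one_le_right (norm_nonneg _) ((one_le_div hr).mpr hrR.le)
    · have h2 := hgf z hz
      rw [List.map_cons, List.prod_cons]
      have h3 : ‖f₁ z‖ * (‖z - a‖ / (2 * R)) ≤ ‖f z‖ := by
        have h4 : ‖(R : ℂ) ^ 2 - (starRingEnd ℂ) a * z‖ ≤ 2 * R ^ 2 := by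
          refine (norm_sub_le _ _).trans ?_
          rw [norm_mul, norm_pow, Complex.norm_real, Real.norm_of_nonneg hR.le, Complex.norm_conj]
          rw [mem_closedBall_zero_iff] at hz
          rw [mem_ball_zero_iff] at haR
          nlinarith [norm_nonneg a, norm_nonneg z]
        rw [hds z, hf₁, norm_mul, norm_mul, norm_div, Complex.norm_real, Real.norm_of_nonneg hR.le]
        calc ‖dslope f a z‖ * (‖(R : ℂ) ^ 2 - (starRingEnd ℂ) a * z‖ / R) * (‖z - a‖ / (2 * R))
            ≤ ‖dslope f a z‖ * (2 * R ^ 2 / R) * (‖z - a‖ / (2 * R)) := by gcongr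
          _ = ‖z - a‖ * ‖dslope f a z‖ := by field_simp
      calc ‖g z‖ * (‖z - a‖ / (2 * R) * (Z.map fun a => ‖z - a‖ / (2 * R)).prod)
          = ‖g z‖ * (Z.map fun a => ‖z - a‖ / (2 * R)).prod * (‖z - a‖ / (2 * R)) := by ring
        _ ≤ ‖f₁ z‖ * (‖z - a‖ / (2 * R)) := by gcongr
        _ ≤ ‖f z‖ := h3

/-- A lower bound for a function without zeros in a disc. -/
theorem norm_ge_of_ne_zero {r ρ M K : ℝ} {g : ℂ → ℂ} (hρ : 0 ≤ ρ) (hρr : ρ < r)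
    (hg : DifferentiableOn ℂ g (Metric.ball 0 r)) (hg0 : ∀ z ∈ Metric.ball (0 : ℂ) r, g z ≠ 0)
    (hM : ∀ z ∈ Metric.ball (0 : ℂ) r, ‖g z‖ ≤ M) (hK : 0 < K) (hMK : M ≤ ‖g 0‖ * Real.exp K)
    {z : ℂ} (hz : ‖z‖ ≤ ρ) :
    ‖g 0‖ * Real.exp (-(2 * K * ρ / (r - ρ))) ≤ ‖g z‖ := by
  have hr : 0 < r := hρ.trans_lt hρr
  have h0r : (0 : ℂ) ∈ Metric.ball (0 : ℂ) r := Metric.mem_ball_self hr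
  have hd : DifferentiableOn ℂ (fun z => deriv g z / g z) (Metric.ball 0 r) :=
    (hg.deriv Metric.isOpen_ball).div hg hg0
  -- h is a logarithm of g/g(0) normalised by h(0) = 0. Its real part is at most K, so
  -- Borel–Carathéodory bounds |h| and hence bounds |g| from below.
  obtain ⟨h, hh⟩ := hd.isExactOn_ball.with_val_at (0 : ℂ) (0 : ℂ)
  have hconst : ∀ w ∈ Metric.ball (0 : ℂ) r, g w * Complex.exp (-h w) = g 0 := by
    have hderiv : ∀ w ∈ Metric.ball (0 : ℂ) r,
        HasDerivAt (fun w => g w * Complex.exp (-h w)) 0 w := fun w hw => by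
      have h1 := (hg.differentiableAt (Metric.isOpen_ball.mem_nhds hw)).hasDerivAt
      refine (h1.mul (hh.2 w hw).neg.cexp).congr_deriv ?_
      have := hg0 w hw
      field_simp
      ring
    intro w hw
    have := (convex_ball (0 : ℂ) r).is_const_of_fderivWithin_eq_zero (𝕜 := ℂ)
      (f := fun w => g w * Complex.exp (-h w))
      (fun w hw => (hderiv w hw).differentiableAt.differentiableWithinAt) (fun w hw => by
        rw [fderivWithin_of_isOpen Metric.isOpen_ball hw]
        ext; simp [(hderiv w hw).deriv]) hw h0r
    simpa [hh.1] using this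
  have hexp : ∀ w ∈ Metric.ball (0 : ℂ) r, ‖g w‖ = ‖g 0‖ * Real.exp (h w).re := fun w hw => by
    rw [← hconst w hw, norm_mul, Complex.norm_exp, mul_assoc, ← Real.exp_add]
    simp
  have hg00 : 0 < ‖g 0‖ := norm_pos_iff.mpr (hg0 0 h0r)
  have hzr : z ∈ Metric.ball (0 : ℂ) r := by rw [mem_ball_zero_iff]; linarith
  have hre : Set.MapsTo h (Metric.ball 0 r) {z | z.re ≤ K} := fun w hw => by
    have h2 := (hM w hw).trans hMK
    rw [hexp w hw] at h2
    exact Real.exp_le_exp.mp (le_of_mul_le_mul_left h2 hg00)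
  have hbc := Complex.borelCaratheodory_zero hK
    (fun w hw => (hh.2 w hw).differentiableAt.differentiableWithinAt) hre hr hzr hh.1
  rw [hexp z hzr]
  gcongr
  have h3 : 2 * K * ‖z‖ / (r - ‖z‖) ≤ 2 * K * ρ / (r - ρ) := by
    have : 0 < r - ρ := by linarith
    gcongr
  have h4 := neg_abs_le (h z).re
  have h5 := Complex.abs_re_le_norm (h z)
  linarith

lemma pow_le_list_prod {Z : List ℂ} {φ : ℂ → ℝ} {q : ℝ} {n : ℕ} (hq0 : 0 ≤ q) (hq1 : q ≤ 1)
    (hZ : Z.length ≤ n) (h : ∀ a ∈ Z, q ≤ φ a) : q ^ n ≤ (Z.map φ).prod := by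
  have h1 : q ^ Z.length ≤ (Z.map φ).prod := by
    clear hZ
    induction Z with
    | nil => simp
    | cons a Z ih =>
      rw [List.length_cons, pow_succ', List.map_cons, List.prod_cons]
      have h2 := ih fun b hb => h b (List.mem_cons_of_mem _ hb)
      have h3 := h a List.mem_cons_self
      have h4 : 0 ≤ q ^ Z.length := by positivity
      gcongr
      exact hq0.trans h3
  exact (pow_le_pow_of_le_one hq0 hq1 hZ).trans h1

/-- Among `n + 1` equally spaced heights one is far from `n` given points. -/
lemma exists_far_height {n : ℕ} (Z : List ℂ) (hZ : Z.length ≤ n) (t₀ : ℝ) :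
    ∃ j : ℕ, j ≤ n ∧ ∀ a ∈ Z, 1 / (2 * (n + 1) : ℝ) ≤ |t₀ + j / (n + 1) - a.im| := by
  classical
  by_contra! hcon
  choose φ hφ1 hφ2 using fun j : Fin (n + 1) => hcon j (Nat.lt_succ_iff.mp j.2)
  have hcard : Z.toFinset.card < (Finset.univ : Finset (Fin (n + 1))).card := by
    rw [Finset.card_univ, Fintype.card_fin]
    -- Pigeonhole: if every height were close to a point, two of the n + 1 heights would share one,
    -- yet they are at least 1/(n + 1) apart and each lies closer than half of that to it.
    exact Nat.lt_succ_of_le ((List.toFinset_card_le Z).trans hZ)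
  obtain ⟨i, -, j, -, hij, hφ⟩ := Finset.exists_ne_map_eq_of_card_lt_of_maps_to hcard
    (f := φ) (fun j _ => by simpa using hφ1 j)
  have h1 := abs_lt.mp (hφ2 i)
  have h2 := abs_lt.mp (hφ2 j)
  rw [← hφ] at h2
  have hn : (0 : ℝ) < n + 1 := by positivity
  have e : (1 : ℝ) / (n + 1) = 1 / (2 * (n + 1)) + 1 / (2 * (n + 1)) := by field_simp; norm_num
  have key : ∀ i j : Fin (n + 1), i < j → (i : ℝ) / (n + 1) + 1 / (n + 1) ≤ (j : ℝ) / (n + 1) := by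
    intro i j hij
    rw [← add_div]
    gcongr
    exact_mod_cast hij
  rcases lt_or_gt_of_ne hij with h | h
  · have := key i j h; linarith
  · have := key j i h; linarith

/-! ### Growth of the zeta function -/

/-- The terms of the series `∑ n^{-s} - ∫ x^{-s} dx`, multiplied by `s - 1`. -/
def zetaTerm (n : ℕ) (s : ℂ) : ℂ :=
  (s - 1) * ((n + 1 : ℝ) : ℂ) ^ (-s) + ((n + 2 : ℝ) : ℂ) ^ (1 - s) - ((n + 1 : ℝ) : ℂ) ^ (1 - s)

lemma hasDerivAt_ofReal_add_cpow {N u : ℝ} (hN : 0 < N) (hu : 0 ≤ u) (w : ℂ) :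
    HasDerivAt (fun u : ℝ => ((N + u : ℝ) : ℂ) ^ w) (w * ((N + u : ℝ) : ℂ) ^ (w - 1)) u := by
  have h1 : HasDerivAt (fun u : ℝ => ((N + u : ℝ) : ℂ)) 1 u := by
    simpa using ((hasDerivAt_id u).const_add N).ofReal_comp
  have hs : ((N + u : ℝ) : ℂ) ∈ slitPlane := Or.inl (by rw [Complex.ofReal_re]; linarith)
  have h2 := ((hasDerivAt_id ((N + u : ℝ) : ℂ)).cpow_const (c := w) hs).comp
    (h₂ := fun z => z ^ w) (h := fun u : ℝ => ((N + u : ℝ) : ℂ)) u h1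
  simp only [id_eq, mul_one] at h2
  exact h2

lemma norm_ofReal_cpow_sub_le {N u : ℝ} (hN : 0 < N) (hu : u ∈ Set.Icc (0 : ℝ) 1) {s : ℂ}
    (hs : 0 ≤ s.re) :
    ‖((N + u : ℝ) : ℂ) ^ (-s) - (N : ℂ) ^ (-s)‖ ≤ ‖s‖ * N ^ (-s.re - 1) := by
  have h := norm_image_sub_le_of_norm_deriv_le_segment'
    (f := fun u : ℝ => ((N + u : ℝ) : ℂ) ^ (-s)) (a := 0) (b := 1) (C := ‖s‖ * N ^ (-s.re - 1))
    (fun u hu => (hasDerivAt_ofReal_add_cpow hN hu.1 (-s)).hasDerivWithinAt) (fun u hu => by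
      have hNu : 0 < N + u := by linarith [hu.1]
      rw [norm_mul, norm_neg, Complex.norm_cpow_eq_rpow_re_of_pos hNu]
      simp only [Complex.sub_re, Complex.neg_re, Complex.one_re]
      refine mul_le_mul_of_nonneg_left ?_ (norm_nonneg _)
      exact Real.rpow_le_rpow_of_nonpos hN (by linarith [hu.1]) (by linarith)) u hu
  simp only [add_zero, sub_zero] at h
  refine h.trans (mul_le_of_le_one_right (by positivity) hu.2)

/-- With N = n + 1 the term is (s - 1) ∫₀¹ (N^{-s} - (N+u)^{-s}) du, and the difference gains a
factor |s|/N. The extra power of N makes the series converge for Re s > 0. -/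
lemma norm_zetaTerm_le (n : ℕ) {s : ℂ} (hs : 0 ≤ s.re) :
    ‖zetaTerm n s‖ ≤ ‖s - 1‖ * ‖s‖ * (n + 1 : ℝ) ^ (-s.re - 1) := by
  have hN : (0 : ℝ) < n + 1 := by positivity
  have h := norm_image_sub_le_of_norm_deriv_le_segment'
    (f := fun u : ℝ => ((n + 1 + u : ℝ) : ℂ) ^ (1 - s) - (u : ℂ) * ((1 - s) * ((n + 1 : ℝ) : ℂ) ^ (-s)))
    (a := 0) (b := 1) (C := ‖s - 1‖ * ‖s‖ * (n + 1 : ℝ) ^ (-s.re - 1))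
    (fun u hu => ((hasDerivAt_ofReal_add_cpow hN hu.1 (1 - s)).sub
      ((hasDerivAt_id u).ofReal_comp.mul_const
        ((1 - s) * ((n + 1 : ℝ) : ℂ) ^ (-s)))).hasDerivWithinAt) (fun u hu => by
      have e : (1 - s) - 1 = -s := by ring
      have h1 := norm_ofReal_cpow_sub_le hN ⟨hu.1, hu.2.le⟩ hs
      rw [e, Complex.ofReal_one, one_mul, ← mul_sub, norm_mul, norm_sub_rev 1 s, mul_assoc]
      exact mul_le_mul_of_nonneg_left h1 (norm_nonneg _)) 1 (by simp)
  simp only [sub_zero, mul_one, add_zero, Complex.ofReal_zero, zero_mul, Complex.ofReal_one,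
    one_mul] at h
  refine le_of_eq_of_le (congrArg _ ?_) h
  have e : (n + 1 + 1 : ℝ) = n + 2 := by ring
  rw [zetaTerm, e]
  ring

lemma differentiable_zetaTerm (n : ℕ) : Differentiable ℂ (zetaTerm n) := by
  have h1 : ((n + 1 : ℝ) : ℂ) ≠ 0 := by exact_mod_cast Nat.succ_ne_zero n
  have h2 : ((n + 2 : ℝ) : ℂ) ≠ 0 := by exact_mod_cast Nat.succ_ne_zero (n + 1)
  intro s
  unfold zetaTerm
  exact (((by fun_prop : DifferentiableAt ℂ (fun s : ℂ => s - 1) s).mul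
    ((by fun_prop : DifferentiableAt ℂ (fun s : ℂ => -s) s).const_cpow (Or.inl h1))).add
    ((by fun_prop : DifferentiableAt ℂ (fun s : ℂ => 1 - s) s).const_cpow (Or.inl h2))).sub
    ((by fun_prop : DifferentiableAt ℂ (fun s : ℂ => 1 - s) s).const_cpow (Or.inl h1))

lemma summable_add_one_rpow {σ : ℝ} (hσ : 0 < σ) :
    Summable (fun n : ℕ => (n + 1 : ℝ) ^ (-σ - 1)) := by
  have h := (summable_nat_add_iff 1).mpr
    (Real.summable_nat_rpow.mpr (by linarith : -σ - 1 < -1))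
  simpa using h

lemma summable_zetaTerm {s : ℂ} (hs : 0 < s.re) : Summable (fun n => zetaTerm n s) :=
  Summable.of_norm_bounded ((summable_add_one_rpow hs).mul_left _)
    fun n => norm_zetaTerm_le n hs.le

/-- The terms (n+2)^{1-s} - (n+1)^{1-s} telescope, and the boundary term tends to 0 for Re s > 1. -/
lemma tsum_zetaTerm_of_one_lt_re {s : ℂ} (hs : 1 < s.re) :
    1 + ∑' n, zetaTerm n s = (s - 1) * riemannZeta s := by
  have hs' : s ≠ 0 := by rintro rfl; norm_num at hs
  have h1 : Tendsto (fun M : ℕ => 1 + ∑ n ∈ Finset.range M, zetaTerm n s) atTop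
      (𝓝 (1 + ∑' n, zetaTerm n s)) :=
    (summable_zetaTerm (by linarith)).hasSum.tendsto_sum_nat.const_add 1
  have hz : HasSum (fun n : ℕ => ((n + 1 : ℝ) : ℂ) ^ (-s)) (riemannZeta s) := by
    rw [zeta_eq_tsum_one_div_nat_add_one_cpow hs]
    have hsum : Summable (fun n : ℕ => 1 / ((n : ℂ) + 1) ^ s) := by
      have := (summable_nat_add_iff 1).mpr (Complex.summable_one_div_nat_cpow.mpr hs)
      simpa using this
    convert hsum.hasSum using 2 with n
    rw [Complex.cpow_neg, one_div]
    push_cast; rfl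
  have h2 : ∀ M : ℕ, 1 + ∑ n ∈ Finset.range M, zetaTerm n s =
      (s - 1) * ∑ n ∈ Finset.range M, ((n + 1 : ℝ) : ℂ) ^ (-s) + ((M + 1 : ℝ) : ℂ) ^ (1 - s) := by
    intro M
    induction M with
    | zero => simp
    | succ M ih =>
      rw [Finset.sum_range_succ, ← add_assoc, ih, Finset.sum_range_succ, zetaTerm]
      have : ((M + 1 : ℕ) + 1 : ℝ) = M + 2 := by push_cast; ring
      rw [this]
      ring
  have h3 : Tendsto (fun M : ℕ => ((M + 1 : ℝ) : ℂ) ^ (1 - s)) atTop (𝓝 0) := by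
    rw [tendsto_zero_iff_norm_tendsto_zero]
    have : ∀ M : ℕ, ‖((M + 1 : ℝ) : ℂ) ^ (1 - s)‖ = (M + 1 : ℝ) ^ (-(s.re - 1)) := fun M => by
      rw [Complex.norm_cpow_eq_rpow_re_of_pos (by positivity)]; simp
    simp_rw [this]
    exact (tendsto_rpow_neg_atTop (by linarith)).comp
      (tendsto_natCast_atTop_atTop.atTop_add tendsto_const_nhds)
  have h4 := (hz.tendsto_sum_nat.const_mul (s - 1)).add h3
  rw [add_zero] at h4
  simp_rw [h2] at h1
  exact tendsto_nhds_unique h1 h4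

/-- The identity theorem extends the previous formula; local uniform convergence of the series makes
the right side analytic on Re s > 0. -/
lemma riemannZeta₁_eq_tsum {s : ℂ} (hs : 0 < s.re) :
    riemannZeta₁ s = 1 + ∑' n, zetaTerm n s := by
  have hopen : IsOpen {s : ℂ | 0 < s.re} := isOpen_lt continuous_const Complex.continuous_re
  have h1 : AnalyticOnNhd ℂ riemannZeta₁ {s : ℂ | 0 < s.re} :=
    differentiable_riemannZeta₁.differentiableOn.analyticOnNhd hopen
  have h2 : AnalyticOnNhd ℂ (fun s => 1 + ∑' n, zetaTerm n s) {s : ℂ | 0 < s.re} := by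
    refine DifferentiableOn.analyticOnNhd (DifferentiableOn.const_add _ ?_) hopen
    intro w hw
    have hw' : 0 < w.re := hw
    set V : Set ℂ := {s | w.re / 2 < s.re} ∩ Metric.ball 0 (‖w‖ + 1) with hV
    have hVo : IsOpen V :=
      (isOpen_lt continuous_const Complex.continuous_re).inter Metric.isOpen_ball
    have hwV : w ∈ V := ⟨by change w.re / 2 < w.re; linarith, by simp⟩
    refine (DifferentiableOn.differentiableAt (s := V) ?_
      (hVo.mem_nhds hwV)).differentiableWithinAt
    refine Complex.differentiableOn_tsum_of_summable_norm
      (u := fun n : ℕ => (‖w‖ + 2) * (‖w‖ + 1) * (n + 1 : ℝ) ^ (-(w.re / 2) - 1))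
      ((summable_add_one_rpow (by linarith)).mul_left _)
      (fun n => (differentiable_zetaTerm n).differentiableOn) hVo fun n s hs => ?_
    have hs1 : w.re / 2 < s.re := hs.1
    have hs2 : ‖s‖ < ‖w‖ + 1 := by simpa using hs.2
    refine (norm_zetaTerm_le n (by linarith)).trans ?_
    have hs3 : ‖s - 1‖ ≤ ‖w‖ + 2 := (norm_sub_le _ _).trans (by rw [norm_one]; linarith)
    gcongr
    simp
  refine h1.eqOn_of_preconnected_of_eventuallyEq h2 (convex_halfSpace_re_gt 0).isPreconnected
    (z₀ := 2) (by simp) ?_ hs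
  filter_upwards [(isOpen_lt continuous_const Complex.continuous_re).mem_nhds
    (show (1 : ℝ) < (2 : ℂ).re by norm_num)] with z hz
  have hz1 : z ≠ 1 := by rintro rfl; norm_num at hz
  rw [tsum_zetaTerm_of_one_lt_re hz, riemannZeta_eq_inv_sub_mul hz1, ← mul_assoc,
    mul_inv_cancel₀ (sub_ne_zero.mpr hz1), one_mul]

/-- Linear growth of `ζ` to the right of the imaginary axis. -/
theorem exists_norm_riemannZeta_le {σ : ℝ} (hσ : 0 < σ) :
    ∃ C : ℝ, 0 < C ∧ ∀ s : ℂ, σ ≤ s.re → 1 ≤ |s.im| → ‖riemannZeta s‖ ≤ C * ‖s‖ := by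
  set S := ∑' n : ℕ, (n + 1 : ℝ) ^ (-σ - 1)
  have hS : 0 ≤ S := tsum_nonneg fun n => by positivity
  refine ⟨1 + S, by positivity, fun s hs him => ?_⟩
  have hs1 : 1 ≤ ‖s - 1‖ := by
    have := Complex.abs_im_le_norm (s - 1)
    simp only [Complex.sub_im, Complex.one_im, sub_zero] at this
    linarith
  have hs2 : 1 ≤ ‖s‖ := him.trans (Complex.abs_im_le_norm s)
  have hne : s ≠ 1 := by rintro rfl; simp at hs1; linarith
  have hb : ‖riemannZeta₁ s‖ ≤ 1 + ‖s - 1‖ * ‖s‖ * S := by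
    rw [riemannZeta₁_eq_tsum (hσ.trans_le hs)]
    refine (norm_add_le _ _).trans ?_
    rw [norm_one]
    refine add_le_add le_rfl (tsum_of_norm_bounded
      ((summable_add_one_rpow hσ).hasSum.mul_left (‖s - 1‖ * ‖s‖)) fun n => ?_)
    refine (norm_zetaTerm_le n (by linarith)).trans ?_
    gcongr
    simp
  rw [riemannZeta_eq_inv_sub_mul hne, norm_mul, norm_inv, inv_mul_le_iff₀ (by linarith)]
  refine hb.trans ?_
  nlinarith [mul_nonneg (norm_nonneg (s - 1)) hS, mul_le_mul hs1 hs2 zero_le_one (norm_nonneg _)]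

/-! ### Lower bounds for ζ -/

lemma exists_le_norm_riemannZeta {σ : ℝ} (hσ : 1 < σ) :
    ∃ c : ℝ, 0 < c ∧ ∀ s : ℂ, s.re = σ → c ≤ ‖riemannZeta s‖ := by
  have hsum : ∀ s : ℂ, s.re = σ → HasSum
      (fun n => ‖LSeries.term (fun n => (mu 1 n : ℂ)) (σ : ℂ) n‖)
      (∑' n, ‖LSeries.term (fun n => (mu 1 n : ℂ)) (σ : ℂ) n‖) := fun s hs =>
    ((LSeriesHasSum_mu 1 (s := (σ : ℂ)) (by simpa)).LSeriesSummable.norm).hasSum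
  set D := ∑' n, ‖LSeries.term (fun n => (mu 1 n : ℂ)) (σ : ℂ) n‖
  have hD : 0 ≤ D := tsum_nonneg fun n => norm_nonneg _
  refine ⟨1 / (D + 1), by positivity, fun s hs => ?_⟩
  have hz : riemannZeta s ≠ 0 := riemannZeta_ne_zero_of_one_lt_re (by rw [hs]; exact hσ)
  -- 1/ζ(s) is the sum of μ(n) n^{-s}, so it is bounded by ∑ |μ(n)| n^{-σ}, independently of Im s.
  have h := HasSum.norm_le_of_bounded (LSeriesHasSum_mu 1 (s := s) (by rw [hs]; exact hσ))
    (hsum s hs) (fun n => by rw [LSeries.norm_term_eq, LSeries.norm_term_eq, hs, Complex.ofReal_re])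
  rw [pow_one, norm_inv] at h
  have hpos : 0 < ‖riemannZeta s‖ := norm_pos_iff.mpr hz
  rw [div_le_iff₀ (by positivity)]
  rw [inv_le_iff_one_le_mul₀ hpos] at h
  nlinarith

/-- A lower bound for `ζ` on horizontal segments at suitable heights. -/
theorem exists_height_le_norm_riemannZeta : ∃ (C c : ℝ), 0 < C ∧ 0 < c ∧ ∀ᶠ n : ℕ in atTop,
    ∃ t ∈ Set.Icc ((n : ℝ) ^ 2) (n ^ 2 + 1), ∀ σ ∈ Set.Icc (1 / 2 : ℝ) 2,
      c * Real.exp (-(16 * Real.log (C * n ^ 2))) * (1 / (8 * (n + 1) : ℝ)) ^ n ≤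
        ‖riemannZeta (σ + t * I)‖ := by
  obtain ⟨C₁, hC₁, hup⟩ := exists_norm_riemannZeta_le (σ := 1 / 10) (by norm_num)
  obtain ⟨c, hc, hlow⟩ := exists_le_norm_riemannZeta (σ := 2) (by norm_num)
  refine ⟨2 * C₁ / c, c, by positivity, hc, ?_⟩
  -- 18/19 is the ratio of the radii 9/5 and 19/10; once M(18/19)^n < c, at most n zeros have to be
  -- divided out.
  have hlim : Tendsto (fun n : ℕ => 2 * C₁ * ((n : ℝ) ^ 2 * (18 / 19 : ℝ) ^ n)) atTop (𝓝 0) := by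
    simpa using (tendsto_pow_const_mul_const_pow_of_abs_lt_one 2 (r := (18 / 19 : ℝ))
      (by rw [abs_of_pos] <;> norm_num)).const_mul (2 * C₁)
  have hlog : Tendsto (fun n : ℕ => 2 * C₁ / c * (n : ℝ) ^ 2) atTop atTop :=
    ((tendsto_pow_atTop two_ne_zero).comp tendsto_natCast_atTop_atTop).const_mul_atTop
      (by positivity)
  filter_upwards [hlim.eventually_lt_const hc, eventually_ge_atTop 3,
    hlog.eventually_gt_atTop 1] with n hn hn3 hK
  have hn3' : (3 : ℝ) ≤ n := by exact_mod_cast hn3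
  have hn9 : (9 : ℝ) ≤ n ^ 2 := by nlinarith
  -- Around the centre 2 + iT₀ the disc of radius 19/10 stays in Re s ≥ 1/10, where ζ grows
  -- linearly. The disc of radius 8/5 contains 1/2 ≤ Re s ≤ 2 with |Im s - T₀| ≤ 1/2, because (3/2)²
  -- + (1/2)² < (8/5)².
  set T₀ : ℝ := n ^ 2 + 1 / 2 with hT₀
  set s₀ : ℂ := 2 + T₀ * I with hs₀
  set f : ℂ → ℂ := fun z => riemannZeta (s₀ + z) with hf
  have hre : ∀ z : ℂ, (s₀ + z).re = 2 + z.re := fun z => by simp [hs₀]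
  have him : ∀ z : ℂ, (s₀ + z).im = T₀ + z.im := fun z => by simp [hs₀]
  have hfd : DifferentiableOn ℂ f (Metric.ball 0 2) := by
    intro z hz
    rw [mem_ball_zero_iff] at hz
    have h1 : s₀ + z ≠ 1 := by
      intro h
      have h2 := congrArg Complex.im h
      rw [him, Complex.one_im] at h2
      have h3 := Complex.abs_im_le_norm z
      have h4 := neg_abs_le z.im
      linarith
    exact ((differentiableAt_riemannZeta h1).comp z
      (by fun_prop : DifferentiableAt ℂ (fun z => s₀ + z) z)).differentiableWithinAt
  have hM : ∀ z ∈ Metric.closedBall (0 : ℂ) (19 / 10), ‖f z‖ ≤ 2 * C₁ * n ^ 2 := by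
    intro z hz
    rw [mem_closedBall_zero_iff] at hz
    have h1 := abs_le.mp ((Complex.abs_re_le_norm z).trans hz)
    have h2 := abs_le.mp ((Complex.abs_im_le_norm z).trans hz)
    refine (hup (s₀ + z) (by rw [hre]; linarith) ?_).trans ?_
    · rw [him, abs_of_nonneg (by linarith)]; linarith
    · have h3 : ‖s₀ + z‖ ≤ 2 + T₀ + 19 / 10 := by
        refine (norm_add_le _ _).trans (add_le_add ?_ hz)
        refine (norm_add_le _ _).trans ?_
        rw [norm_mul, Complex.norm_I, mul_one, Complex.norm_real, Real.norm_of_nonneg (by linarith)]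
        simp
      have : ‖s₀ + z‖ ≤ 2 * n ^ 2 := by linarith
      calc C₁ * ‖s₀ + z‖ ≤ C₁ * (2 * n ^ 2) := by gcongr
        _ = _ := by ring
  have hf0 : c ≤ ‖f 0‖ := hlow _ (by rw [hre]; simp)
  obtain ⟨Z, g, hZ, hgd, hgM, hgn, hg0, hgf⟩ := exists_blaschke_quotient (r := 9 / 5)
    (R := 19 / 10) (by norm_num) (by norm_num) Metric.isOpen_ball
    (Metric.closedBall_subset_ball (by norm_num)) n f hfd hM (by
      refine lt_of_lt_of_le ?_ hf0
      refine lt_of_eq_of_lt ?_ hn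
      norm_num
      ring)
  obtain ⟨j, hj, hjZ⟩ := exists_far_height Z hZ (-(1 / 2))
  have hj1 : (0 : ℝ) ≤ j / (n + 1) := by positivity
  have hj2 : (j : ℝ) / (n + 1) ≤ 1 := by
    rw [div_le_one (by positivity)]
    have : (j : ℝ) ≤ n := by exact_mod_cast hj
    linarith
  refine ⟨n ^ 2 + j / (n + 1), ⟨by linarith, by linarith⟩, fun σ hσ => ?_⟩
  set z : ℂ := ((σ - 2 : ℝ) : ℂ) + ((-(1 / 2) + j / (n + 1) : ℝ) : ℂ) * I with hz
  have hri : ∀ a b : ℝ, ((a : ℂ) + b * I).re = a ∧ ((a : ℂ) + b * I).im = b := by simp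
  have hzre : z.re = σ - 2 := (hri _ _).1
  have hzim : z.im = -(1 / 2) + j / (n + 1) := (hri _ _).2
  have hzeq : (σ + ((n ^ 2 + j / (n + 1) : ℝ) : ℂ) * I : ℂ) = s₀ + z := by
    apply Complex.ext
    · rw [hre, hzre, (hri _ _).1]; ring
    · rw [him, hzim, hT₀, (hri _ _).2]; ring
  have hznorm : ‖z‖ ≤ 8 / 5 := by
    have h1 : ‖z‖ ^ 2 ≤ (8 / 5) ^ 2 := by
      rw [Complex.sq_norm, Complex.normSq_apply, hzre, hzim]
      nlinarith [hσ.1, hσ.2]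
    exact le_of_sq_le_sq h1 (by norm_num)
  rw [hzeq]
  have hlogpos : 0 < Real.log (2 * C₁ / c * n ^ 2) := Real.log_pos hK
  have hgl := norm_ge_of_ne_zero (r := 9 / 5) (ρ := 8 / 5) (M := 2 * C₁ * n ^ 2)
    (K := Real.log (2 * C₁ / c * n ^ 2)) (g := g) (by norm_num) (by norm_num)
    (hgd.mono (Metric.ball_subset_ball (by norm_num)))
    (fun w hw => hgn w (Metric.ball_subset_closedBall hw))
    (fun w hw => hgM w (Metric.closedBall_subset_closedBall (by norm_num)
      (Metric.ball_subset_closedBall hw))) hlogpos (by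
      rw [Real.exp_log (by positivity)]
      calc 2 * C₁ * (n : ℝ) ^ 2 = c * (2 * C₁ / c * n ^ 2) := by field_simp
        _ ≤ ‖g 0‖ * (2 * C₁ / c * n ^ 2) := by gcongr; exact hf0.trans hg0) hznorm
  -- The distance 1/(2(n+1)) to each zero, divided by 2R = 19/5 ≤ 4, leaves at least 1/(8(n+1)) per
  -- Blaschke factor.
  have hprod := pow_le_list_prod (Z := Z) (φ := fun a => ‖z - a‖ / (2 * (19 / 10)))
    (q := 1 / (8 * (n + 1))) (n := n) (by positivity)
    (by rw [div_le_one (by positivity)]; linarith) hZ (fun a ha => by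
      have h1 := hjZ a ha
      have h2 : |z.im - a.im| ≤ ‖z - a‖ := by
        rw [← Complex.sub_im]; exact Complex.abs_im_le_norm _
      rw [hzim] at h2
      have h3 := h1.trans h2
      have e : (1 : ℝ) / (8 * (n + 1)) = 1 / (2 * (n + 1)) / 4 := by field_simp; norm_num
      rw [e]
      refine div_le_div₀ (norm_nonneg _) h3 (by norm_num) (by norm_num))
  have hfin := hgf z (by rw [mem_closedBall_zero_iff]; linarith)
  refine le_trans ?_ hfin
  -- The constant 16 is 2ρ/(r - ρ) with ρ = 8/5 and r = 9/5.
  have e : -(2 * Real.log (2 * C₁ / c * n ^ 2) * (8 / 5) / (9 / 5 - 8 / 5)) =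
      -(16 * Real.log (2 * C₁ / c * n ^ 2)) := by ring
  rw [e] at hgl
  have h4 : c * Real.exp (-(16 * Real.log (2 * C₁ / c * n ^ 2))) ≤ ‖g z‖ :=
    le_trans (by gcongr; exact hf0.trans hg0) hgl
  gcongr

/-- There are heights tending to infinity along which `1 / ζ` grows subexponentially. -/
theorem exists_heights : ∃ t : ℕ → ℝ, Tendsto t atTop atTop ∧ ∀ ε : ℝ, 0 < ε →
    ∀ᶠ n in atTop, ∀ σ ∈ Set.Icc (1 / 2 : ℝ) 2,
      Real.exp (-ε * t n) ≤ ‖riemannZeta (σ + t n * I)‖ := by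
  obtain ⟨C, c, hC, hc, hev⟩ := exists_height_le_norm_riemannZeta
  obtain ⟨N, hN⟩ := eventually_atTop.mp hev
  choose! t ht hζ using hN
  have hsq : Tendsto (fun n : ℕ => (n : ℝ) ^ 2) atTop atTop :=
    (tendsto_pow_atTop two_ne_zero).comp tendsto_natCast_atTop_atTop
  refine ⟨t, tendsto_atTop_mono' _ ?_ hsq, fun ε hε => ?_⟩
  · filter_upwards [eventually_ge_atTop N] with n hn using (ht n hn).1
  have hlogo : ∀ δ : ℝ, 0 < δ → ∀ᶠ x : ℝ in atTop, Real.log x ≤ δ * x := fun δ hδ => by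
    filter_upwards [Real.isLittleO_log_id_atTop.bound hδ, eventually_ge_atTop 0] with x hx hx0
    rw [id, Real.norm_of_nonneg hx0] at hx
    exact (Real.le_norm_self _).trans hx
  have e1 := (hsq.const_mul_atTop hC).eventually (hlogo (ε / (64 * C)) (by positivity))
  have e2 := ((tendsto_natCast_atTop_atTop.atTop_add
    (tendsto_const_nhds (x := (1 : ℝ)))).const_mul_atTop (show (0 : ℝ) < 8 by norm_num)).eventually
    (hlogo (ε / 64) (by positivity))
  have e3 := (hsq.const_mul_atTop (show 0 < ε / 4 by positivity)).eventually_ge_atTop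
    (-Real.log c)
  filter_upwards [e1, e2, e3, eventually_ge_atTop N, eventually_ge_atTop 1]
    with n h1 h2 h3 hnN hn1 σ hσ
  refine le_trans ?_ (hζ n hnN σ hσ)
  have hn1' : (1 : ℝ) ≤ n := by exact_mod_cast hn1
  have hpos : (0 : ℝ) < 8 * (n + 1) := by positivity
  have hpow : (1 / (8 * (n + 1) : ℝ)) ^ n = Real.exp (-(n * Real.log (8 * (n + 1)))) := by
    rw [one_div, inv_pow, Real.exp_neg, mul_comm (n : ℝ), Real.exp_mul, Real.exp_log hpos,
      Real.rpow_natCast]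
  rw [hpow, ← Real.exp_log hc, ← Real.exp_add, ← Real.exp_add, Real.exp_le_exp]
  have ht1 := (ht n hnN).1
  -- This is why heights of size n² go with n zeros: the loss n log(8(n+1)) is o(n²), hence
  -- subexponential in the height.
  have h4 : n * Real.log (8 * (n + 1)) ≤ ε / 4 * n ^ 2 := by
    calc n * Real.log (8 * (n + 1)) ≤ n * (ε / 64 * (8 * (n + 1))) := by gcongr
      _ ≤ n * (ε / 64 * (8 * (n + n))) := by gcongr
      _ = ε / 4 * n ^ 2 := by ring
  have h5 : 16 * Real.log (C * n ^ 2) ≤ ε / 4 * n ^ 2 := by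
    calc 16 * Real.log (C * n ^ 2) ≤ 16 * (ε / (64 * C) * (C * n ^ 2)) := by gcongr
      _ = ε / 4 * n ^ 2 := by field_simp; norm_num
  have h6 : ε * n ^ 2 ≤ ε * t n := by gcongr
  have h7 : 0 ≤ ε / 4 * n ^ 2 := by positivity
  linarith

end ThetaZeta

end

noncomputable section

namespace ThetaZeta

open Filter Topology Complex MeasureTheory

/-! ### Shifting a line of integration -/

lemma integrable_exp_neg_mul_abs {η : ℝ} (hη : 0 < η) :
    Integrable (fun t : ℝ => Real.exp (-η * |t|)) := by
  rw [← integrableOn_univ, ← Set.Iic_union_Ioi (a := (0 : ℝ))]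
  refine IntegrableOn.union ?_ ?_
  · refine (integrableOn_exp_mul_Iic hη 0).congr_fun (fun t ht => ?_) measurableSet_Iic
    simp only []
    rw [abs_of_nonpos ht]; ring_nf
  · refine (integrableOn_exp_mul_Ioi (neg_lt_zero.mpr hη) 0).congr_fun (fun t ht => ?_)
      measurableSet_Ioi
    simp only []
    rw [abs_of_pos ht]

lemma integrable_of_norm_le_exp {f : ℝ → ℂ} (hf : Continuous f) {C η : ℝ} (hη : 0 < η)
    (h : ∀ t, ‖f t‖ ≤ C * Real.exp (-η * |t|)) : Integrable f :=
  ((integrable_exp_neg_mul_abs hη).const_mul C).mono' hf.aestronglyMeasurable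
    (Eventually.of_forall h)

lemma tendsto_rectIntegral {F : ℂ → ℂ} {a b : ℝ} (hab : a ≤ b) {T : ℕ → ℝ}
    (hT : Tendsto T atTop atTop)
    (ha : Integrable fun y : ℝ => F (a + y * I)) (hb : Integrable fun y : ℝ => F (b + y * I))
    {B : ℕ → ℝ} (hB : Tendsto B atTop (𝓝 0))
    (hF : ∀ᶠ n in atTop, ∀ σ ∈ Set.Icc a b,
      ‖F (σ + T n * I)‖ ≤ B n ∧ ‖F (σ + (-T n : ℝ) * I)‖ ≤ B n) :
    Tendsto (fun n => rectIntegral F a b (-T n) (T n)) atTop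
      (𝓝 (I * (∫ y : ℝ, F (b + y * I)) - I * ∫ y : ℝ, F (a + y * I))) := by
  have hT' : Tendsto (fun n => -T n) atTop atBot := tendsto_neg_atTop_atBot.comp hT
  have h1 := (intervalIntegral_tendsto_integral hb hT' hT).const_mul I
  have h2 := (intervalIntegral_tendsto_integral ha hT' hT).const_mul I
  have hB' : Tendsto (fun n => B n * |b - a|) atTop (𝓝 0) := by simpa using hB.mul_const |b - a|
  have h3 : Tendsto (fun n => ∫ x in a..b, F (x + (-T n : ℝ) * I)) atTop (𝓝 0) := by
    refine squeeze_zero_norm' ?_ hB'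
    filter_upwards [hF] with n hn
    refine intervalIntegral.norm_integral_le_of_norm_le_const fun x hx => ?_
    rw [Set.uIoc_of_le hab] at hx
    exact (hn x ⟨hx.1.le, hx.2⟩).2
  have h4 : Tendsto (fun n => ∫ x in a..b, F (x + T n * I)) atTop (𝓝 0) := by
    refine squeeze_zero_norm' ?_ hB'
    filter_upwards [hF] with n hn
    refine intervalIntegral.norm_integral_le_of_norm_le_const fun x hx => ?_
    rw [Set.uIoc_of_le hab] at hx
    exact (hn x ⟨hx.1.le, hx.2⟩).1
  simpa [rectIntegral] using ((h3.sub h4).add h1).sub h2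

/-- The residues are defined by limits of derivatives of formulas singular at p; such a limit is the
derivative of the analytic extension. -/
lemma limUnder_iteratedDeriv {φ g : ℂ → ℂ} {p : ℂ} (n : ℕ) (hg : AnalyticAt ℂ g p)
    (h : ∀ᶠ s in 𝓝[≠] p, φ s = g s) :
    limUnder (𝓝[≠] p) (iteratedDeriv n φ) = iteratedDeriv n g p := by
  have h1 : ∀ᶠ s in 𝓝[≠] p, φ =ᶠ[𝓝 s] g := by
    filter_upwards [eventually_eventually_nhdsWithin.mpr h, self_mem_nhdsWithin] with s hs hsp
    exact hs.filter_mono (by rw [isOpen_compl_singleton.nhdsWithin_eq hsp])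
  have h2 : Tendsto (iteratedDeriv n g) (𝓝[≠] p) (𝓝 (iteratedDeriv n g p)) := by
    have : AnalyticAt ℂ (iteratedDeriv n g) p := by
      rw [iteratedDeriv_eq_iterate]; exact hg.iterated_deriv n
    exact this.continuousAt.tendsto.mono_left nhdsWithin_le_nhds
  refine (h2.congr' ?_).limUnder_eq
  filter_upwards [h1] with s hs
  exact (hs.iteratedDeriv_eq n).symm

lemma norm_exp_neg_mul_le {s w : ℂ} {A : ℝ} (hs : |s.re| ≤ A) :
    ‖Complex.exp (-(s * w))‖ ≤ Real.exp (A * |w.re|) * Real.exp (|w.im| * |s.im|) := by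
  rw [Complex.norm_exp, ← Real.exp_add, Real.exp_le_exp]
  simp only [Complex.neg_re, Complex.mul_re]
  have h1 : -(s.re * w.re) ≤ A * |w.re| := by
    refine (neg_le_abs _).trans ?_
    rw [abs_mul]; gcongr
  have h2 : s.im * w.im ≤ |w.im| * |s.im| := by
    refine (le_abs_self _).trans ?_
    rw [abs_mul, mul_comm]
  linarith

/-- Exponential decay of `Γ(s/2)`, with the pole removed. -/
lemma exists_norm_mul_norm_Gamma_half_le {η : ℝ} (hη0 : 0 ≤ η) (hη : η < Real.pi / 4) (B : ℝ) :
    ∃ C : ℝ, 0 ≤ C ∧ ∀ s : ℂ, -1 ≤ s.re → s.re ≤ B →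
      ‖s‖ * ‖Gamma (s / 2)‖ ≤ C * Real.exp (-η * |s.im|) := by
  obtain ⟨C, hC, h⟩ := exists_norm_mul_norm_Gamma_le (θ := 2 * η) (by positivity) (by linarith)
    (B / 2)
  refine ⟨2 * C, by positivity, fun s h1 h2 => ?_⟩
  have hre : (s / 2).re = s.re / 2 := by simp
  have him : (s / 2).im = s.im / 2 := by simp
  have hn : ‖s / 2‖ = ‖s‖ / 2 := by simp
  have := h (s / 2) (by rw [hre]; linarith) (by rw [hre]; linarith)
  rw [him, hn, abs_div, abs_two] at this
  have e : -(2 * η) * (|s.im| / 2) = -η * |s.im| := by ring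
  rw [e] at this
  linarith

/-- One factor e^{-ηx} of the k available suffices, since the condition on the argument does not
depend on k. -/
lemma pow_exp_neg_le {C η : ℝ} {k : ℕ} (hk : 1 ≤ k) (hη : 0 ≤ η) {a x : ℝ} (hx : 0 ≤ x)
    (ha : 0 ≤ a) (h : a ≤ C * Real.exp (-η * x)) : a ^ k ≤ C ^ k * Real.exp (-η * x) := by
  have hk' : (1 : ℝ) ≤ k := by exact_mod_cast hk
  have hC : 0 ≤ C := by
    by_contra hC
    have := Real.exp_pos (-η * x)
    nlinarith
  calc a ^ k ≤ (C * Real.exp (-η * x)) ^ k := by gcongr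
    _ = C ^ k * Real.exp (k * (-η * x)) := by rw [mul_pow, ← Real.exp_nat_mul]
    _ ≤ C ^ k * Real.exp (-η * x) := by
      refine mul_le_mul_of_nonneg_left (Real.exp_le_exp.mpr ?_) (by positivity)
      nlinarith [mul_nonneg hη hx]

/-- The integrand of the Steen function after the substitution `s ↦ s / 2`. -/
def gammaKernel (k : ℕ) (w s : ℂ) : ℂ := Gamma (s / 2) ^ k * Complex.exp (-(s * w))

/-- The poles of Γ(s/2) are 0, -2, -4, …; the line Re s = -1 separates 0 from the others, so
shifting to it crosses only 0. -/
lemma differentiableAt_Gamma_half {s : ℂ} (hs : -1 ≤ s.re) (hs0 : s ≠ 0) :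
    DifferentiableAt ℂ (fun s => Gamma (s / 2)) s := by
  refine (Complex.differentiableAt_Gamma (s / 2) fun m h => ?_).comp s (by fun_prop)
  have h1 : s = -(2 * m) := by linear_combination 2 * h
  rcases Nat.eq_zero_or_pos m with rfl | hm
  · exact hs0 (by simpa using h1)
  · have h2 := congrArg Complex.re h1
    have hm' : (1 : ℝ) ≤ m := by exact_mod_cast hm
    simp at h2
    linarith

lemma differentiableAt_gammaKernel (k : ℕ) (w : ℂ) {s : ℂ} (hs : -1 ≤ s.re) (hs0 : s ≠ 0) :
    DifferentiableAt ℂ (gammaKernel k w) s :=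
  ((differentiableAt_Gamma_half hs hs0).pow k).mul (by fun_prop)

/-- A bound for the kernel in vertical strips. -/
lemma exists_norm_gammaKernel_le {k : ℕ} (hk : 1 ≤ k) {w : ℂ} (hw : |w.im| < Real.pi / 4) {B : ℝ}
    (hB : 1 ≤ B) : ∃ C η : ℝ, 0 ≤ C ∧ 0 < η ∧ ∀ s : ℂ, -1 ≤ s.re → s.re ≤ B →
      ‖s‖ ^ k * ‖gammaKernel k w s‖ ≤ C * Real.exp (-η * |s.im|) := by
  obtain ⟨η, hη1, hη2⟩ := exists_between hw
  have hη0 : 0 ≤ η := (abs_nonneg _).trans hη1.le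
  obtain ⟨C, hC, h⟩ := exists_norm_mul_norm_Gamma_half_le hη0 hη2 B
  refine ⟨C ^ k * Real.exp (B * |w.re|), η - |w.im|, by positivity, by linarith,
    fun s h1 h2 => ?_⟩
  have h3 := pow_exp_neg_le hk hη0 (abs_nonneg s.im) (by positivity) (h s h1 h2)
  have h4 := norm_exp_neg_mul_le (w := w) (s := s) (A := B) (abs_le.mpr ⟨by linarith, h2⟩)
  calc ‖s‖ ^ k * ‖gammaKernel k w s‖
      = (‖s‖ * ‖Gamma (s / 2)‖) ^ k * ‖Complex.exp (-(s * w))‖ := by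
        rw [gammaKernel, norm_mul, norm_pow, mul_pow]; ring
    _ ≤ C ^ k * Real.exp (-η * |s.im|) *
        (Real.exp (B * |w.re|) * Real.exp (|w.im| * |s.im|)) := by gcongr
    _ = C ^ k * Real.exp (B * |w.re|) * Real.exp (-(η - |w.im|) * |s.im|) := by
        rw [show -(η - |w.im|) * |s.im| = -η * |s.im| + |w.im| * |s.im| by ring, Real.exp_add]
        ring

lemma continuous_gammaKernel_line (k : ℕ) (w : ℂ) {a : ℝ} (ha : -1 ≤ a) (ha0 : a ≠ 0) :
    Continuous fun y : ℝ => gammaKernel k w (a + y * I) := by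
  refine continuous_iff_continuousAt.mpr fun y => ?_
  have h := (differentiableAt_gammaKernel k w (s := a + y * I) (by simpa) (fun h => ha0 (by
    simpa using congrArg Complex.re h))).continuousAt
  exact ContinuousAt.comp (f := fun y : ℝ => (a + y * I : ℂ)) h (by fun_prop)

lemma integrable_gammaKernel_line {k : ℕ} (hk : 1 ≤ k) {w : ℂ} (hw : |w.im| < Real.pi / 4)
    {a : ℝ} (ha : -1 ≤ a) (ha0 : a ≠ 0) :
    Integrable fun y : ℝ => gammaKernel k w (a + y * I) := by
  obtain ⟨C, η, hC, hη, h⟩ := exists_norm_gammaKernel_le hk hw (le_max_left 1 a)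
  refine integrable_of_norm_le_exp (continuous_gammaKernel_line k w ha ha0) (C := C / |a| ^ k) hη
    fun y => ?_
  have h1 := h (a + y * I) (by simpa) (by simp)
  have h2 : |a| ≤ ‖(a + y * I : ℂ)‖ := by simpa using Complex.abs_re_le_norm (a + y * I : ℂ)
  have ha' : 0 < |a| := abs_pos.mpr ha0
  have h3 : |a| ^ k * ‖gammaKernel k w (a + y * I)‖ ≤ C * Real.exp (-η * |y|) := by
    have e : ((a : ℂ) + y * I).im = y := by simp
    rw [e] at h1
    exact le_trans (by gcongr) h1
  rw [div_mul_eq_mul_div, le_div_iff₀ (by positivity), mul_comm]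
  exact h3

/-- The shift of the line of integration in the Steen function over the pole at `0`. -/
theorem integral_gammaKernel_sub {k : ℕ} (hk : 1 ≤ k) {w : ℂ} (hw : |w.im| < Real.pi / 4)
    {b : ℝ} (hb : 0 < b) :
    (∫ y : ℝ, gammaKernel k w (b + y * I)) - (∫ y : ℝ, gammaKernel k w ((-1 : ℝ) + y * I)) =
      2 * Real.pi * residueZero k (Complex.exp w) := by
  have hwI : Complex.log (Complex.exp w) = w := by
    have := abs_lt.mp hw
    exact Complex.log_exp (by linarith [Real.pi_pos]) (by linarith [Real.pi_pos])
  -- The analytic extension of s^k Γ(s/2)^k e^{-sw}, using sΓ(s/2) = 2Γ(s/2 + 1).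
  set g : ℂ → ℂ := fun s => (2 * Gamma (s / 2 + 1)) ^ k * Complex.exp (-(s * w)) with hg
  have hgan : AnalyticAt ℂ g 0 := by
    have hopen : IsOpen {s : ℂ | -2 < s.re} := isOpen_lt continuous_const Complex.continuous_re
    refine DifferentiableOn.analyticAt (s := {s : ℂ | -2 < s.re}) (fun s hs => ?_)
      (hopen.mem_nhds (by simp))
    have hs' : -2 < s.re := hs
    have h1 : DifferentiableAt ℂ (fun s : ℂ => Gamma (s / 2 + 1)) s := by
      refine (Complex.differentiableAt_Gamma (s / 2 + 1) fun m h => ?_).comp s (by fun_prop)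
      have h2 := congrArg Complex.re h
      have hm : (0 : ℝ) ≤ m := Nat.cast_nonneg m
      simp at h2
      linarith
    exact (((h1.const_mul 2).pow k).mul (by fun_prop)).differentiableWithinAt
  have hker : ∀ s : ℂ, s ≠ 0 → s * Gamma (s / 2) = 2 * Gamma (s / 2 + 1) := fun s hs => by
    rw [Complex.Gamma_add_one _ (div_ne_zero hs two_ne_zero)]; ring
  obtain ⟨j, rfl⟩ : ∃ j, k = j + 1 := ⟨k - 1, by omega⟩
  have hres : HasRes (gammaKernel (j + 1) w) 0 (residueZero (j + 1) (Complex.exp w)) := by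
    have h1 := hasRes_of_eq_div_pow (F := gammaKernel (j + 1) w) j hgan (by
      filter_upwards [self_mem_nhdsWithin] with s hs
      have hs' : s ≠ 0 := hs
      simp only [hg, sub_zero, ← hker s hs', gammaKernel]
      rw [mul_pow]
      field_simp)
    convert h1 using 1
    rw [residueZero, add_tsub_cancel_right, limUnder_iteratedDeriv j hgan]
    · ring
    filter_upwards [self_mem_nhdsWithin] with s hs
    simp only [hg, ← hker s hs]
    rw [mul_pow, Complex.cpow_def_of_ne_zero (Complex.exp_ne_zero _), hwI]
    ring_nf
  obtain ⟨C, η, hC, hη, hbd⟩ := exists_norm_gammaKernel_le hk hw (le_max_left 1 b)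
  have hlim := tendsto_rectIntegral (F := gammaKernel (j + 1) w) (a := -1) (b := b) (by linarith)
    (T := fun n : ℕ => (n : ℝ)) tendsto_natCast_atTop_atTop
    (integrable_gammaKernel_line hk hw le_rfl (by norm_num))
    (integrable_gammaKernel_line hk hw (by linarith) hb.ne')
    (B := fun n => C * Real.exp (-η * n)) (by
      have : Tendsto (fun n : ℕ => -η * (n : ℝ)) atTop atBot :=
        tendsto_natCast_atTop_atTop.const_mul_atTop_of_neg (by linarith)
      simpa using (Real.tendsto_exp_atBot.comp this).const_mul C) (by
      filter_upwards [eventually_ge_atTop 1] with n hn σ hσ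
      have hn' : (1 : ℝ) ≤ n := by exact_mod_cast hn
      have key : ∀ y : ℝ, |y| = n →
          ‖gammaKernel (j + 1) w (σ + y * I)‖ ≤ C * Real.exp (-η * n) := fun y hy => by
        have h1 := hbd (σ + y * I) (by simpa using hσ.1) (by simpa using Or.inr hσ.2)
        have e : ((σ : ℂ) + y * I).im = y := by simp
        rw [e, hy] at h1
        refine le_trans (le_mul_of_one_le_left (norm_nonneg _) (one_le_pow₀ ?_)) h1
        have := Complex.abs_im_le_norm (σ + y * I : ℂ)
        rw [e, hy] at this
        linarith
      exact ⟨key n (by simp), key (-n) (by simp)⟩)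
  have hrect : ∀ᶠ n : ℕ in atTop, rectIntegral (gammaKernel (j + 1) w) (-1) b (-(n : ℝ)) n =
      2 * Real.pi * I * residueZero (j + 1) (Complex.exp w) := by
    filter_upwards [eventually_ge_atTop 1] with n hn
    have hn' : (1 : ℝ) ≤ n := by exact_mod_cast hn
    rw [rectIntegral_eq_sum_residues (P := {0})
      (res := fun _ => residueZero (j + 1) (Complex.exp w)) (by linarith) (by linarith)]
    · simp
    · intro z hz hz0
      exact differentiableAt_gammaKernel _ _ hz.1.1 (by simpa using hz0)
    · intro p hp
      obtain rfl : p = 0 := by simpa using hp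
      refine ⟨?_, hres⟩
      rw [Complex.mem_reProdIm]
      simp only [Complex.zero_re, Complex.zero_im, Set.mem_Ioo]
      refine ⟨⟨by norm_num, hb⟩, by linarith, by linarith⟩
  have hfin := tendsto_nhds_unique hlim (tendsto_const_nhds.congr' (hrect.mono fun _ h => h.symm))
  have hI : I * I = -1 := Complex.I_mul_I
  linear_combination (-I) * hfin + ((∫ y : ℝ, gammaKernel (j + 1) w (b + y * I)) -
    (∫ y : ℝ, gammaKernel (j + 1) w ((-1 : ℝ) + y * I)) -
      2 * Real.pi * residueZero (j + 1) (Complex.exp w)) * hI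

/-- The Steen function with zero parameters as an integral of the kernel. -/
lemma two_mul_steenV {k : ℕ} (c : ℝ) {w : ℂ} (hw : |w.im| < Real.pi / 4) :
    2 * steenV c (fun _ : Fin k => (0 : ℂ)) (Complex.exp (2 * w)) =
      1 / (2 * Real.pi) * ∫ y : ℝ, gammaKernel k w ((2 * c : ℝ) + y * I) := by
  have hwI : Complex.log (Complex.exp (2 * w)) = 2 * w := by
    have := abs_lt.mp hw
    exact Complex.log_exp (by simp; linarith [Real.pi_pos]) (by simp; linarith [Real.pi_pos])
  set h : ℝ → ℂ := fun t => (∏ _j : Fin k, Gamma ((c + t * I) + 0)) *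
    Complex.exp (2 * w) ^ (-(c + t * I)) with hh
  have h1 : ∀ y : ℝ, gammaKernel k w ((2 * c : ℝ) + y * I) = h (y / 2) := fun y => by
    simp only [hh, gammaKernel, Finset.prod_const, Finset.card_univ, Fintype.card_fin, add_zero]
    rw [Complex.cpow_def_of_ne_zero (Complex.exp_ne_zero _), hwI]
    push_cast
    congr 2
    · congr 1; ring
    · ring
  simp_rw [h1]
  -- The Jacobian 2 of y ↦ y/2 accounts for the factor 2 in front of V.
  rw [Measure.integral_comp_div h 2, steenV]
  simp only [abs_two]
  rw [Complex.real_smul]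
  push_cast
  ring

end ThetaZeta

end

noncomputable section

namespace ThetaZeta

open Filter Topology Complex MeasureTheory

/-! ### The symmetric form of `Λ(s)` -/

/-- The entire function `s (1 - s) Λ_ζ(s)`, where `Λ_ζ` is the completed zeta function. -/
def xi (s : ℂ) : ℂ := s * (1 - s) * completedRiemannZeta₀ s - 1

/-- `π^{-s/2} Γ(s/2 + 1)`. -/
def shiftedGamma (s : ℂ) : ℂ := (Real.pi : ℂ) ^ (-s / 2) * Gamma (s / 2 + 1)

/-- The meromorphic function `Λ(s) = π^{-s/2} Γ(s/2) ζ(1-s)^{-1}` in a manifestly symmetric form,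
free of removable singularities. -/
def symLam (s : ℂ) : ℂ := 4 * shiftedGamma s * shiftedGamma (1 - s) / xi s

lemma xi_one_sub (s : ℂ) : xi (1 - s) = xi s := by
  rw [xi, xi, completedRiemannZeta₀_one_sub]; ring

lemma symLam_one_sub (s : ℂ) : symLam (1 - s) = symLam s := by
  rw [symLam, symLam, xi_one_sub, sub_sub_cancel]; ring

lemma differentiable_xi : Differentiable ℂ xi := by
  have := differentiable_completedZeta₀
  unfold xi
  fun_prop

lemma xi_eq {s : ℂ} (h0 : s ≠ 0) (h1 : s ≠ 1) : xi s = s * (1 - s) * completedRiemannZeta s := by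
  have h1' : 1 - s ≠ 0 := sub_ne_zero.mpr h1.symm
  rw [xi, completedRiemannZeta_eq]
  field_simp
  ring

lemma xi_one : xi 1 = -1 := by simp [xi]

lemma xi_eq_riemannZeta {s : ℂ} (hs : 0 < s.re) (h1 : s ≠ 1) :
    xi s = s * (1 - s) * Gammaℝ s * riemannZeta s := by
  have h0 : s ≠ 0 := by rintro rfl; simp at hs
  have := Gammaℝ_ne_zero_of_re_pos hs
  rw [xi_eq h0 h1, riemannZeta_def_of_ne_zero h0]
  field_simp

lemma Gammaℝ_eq_shiftedGamma {s : ℂ} (h0 : s ≠ 0) : Gammaℝ s = 2 * shiftedGamma s / s := by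
  rw [Gammaℝ, shiftedGamma, Complex.Gamma_add_one _ (div_ne_zero h0 two_ne_zero)]
  field_simp

/-- Γ_ℝ(s) = 2 `shiftedGamma s` / s, used at s and at 1 - s, gives the factor 4 and cancels s(1 - s)
in `xi`. At zeros of `xi` both sides take the conventional value 0. -/
lemma Lam_eq_symLam {s : ℂ} (h0 : s ≠ 0) (h1 : s ≠ 1) : Lam s = symLam s := by
  have h1' : 1 - s ≠ 0 := sub_ne_zero.mpr h1.symm
  have e : Lam s = Gammaℝ s * (riemannZeta (1 - s))⁻¹ := rfl
  rw [e, riemannZeta_def_of_ne_zero h1', completedRiemannZeta_one_sub, Gammaℝ_eq_shiftedGamma h0,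
    Gammaℝ_eq_shiftedGamma h1', symLam, xi_eq h0 h1, inv_div]
  by_cases hz : completedRiemannZeta s = 0
  · simp [hz]
  · field_simp
    ring

theorem functionalEquation (k : ℕ) : FunctionalEquation k := by
  intro s h0 h1 _ _
  have h0' : s ≠ 0 := by simpa using h0 0
  have h1' : s ≠ 1 := fun h => h1 0 (by simp [h])
  rw [Lam_eq_symLam h0' h1', Lam_eq_symLam (sub_ne_zero.mpr h1'.symm) (by simpa using h0'),
    symLam_one_sub]

lemma ne_one_of_mem_nontrivialZeros {ρ : ℂ} (hρ : ρ ∈ nontrivialZeros) : ρ ≠ 1 := by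
  rintro rfl
  have := hρ.2.2
  simp at this

lemma ne_zero_of_mem_nontrivialZeros {ρ : ℂ} (hρ : ρ ∈ nontrivialZeros) : ρ ≠ 0 := by
  rintro rfl
  have := hρ.2.1
  simp at this

lemma re_lt_one_of_xi_eq_zero {s : ℂ} (h : xi s = 0) : s.re < 1 := by
  by_contra! hs
  have h1 : s ≠ 1 := by rintro rfl; rw [xi_one] at h; norm_num at h
  have hs0 : 0 < s.re := by linarith
  have h0 : s ≠ 0 := by rintro rfl; simp at hs0
  rw [xi_eq_riemannZeta hs0 h1] at h
  exact mul_ne_zero (mul_ne_zero (mul_ne_zero h0 (sub_ne_zero.mpr h1.symm))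
    (Gammaℝ_ne_zero_of_re_pos hs0)) (riemannZeta_ne_zero_of_one_le_re hs) h

/-- ζ has no zeros on Re s ≥ 1; applying this to s and to 1 - s confines the zeros of `xi` to the
open strip, where the other factors do not vanish. -/
lemma xi_eq_zero_iff {s : ℂ} : xi s = 0 ↔ s ∈ nontrivialZeros := by
  constructor
  · intro h
    have hlt := re_lt_one_of_xi_eq_zero h
    have hlt' := re_lt_one_of_xi_eq_zero (s := 1 - s) (by rwa [xi_one_sub])
    have hs0 : 0 < s.re := by simpa using hlt'
    have h1 : s ≠ 1 := by rintro rfl; simp at hlt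
    have h0 : s ≠ 0 := by rintro rfl; simp at hs0
    rw [xi_eq_riemannZeta hs0 h1] at h
    refine ⟨?_, hs0, hlt⟩
    exact (mul_eq_zero.mp h).resolve_left (mul_ne_zero (mul_ne_zero h0 (sub_ne_zero.mpr h1.symm))
      (Gammaℝ_ne_zero_of_re_pos hs0))
  · intro h
    rw [xi_eq_riemannZeta h.2.1 (ne_one_of_mem_nontrivialZeros h), h.1, mul_zero]

lemma one_sub_mem_nontrivialZeros {ρ : ℂ} (hρ : ρ ∈ nontrivialZeros) :
    1 - ρ ∈ nontrivialZeros := by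
  rw [← xi_eq_zero_iff, xi_one_sub, xi_eq_zero_iff]
  exact hρ

lemma deriv_xi_ne_zero {ρ : ℂ} (hρ : ρ ∈ nontrivialZeros) (h : deriv riemannZeta ρ ≠ 0) :
    deriv xi ρ ≠ 0 := by
  have h0 := ne_zero_of_mem_nontrivialZeros hρ
  have h1 := ne_one_of_mem_nontrivialZeros hρ
  have hG := Gammaℝ_ne_zero_of_re_pos hρ.2.1
  have hdG : DifferentiableAt ℂ Gammaℝ ρ := by
    have := (differentiable_Gammaℝ_inv ρ).inv (inv_ne_zero hG)
    simpa only [inv_inv, Pi.inv_def] using this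
  have hd : DifferentiableAt ℂ (fun s : ℂ => s * (1 - s) * Gammaℝ s) ρ :=
    DifferentiableAt.mul (by fun_prop) hdG
  have hder := hd.hasDerivAt.fun_mul (differentiableAt_riemannZeta h1).hasDerivAt
  have hev : xi =ᶠ[𝓝 ρ] fun s => s * (1 - s) * Gammaℝ s * riemannZeta s := by
    filter_upwards [(isOpen_lt continuous_const Complex.continuous_re).mem_nhds hρ.2.1,
      isOpen_ne.mem_nhds h1] with s hs hs1
    exact xi_eq_riemannZeta hs hs1
  rw [hev.deriv_eq, HasDerivAt.deriv hder, hρ.1, mul_zero, zero_add]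
  exact mul_ne_zero (mul_ne_zero (mul_ne_zero h0 (sub_ne_zero.mpr h1.symm)) hG) h

lemma differentiableAt_shiftedGamma {s : ℂ} (hs : -2 < s.re) :
    DifferentiableAt ℂ shiftedGamma s := by
  have h1 : DifferentiableAt ℂ (fun s : ℂ => Gamma (s / 2 + 1)) s := by
    refine (Complex.differentiableAt_Gamma (s / 2 + 1) fun m h => ?_).comp s (by fun_prop)
    have h2 := congrArg Complex.re h
    have hm : (0 : ℝ) ≤ m := Nat.cast_nonneg m
    simp at h2
    linarith
  refine DifferentiableAt.mul ?_ h1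
  exact (by fun_prop : DifferentiableAt ℂ (fun s : ℂ => -s / 2) s).const_cpow
    (Or.inl (by exact_mod_cast Real.pi_ne_zero))

lemma differentiableAt_symLam_numerator {s : ℂ} (h1 : -2 < s.re) (h2 : s.re < 3) :
    DifferentiableAt ℂ (fun s => 4 * shiftedGamma s * shiftedGamma (1 - s)) s :=
  ((differentiableAt_shiftedGamma h1).const_mul 4).mul
    ((differentiableAt_shiftedGamma (s := 1 - s) (by simp; linarith)).comp s (by fun_prop))

/-! ### Bounds for `Λ(s)` -/

lemma norm_pi_cpow_le {s : ℂ} (hs : -1 ≤ s.re) : ‖(Real.pi : ℂ) ^ (-s / 2)‖ ≤ Real.pi := by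
  rw [Complex.norm_cpow_eq_rpow_re_of_pos Real.pi_pos]
  have h1 : (1 : ℝ) ≤ Real.pi := by linarith [Real.pi_gt_three]
  calc Real.pi ^ (-s / 2).re ≤ Real.pi ^ (1 : ℝ) :=
        Real.rpow_le_rpow_of_exponent_le h1 (by simp; linarith)
    _ = Real.pi := Real.rpow_one _

/-- ζ(1-s) is kept on the left so that different lower bounds for it can be inserted: a constant on
Re s = -1, a subexponential one at the chosen heights. -/
lemma exists_norm_symLam_mul_le {η : ℝ} (hη0 : 0 ≤ η) (hη : η < Real.pi / 4) :
    ∃ C : ℝ, 0 ≤ C ∧ ∀ s : ℂ, -1 ≤ s.re → s.re ≤ 1 / 2 → 1 ≤ ‖s‖ →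
      ‖symLam s‖ * ‖riemannZeta (1 - s)‖ ≤ C * Real.exp (-η * |s.im|) := by
  obtain ⟨C, hC, h⟩ := exists_norm_mul_norm_Gamma_half_le hη0 hη (1 / 2)
  refine ⟨Real.pi * C, by positivity, fun s h1 h2 hs => ?_⟩
  have h0 : s ≠ 0 := by rintro rfl; simp at hs; linarith
  have h1' : s ≠ 1 := by rintro rfl; norm_num at h2
  rw [← Lam_eq_symLam h0 h1']
  have h3 := h s h1 h2
  have h4 : ‖Gamma (s / 2)‖ ≤ C * Real.exp (-η * |s.im|) :=
    le_trans (le_mul_of_one_le_left (norm_nonneg _) hs) h3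
  have h5 : ‖(riemannZeta (1 - s))⁻¹‖ * ‖riemannZeta (1 - s)‖ ≤ 1 := by
    rw [norm_inv]; exact inv_mul_le_one
  calc ‖Lam s‖ * ‖riemannZeta (1 - s)‖
      = ‖(Real.pi : ℂ) ^ (-s / 2)‖ * ‖Gamma (s / 2)‖ *
        (‖(riemannZeta (1 - s))⁻¹‖ * ‖riemannZeta (1 - s)‖) := by
        rw [Lam, norm_mul, norm_mul]; ring
    _ ≤ Real.pi * (C * Real.exp (-η * |s.im|)) * 1 := by
        gcongr
        exact norm_pi_cpow_le h1
    _ = _ := by ring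

lemma exists_norm_symLam_line_le {η : ℝ} (hη0 : 0 ≤ η) (hη : η < Real.pi / 4) :
    ∃ C : ℝ, 0 ≤ C ∧ ∀ y : ℝ, ‖symLam ((-1 : ℝ) + y * I)‖ ≤ C * Real.exp (-η * |y|) := by
  obtain ⟨C, hC, h⟩ := exists_norm_symLam_mul_le hη0 hη
  obtain ⟨c, hc, hz⟩ := exists_le_norm_riemannZeta (σ := 2) (by norm_num)
  refine ⟨C / c, by positivity, fun y => ?_⟩
  have hre : (((-1 : ℝ) : ℂ) + y * I).re = -1 := by simp
  have him : (((-1 : ℝ) : ℂ) + y * I).im = y := by simp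
  have h1 := h ((-1 : ℝ) + y * I) (by rw [hre]) (by rw [hre]; norm_num) (by
    have := Complex.abs_re_le_norm (((-1 : ℝ) : ℂ) + y * I)
    rw [hre] at this; simpa using this)
  rw [him] at h1
  have h2 := hz (1 - ((-1 : ℝ) + y * I)) (by rw [Complex.sub_re, hre]; norm_num)
  rw [div_mul_eq_mul_div, le_div_iff₀ hc]
  exact le_trans (by gcongr) h1

/-- Along suitable heights `Λ(s)` decays exponentially on horizontal segments. -/
theorem exists_heights_symLam : ∃ t : ℕ → ℝ, Tendsto t atTop atTop ∧
    (∀ η : ℝ, 0 ≤ η → η < Real.pi / 4 → ∃ C : ℝ, ∀ᶠ n in atTop, ∀ s : ℂ, -1 ≤ s.re → s.re ≤ 2 →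
      |s.im| = t n → xi s ≠ 0 ∧ ‖symLam s‖ ≤ C * Real.exp (-η * t n)) := by
  obtain ⟨t, ht, hz⟩ := exists_heights
  have hlow : ∀ ε : ℝ, 0 < ε → ∀ᶠ n in atTop, ∀ s : ℂ, 1 / 2 ≤ s.re → s.re ≤ 2 → |s.im| = t n →
      Real.exp (-ε * t n) ≤ ‖riemannZeta s‖ := by
    intro ε hε
    filter_upwards [hz ε hε] with n hn s h1 h2 h3
    have h4 := hn s.re ⟨h1, h2⟩
    rcases abs_choice s.im with h | h
    · rw [h] at h3
      rwa [← h3, Complex.re_add_im, h3] at h4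
    · rw [h] at h3
      -- The heights are positive; ordinates -t n are reached by conjugation symmetry.
      have : (s.re : ℂ) + t n * I = (starRingEnd ℂ) s := by
        rw [← h3]; apply Complex.ext <;> simp
      rwa [this, riemannZeta_conj, Complex.norm_conj] at h4
  refine ⟨t, ht, fun η hη0 hη => ?_⟩
  -- The surplus decay η' - η pays for the subexponential size of 1/ζ.
  obtain ⟨η', h1, h2⟩ := exists_between hη
  obtain ⟨C, hC, hb⟩ := exists_norm_symLam_mul_le (hη0.trans h1.le) h2
  refine ⟨C, ?_⟩
  filter_upwards [hlow (η' - η) (by linarith), ht.eventually_ge_atTop 1] with n hn htn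
  have hxi : ∀ s : ℂ, 1 / 2 ≤ s.re → s.re ≤ 2 → |s.im| = t n → xi s ≠ 0 := by
    intro s h3 h4 h5 h6
    have h7 := hn s h3 h4 h5
    rw [(xi_eq_zero_iff.mp h6).1, norm_zero] at h7
    exact absurd h7 (not_le.mpr (Real.exp_pos _))
  have hL : ∀ s : ℂ, -1 ≤ s.re → s.re ≤ 1 / 2 → |s.im| = t n →
      ‖symLam s‖ ≤ C * Real.exp (-η * t n) := by
    intro s h3 h4 h5
    have h6 := hb s h3 h4 (by
      have := Complex.abs_im_le_norm s
      linarith)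
    have h7 := hn (1 - s) (by simp; linarith) (by simp; linarith) (by simpa using h5)
    rw [h5] at h6
    have h8 : ‖symLam s‖ * Real.exp (-(η' - η) * t n) ≤ C * Real.exp (-η' * t n) :=
      le_trans (by gcongr) h6
    have e : C * Real.exp (-η' * t n) =
        C * Real.exp (-η * t n) * Real.exp (-(η' - η) * t n) := by
      rw [mul_assoc, ← Real.exp_add]; ring_nf
    rw [e] at h8
    exact le_of_mul_le_mul_right h8 (Real.exp_pos _)
  intro s h3 h4 h5
  rcases le_total s.re (1 / 2) with h6 | h6
  · refine ⟨?_, hL s h3 h6 h5⟩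
    rw [← xi_one_sub]
    exact hxi _ (by simp; linarith) (by simp; linarith) (by simpa using h5)
  · refine ⟨hxi s h6 h4 h5, ?_⟩
    rw [← symLam_one_sub]
    exact hL _ (by simp; linarith) (by simp; linarith) (by simpa using h5)

/-! ### The contour integral of `Λ(s)^k x^{-s/2}` -/

/-- `Λ(s)^k e^{-sw}`. -/
def lamKernel (k : ℕ) (w s : ℂ) : ℂ := symLam s ^ k * Complex.exp (-(s * w))

/-- The integral of `Λ(s)^k e^{-sw}` over the line `Re s = -1`. -/
def lamIntegral (k : ℕ) (w : ℂ) : ℂ := ∫ y : ℝ, lamKernel k w ((-1 : ℝ) + y * I)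

lemma lamKernel_one_sub (k : ℕ) (w s : ℂ) :
    lamKernel k w (1 - s) = Complex.exp (-w) * lamKernel k (-w) s := by
  rw [lamKernel, lamKernel, symLam_one_sub, mul_left_comm, ← Complex.exp_add]
  ring_nf

lemma differentiableAt_lamKernel (k : ℕ) (w : ℂ) {s : ℂ} (h1 : -1 ≤ s.re) (h2 : s.re ≤ 2)
    (hs : xi s ≠ 0) : DifferentiableAt ℂ (lamKernel k w) s :=
  (((differentiableAt_symLam_numerator (by linarith) (by linarith)).div
    (differentiable_xi s) hs).pow k).mul (by fun_prop)

lemma integrable_lamKernel {k : ℕ} (hk : 1 ≤ k) {w : ℂ} (hw : |w.im| < Real.pi / 4) :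
    Integrable fun y : ℝ => lamKernel k w ((-1 : ℝ) + y * I) := by
  obtain ⟨η, hη1, hη2⟩ := exists_between hw
  have hη0 : 0 ≤ η := (abs_nonneg _).trans hη1.le
  obtain ⟨C, hC, h⟩ := exists_norm_symLam_line_le hη0 hη2
  refine integrable_of_norm_le_exp (continuous_iff_continuousAt.mpr fun y => ?_)
    (C := C ^ k * Real.exp (1 * |w.re|)) (η := η - |w.im|) (by linarith) fun y => ?_
  · have hd := (differentiableAt_lamKernel k w (s := (-1 : ℝ) + y * I) (by simp) (by norm_num)
      (fun h0 => by
        have := (xi_eq_zero_iff.mp h0).2.1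
        norm_num at this)).continuousAt
    exact ContinuousAt.comp (f := fun y : ℝ => ((-1 : ℝ) + y * I : ℂ)) hd (by fun_prop)
  · have h3 := pow_exp_neg_le hk hη0 (abs_nonneg y) (norm_nonneg _) (h y)
    have h4 := norm_exp_neg_mul_le (w := w) (s := ((-1 : ℝ) : ℂ) + y * I) (A := 1) (by simp)
    have e : (((-1 : ℝ) : ℂ) + y * I).im = y := by simp
    rw [e] at h4
    rw [lamKernel, norm_mul, norm_pow]
    calc _ ≤ C ^ k * Real.exp (-η * |y|) *
        (Real.exp (1 * |w.re|) * Real.exp (|w.im| * |y|)) := by gcongr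
    _ = C ^ k * Real.exp (1 * |w.re|) * Real.exp (-(η - |w.im|) * |y|) := by
        rw [show -(η - |w.im|) * |y| = -η * |y| + |w.im| * |y| by ring, Real.exp_add]
        ring

lemma lamKernel_right_line (k : ℕ) (w : ℂ) (y : ℝ) : lamKernel k w ((2 : ℝ) + y * I) =
    Complex.exp (-w) * lamKernel k (-w) ((-1 : ℝ) + (-y : ℝ) * I) := by
  rw [← lamKernel_one_sub]
  congr 1
  push_cast
  ring

lemma integrable_lamKernel_right {k : ℕ} (hk : 1 ≤ k) {w : ℂ} (hw : |w.im| < Real.pi / 4) :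
    Integrable fun y : ℝ => lamKernel k w ((2 : ℝ) + y * I) := by
  simp_rw [lamKernel_right_line]
  exact ((integrable_lamKernel hk (w := -w) (by simpa)).comp_neg).const_mul _

lemma integral_lamKernel_right (k : ℕ) (w : ℂ) :
    ∫ y : ℝ, lamKernel k w ((2 : ℝ) + y * I) = Complex.exp (-w) * lamIntegral k (-w) := by
  simp_rw [lamKernel_right_line]
  rw [integral_const_mul, lamIntegral,
    ← integral_neg_eq_self (fun y : ℝ => lamKernel k (-w) ((-1 : ℝ) + y * I))]

/-! ### The residues of Λ(s)^k x^{-s/2} at the zeros -/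

lemma log_sqrt {x : ℂ} : Complex.log (x ^ (1 / 2 : ℂ)) = Complex.log x / 2 := by
  rcases eq_or_ne x 0 with rfl | hx
  · simp
  have h1 := Complex.neg_pi_lt_log_im x
  have h2 := Complex.log_im_le_pi x
  have him : (Complex.log x * (1 / 2)).im = (Complex.log x).im / 2 := by
    simp [Complex.mul_im]; ring
  rw [Complex.cpow_def_of_ne_zero hx, Complex.log_exp (by rw [him]; linarith [Real.pi_pos])
    (by rw [him]; linarith [Real.pi_pos])]
  ring

lemma sqrt_ne_zero {x : ℂ} (hx : x ≠ 0) : x ^ (1 / 2 : ℂ) ≠ 0 := by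
  rw [Complex.cpow_def_of_ne_zero hx]; exact Complex.exp_ne_zero _

lemma pi_cpow_mul (k : ℕ) (s : ℂ) :
    (Real.pi : ℂ) ^ (-(k * s) / 2) = ((Real.pi : ℂ) ^ (-s / 2)) ^ k := by
  rw [← Complex.cpow_nat_mul]; ring_nf

/-- `residueRho` is the residue of `Λ(s)^k x^{-s/2}`. -/
lemma hasRes_lamKernel (hsimple : ∀ ρ ∈ nontrivialZeros, deriv riemannZeta ρ ≠ 0) {k : ℕ}
    (hk : 1 ≤ k) {x : ℂ} (hx : x ≠ 0) {ρ : ℂ} (hρ : ρ ∈ nontrivialZeros) :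
    HasRes (lamKernel k (Complex.log x / 2)) ρ (residueRho k x ρ) := by
  obtain ⟨j, rfl⟩ : ∃ j, k = j + 1 := ⟨k - 1, by omega⟩
  -- `xi` has a simple zero at ρ, so replacing it by `dslope xi ρ` divides out s - ρ and makes (s -
  -- ρ)^k Λ(s)^k e^{-sw} analytic there.
  set g : ℂ → ℂ := fun s => (4 * shiftedGamma s * shiftedGamma (1 - s) / dslope xi ρ s) ^ (j + 1) *
    Complex.exp (-(s * (Complex.log x / 2))) with hg
  have hxi : ∀ s, xi s = (s - ρ) * dslope xi ρ s := fun s => by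
    have := sub_smul_dslope xi ρ s
    rw [xi_eq_zero_iff.mpr hρ, sub_zero, smul_eq_mul] at this
    exact this.symm
  have hds : Differentiable ℂ (dslope xi ρ) := by
    rw [← differentiableOn_univ, Complex.differentiableOn_dslope univ_mem]
    exact differentiable_xi.differentiableOn
  have hne : dslope xi ρ ρ ≠ 0 := by
    rw [dslope_same]; exact deriv_xi_ne_zero hρ (hsimple ρ hρ)
  have hnum : AnalyticAt ℂ (fun s => 4 * shiftedGamma s * shiftedGamma (1 - s)) ρ := by
    have hopen : IsOpen ({s : ℂ | -2 < s.re} ∩ {s : ℂ | s.re < 3}) :=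
      (isOpen_lt continuous_const Complex.continuous_re).inter
        (isOpen_lt Complex.continuous_re continuous_const)
    refine DifferentiableOn.analyticAt (fun s hs =>
      (differentiableAt_symLam_numerator hs.1 hs.2).differentiableWithinAt) (hopen.mem_nhds ?_)
    exact ⟨by have := hρ.2.1; change (-2 : ℝ) < ρ.re; linarith,
      by have := hρ.2.2; change ρ.re < 3; linarith⟩
  have hgan : AnalyticAt ℂ g ρ :=
    ((hnum.div (hds.analyticAt ρ) hne).pow (j + 1)).mul (by fun_prop)
  have hF : ∀ s, s ≠ ρ → (s - ρ) ^ (j + 1) * lamKernel (j + 1) (Complex.log x / 2) s = g s := by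
    intro s hs
    have hs' := sub_ne_zero.mpr hs
    simp only [hg, lamKernel, symLam, hxi s]
    rw [← mul_assoc, ← mul_pow]
    congr 2
    by_cases hd : dslope xi ρ s = 0
    · simp [hd]
    · field_simp
  have h1 := hasRes_of_eq_div_pow (F := lamKernel (j + 1) (Complex.log x / 2)) j hgan (by
    filter_upwards [self_mem_nhdsWithin] with s hs
    have hs' := sub_ne_zero.mpr hs
    rw [← hF s hs, mul_div_cancel_left₀ _ (pow_ne_zero _ hs')])
  convert h1 using 1
  rw [residueRho, add_tsub_cancel_right, limUnder_iteratedDeriv j hgan]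
  · ring
  filter_upwards [self_mem_nhdsWithin, nhdsWithin_le_nhds
    (isOpen_ne.mem_nhds (ne_zero_of_mem_nontrivialZeros hρ)), nhdsWithin_le_nhds
    (isOpen_ne.mem_nhds (ne_one_of_mem_nontrivialZeros hρ))] with s hs h0 h1
  rw [← hF s hs, lamKernel, ← Lam_eq_symLam h0 h1, Lam, pi_cpow_mul,
    Complex.cpow_def_of_ne_zero (sqrt_ne_zero hx), log_sqrt, mul_pow, mul_pow, inv_pow]
  ring_nf

lemma mem_zerosUpTo {T : ℝ} {ρ : ℂ} : ρ ∈ zerosUpTo T ↔ ρ ∈ nontrivialZeros ∧ |ρ.im| < T := by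
  simp [zerosUpTo]

lemma ZeroSumConverges.hasZeroSum {f : ℂ → ℂ} (h : ZeroSumConverges f) :
    HasZeroSum f (zeroSum f) := by
  obtain ⟨S, hS⟩ := h
  have : zeroSum f = S := Tendsto.limUnder_eq hS
  rwa [this]

/-- The shift of the line of integration over the critical strip. -/
theorem lamIntegral_neg_sub (hsimple : ∀ ρ ∈ nontrivialZeros, deriv riemannZeta ρ ≠ 0) {k : ℕ}
    (hk : 1 ≤ k) {x : ℂ} (hx : x ≠ 0) (harg : |x.arg| < Real.pi / 2)
    (hconv : ZeroSumConverges (residueRho k x)) :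
    Complex.exp (-(Complex.log x / 2)) * lamIntegral k (-(Complex.log x / 2)) -
      lamIntegral k (Complex.log x / 2) = 2 * Real.pi * zeroSum (residueRho k x) := by
  set w := Complex.log x / 2 with hw
  have hwim : |w.im| < Real.pi / 4 := by
    have : w.im = x.arg / 2 := by rw [hw, Complex.div_ofNat_im, Complex.log_im]
    rw [this, abs_div, abs_two]; linarith
  obtain ⟨t, ht, hb⟩ := exists_heights_symLam
  -- The decay rate η of Λ exceeds the growth rate |Im w| of e^{-sw}, so the horizontal sides vanish
  -- in the limit.
  obtain ⟨η, hη1, hη2⟩ := exists_between hwim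
  have hη0 : 0 ≤ η := (abs_nonneg _).trans hη1.le
  obtain ⟨C, hC⟩ := hb η hη0 hη2
  have hlim := tendsto_rectIntegral (F := lamKernel k w) (a := -1) (b := 2) (by norm_num) ht
    (integrable_lamKernel hk hwim) (integrable_lamKernel_right hk hwim)
    (B := fun n => C ^ k * Real.exp (2 * |w.re|) * Real.exp (-(η - |w.im|) * t n)) (by
      have : Tendsto (fun n => -(η - |w.im|) * t n) atTop atBot :=
        ht.const_mul_atTop_of_neg (by linarith)
      simpa using (Real.tendsto_exp_atBot.comp this).const_mul
        (C ^ k * Real.exp (2 * |w.re|))) (by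
      filter_upwards [hC, ht.eventually_ge_atTop 0] with n hn htn σ hσ
      have key : ∀ y : ℝ, |y| = t n → ‖lamKernel k w (σ + y * I)‖ ≤
          C ^ k * Real.exp (2 * |w.re|) * Real.exp (-(η - |w.im|) * t n) := fun y hy => by
        have hre : ((σ : ℂ) + y * I).re = σ := by simp
        have him : ((σ : ℂ) + y * I).im = y := by simp
        have h1 := (hn (σ + y * I) (by rw [hre]; exact hσ.1) (by rw [hre]; exact hσ.2)
          (by rw [him, hy])).2
        have h2 := pow_exp_neg_le hk hη0 htn (norm_nonneg _) h1
        have h3 := norm_exp_neg_mul_le (w := w) (s := σ + y * I) (A := 2) (by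
          rw [hre, abs_le]; exact ⟨by linarith [hσ.1], hσ.2⟩)
        rw [him, hy] at h3
        have h4 : 0 ≤ C ^ k * Real.exp (-η * t n) := le_trans (by positivity) h2
        rw [lamKernel, norm_mul, norm_pow]
        calc _ ≤ C ^ k * Real.exp (-η * t n) *
            (Real.exp (2 * |w.re|) * Real.exp (|w.im| * t n)) := by gcongr
        _ = C ^ k * Real.exp (2 * |w.re|) * Real.exp (-(η - |w.im|) * t n) := by
            rw [show -(η - |w.im|) * t n = -η * t n + |w.im| * t n by ring, Real.exp_add]
            ring
      exact ⟨key _ (abs_of_nonneg htn), key _ (by rw [abs_neg, abs_of_nonneg htn])⟩)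
  have hrect : ∀ᶠ n in atTop, rectIntegral (lamKernel k w) (-1) 2 (-t n) (t n) =
      2 * Real.pi * I * ∑ ρ ∈ zerosUpTo (t n), residueRho k x ρ := by
    filter_upwards [hC, ht.eventually_ge_atTop 0] with n hn htn
    refine rectIntegral_eq_sum_residues (by norm_num) (by linarith) _ _ (fun z hz hzP => ?_)
      fun ρ hρ => ?_
    · refine differentiableAt_lamKernel k w hz.1.1 hz.1.2 fun h0 => ?_
      have hz0 := xi_eq_zero_iff.mp h0
      rw [mem_zerosUpTo, not_and, not_lt] at hzP
      -- The rectangle is closed but `zerosUpTo` uses a strict inequality; a zero on the edge |Im z|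
      -- = t n is excluded by the choice of heights.
      exact (hn z hz.1.1 hz.1.2 (le_antisymm (abs_le.mpr hz.2) (hzP hz0))).1 h0
    · obtain ⟨h1, h2⟩ := mem_zerosUpTo.mp hρ
      refine ⟨⟨⟨?_, ?_⟩, abs_lt.mp h2⟩, hasRes_lamKernel hsimple hk hx h1⟩
      · have := h1.2.1; change (-1 : ℝ) < ρ.re; linarith
      · have := h1.2.2; change ρ.re < 2; linarith
  -- The shift controls the zero sums only along the heights t n; the assumed convergence identifies
  -- this limit with the full symmetric sum.
  have hS : Tendsto (fun n => 2 * Real.pi * I * ∑ ρ ∈ zerosUpTo (t n), residueRho k x ρ) atTop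
      (𝓝 (2 * Real.pi * I * zeroSum (residueRho k x))) :=
    (hconv.hasZeroSum.comp ht).const_mul _
  have hfin := tendsto_nhds_unique (hlim.congr' hrect) hS
  rw [integral_lamKernel_right, ← lamIntegral] at hfin
  have hI : I * I = -1 := Complex.I_mul_I
  linear_combination (-I) * hfin + (Complex.exp (-w) * lamIntegral k (-w) - lamIntegral k w -
    2 * Real.pi * zeroSum (residueRho k x)) * hI

end ThetaZeta

end

noncomputable section

namespace ThetaZeta

open Filter Topology Complex MeasureTheory

/-! ### The series over `n` and the theta relation -/

lemma log_half_im {x : ℂ} (harg : |x.arg| < Real.pi / 2) :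
    |(Complex.log x / 2).im| < Real.pi / 4 := by
  rw [Complex.div_ofNat_im, Complex.log_im, abs_div, Nat.abs_ofNat]
  linarith

lemma uTerm_zero (k : ℕ) (c : ℝ) (x : ℂ) : uTerm k c x 0 = 0 := by simp [uTerm]

/-- The subtracted residue at 0 is what it costs to move the Steen contour from Re s = 2c to Re s =
-1, after which c no longer appears. -/
lemma uTerm_eq_gammaKernel {k : ℕ} (hk : 1 ≤ k) {c : ℝ} (hc : 0 < c) {x : ℂ} (hx : x ≠ 0)
    (harg : |x.arg| < Real.pi / 2) {n : ℕ} (hn : n ≠ 0) :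
    uTerm k c x n = (mu k n : ℂ) / n * (1 / (2 * Real.pi) * ∫ y : ℝ,
      gammaKernel k (k / 2 * Real.log Real.pi + Complex.log x / 2 - Real.log n)
        ((-1 : ℝ) + y * I)) := by
  set w : ℂ := k / 2 * Real.log Real.pi + Complex.log x / 2 - Real.log n with hw
  have hwim : |w.im| < Real.pi / 4 := by
    have : w.im = (Complex.log x / 2).im := by
      rw [hw, Complex.sub_im, Complex.add_im, Complex.ofReal_im]
      have : ((k : ℂ) / 2 * Real.log Real.pi) = ((k / 2 * Real.log Real.pi : ℝ) : ℂ) := by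
        push_cast; rfl
      rw [this, Complex.ofReal_im]; ring
    rw [this]; exact log_half_im harg
  have hn' : (n : ℂ) ≠ 0 := Nat.cast_ne_zero.mpr hn
  have hpi : (Real.pi : ℂ) ≠ 0 := by exact_mod_cast Real.pi_ne_zero
  have hlogn : Complex.exp (Real.log n) = n := by
    rw [Complex.ofReal_log (Nat.cast_nonneg n), Complex.ofReal_natCast, Complex.exp_log hn']
  have hlogpi : (Real.log Real.pi : ℂ) = Complex.log Real.pi :=
    Complex.ofReal_log Real.pi_pos.le
  have e1 : (Real.pi : ℂ) ^ ((k : ℂ) / 2) * x ^ (1 / 2 : ℂ) / n = Complex.exp w := by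
    rw [hw, Complex.exp_sub, Complex.exp_add, hlogn, Complex.cpow_def_of_ne_zero hpi,
      Complex.cpow_def_of_ne_zero hx, hlogpi]
    ring_nf
  have e2 : (Real.pi : ℂ) ^ k * x / (n : ℂ) ^ 2 = Complex.exp (2 * w) := by
    have : 2 * w = k * Complex.log Real.pi + Complex.log x - (2 : ℕ) * Real.log n := by
      rw [hw, hlogpi]; push_cast; ring
    rw [this, Complex.exp_sub, Complex.exp_add, Complex.exp_nat_mul, Complex.exp_nat_mul, hlogn,
      Complex.exp_log hx, Complex.exp_log hpi]
  have hpi2 : (2 * Real.pi : ℂ) ≠ 0 := mul_ne_zero two_ne_zero hpi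
  rw [uTerm, e1, e2, two_mul_steenV c hwim]
  have h := integral_gammaKernel_sub hk hwim (b := 2 * c) (by linarith)
  rw [sub_eq_iff_eq_add] at h
  rw [h]
  generalize (∫ y : ℝ, gammaKernel k w ((-1 : ℝ) + y * I)) = J
  field_simp
  ring

/-- The shift of w by log n yields n^s, and with the factor 1/n it becomes n^{-(1-s)}, a term of the
series for ζ(1-s)^{-k}. -/
lemma gammaKernel_sub_log (k : ℕ) (w s : ℂ) {n : ℕ} (hn : n ≠ 0) :
    (mu k n : ℂ) / n * gammaKernel k (w - Real.log n) s =
      gammaKernel k w s * LSeries.term (fun n => (mu k n : ℂ)) (1 - s) n := by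
  have hn' : (n : ℂ) ≠ 0 := Nat.cast_ne_zero.mpr hn
  have h1 : (n : ℂ) ^ (1 - s) = n * Complex.exp (-(s * Real.log n)) := by
    rw [Complex.cpow_sub _ _ hn', Complex.cpow_one, Complex.cpow_def_of_ne_zero hn',
      Complex.ofReal_log (Nat.cast_nonneg n), Complex.ofReal_natCast, Complex.exp_neg, mul_comm s]
    rfl
  have h2 : Complex.exp (-(s * (w - Real.log n))) =
      Complex.exp (-(s * w)) / Complex.exp (-(s * Real.log n)) := by
    rw [← Complex.exp_sub]; ring_nf
  rw [LSeries.term_of_ne_zero hn, h1, gammaKernel, gammaKernel, h2]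
  have := Complex.exp_ne_zero (-(s * Real.log n))
  field_simp

lemma gammaKernel_mul_inv_zeta (k : ℕ) (w : ℂ) {s : ℂ} (h0 : s ≠ 0) (h1 : s ≠ 1) :
    gammaKernel k (k / 2 * Real.log Real.pi + w) s * (riemannZeta (1 - s) ^ k)⁻¹ =
      lamKernel k w s := by
  have hpi : (Real.pi : ℂ) ≠ 0 := by exact_mod_cast Real.pi_ne_zero
  have h2 : Complex.exp (-(s * (k / 2 * Real.log Real.pi + w))) =
      ((Real.pi : ℂ) ^ (-s / 2)) ^ k * Complex.exp (-(s * w)) := by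
    rw [Complex.cpow_def_of_ne_zero hpi, ← Complex.exp_nat_mul, ← Complex.exp_add,
      Complex.ofReal_log Real.pi_pos.le]
    ring_nf
  rw [gammaKernel, h2, lamKernel, ← Lam_eq_symLam h0 h1, Lam, mul_pow, mul_pow, inv_pow]
  ring

/-- The series over `n` as a contour integral. -/
theorem hasSum_uTerm {k : ℕ} (hk : 1 ≤ k) {c : ℝ} (hc : 0 < c) {x : ℂ} (hx : x ≠ 0)
    (harg : |x.arg| < Real.pi / 2) :
    HasSum (uTerm k c x) (1 / (2 * Real.pi) * lamIntegral k (Complex.log x / 2)) := by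
  set w : ℂ := k / 2 * Real.log Real.pi + Complex.log x / 2 with hw
  have hwim : |w.im| < Real.pi / 4 := by
    have : w.im = (Complex.log x / 2).im := by
      have : ((k : ℂ) / 2 * Real.log Real.pi) = ((k / 2 * Real.log Real.pi : ℝ) : ℂ) := by
        push_cast; rfl
      rw [hw, Complex.add_im, this, Complex.ofReal_im, zero_add]
    rw [this]; exact log_half_im harg
  set f : ℕ → ℝ → ℂ := fun n y => gammaKernel k w ((-1 : ℝ) + y * I) *
    LSeries.term (fun n => (mu k n : ℂ)) (1 - ((-1 : ℝ) + y * I)) n with hf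
  have hterm : ∀ n, uTerm k c x n = 1 / (2 * Real.pi) * ∫ y : ℝ, f n y := by
    intro n
    rcases eq_or_ne n 0 with rfl | hn
    · simp [hf, uTerm_zero]
    · rw [uTerm_eq_gammaKernel hk hc hx harg hn, mul_left_comm, ← integral_const_mul]
      simp_rw [hf, ← gammaKernel_sub_log k w _ hn, hw]
  have hint := integrable_gammaKernel_line hk hwim (a := -1) le_rfl (by norm_num)
  -- On the line, 1 - s has real part 2, so the norms split into a function of y times a summable
  -- sequence and sum and integral may be interchanged.
  have hre : ∀ y : ℝ, (1 - (((-1 : ℝ) : ℂ) + y * I)).re = 2 := fun y => by simp; norm_num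
  have hnorm : ∀ n y, ‖f n y‖ = ‖gammaKernel k w ((-1 : ℝ) + y * I)‖ *
      ‖LSeries.term (fun n => (mu k n : ℂ)) 2 n‖ := fun n y => by
    rw [hf, norm_mul, LSeries.norm_term_eq, LSeries.norm_term_eq, hre]
    rfl
  have hmeas : ∀ n, AEStronglyMeasurable (f n) := fun n => by
    refine hint.aestronglyMeasurable.mul (Continuous.aestronglyMeasurable ?_)
    rcases eq_or_ne n 0 with rfl | hn
    · simp only [LSeries.term_zero]; exact continuous_const
    · simp only [LSeries.term_of_ne_zero hn]
      have hn' : (n : ℂ) ≠ 0 := Nat.cast_ne_zero.mpr hn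
      refine continuous_const.div ?_ fun y => by simp [Complex.cpow_eq_zero_iff, hn']
      exact Continuous.const_cpow (by fun_prop) (Or.inl hn')
  have hfi : ∀ n, Integrable (f n) := fun n =>
    (hint.norm.mul_const ‖LSeries.term (fun n => (mu k n : ℂ)) 2 n‖).mono' (hmeas n)
      (Eventually.of_forall fun y => (hnorm n y).le)
  have hsum : Summable fun n => ∫ y, ‖f n y‖ := by
    simp_rw [hnorm, integral_mul_const]
    exact ((LSeriesHasSum_mu k (s := 2) (by norm_num)).LSeriesSummable.norm).mul_left _
  have h := (hasSum_integral_of_summable_integral_norm hfi hsum).mul_left (1 / (2 * Real.pi) : ℂ)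
  have hval : ∫ y : ℝ, ∑' n, f n y = lamIntegral k (Complex.log x / 2) := by
    rw [lamIntegral]
    congr 1
    funext y
    have h0 : (((-1 : ℝ) : ℂ) + y * I) ≠ 0 := fun h => by
      have := congrArg Complex.re h; simp at this
    have h1 : (((-1 : ℝ) : ℂ) + y * I) ≠ 1 := fun h => by
      have := congrArg Complex.re h; norm_num at this
    rw [← gammaKernel_mul_inv_zeta k _ h0 h1, ← hw]
    exact ((LSeriesHasSum_mu k (by rw [hre]; norm_num)).mul_left _).tsum_eq
  rw [hval] at h
  exact h.congr_fun hterm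

lemma log_one_div {x : ℂ} (harg : |x.arg| < Real.pi / 2) :
    Complex.log (1 / x) = -Complex.log x := by
  rw [one_div, Complex.log_inv]
  intro h
  rw [h, abs_of_pos Real.pi_pos] at harg
  linarith [Real.pi_pos]

lemma abs_arg_one_div {x : ℂ} (harg : |x.arg| < Real.pi / 2) :
    |(1 / x).arg| < Real.pi / 2 := by
  have h := congrArg Complex.im (log_one_div harg)
  rw [Complex.log_im, Complex.neg_im, Complex.log_im] at h
  rwa [h, abs_neg]

lemma cpow_half {x : ℂ} (hx : x ≠ 0) : x ^ (1 / 2 : ℂ) = Complex.exp (Complex.log x / 2) := by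
  rw [Complex.cpow_def_of_ne_zero hx]; ring_nf

/-- The relation between the two series over the zeros, and the relation between the series
over `n`, behind the theta relation. -/
theorem zeroSum_and_tsum_one_div (hsimple : ∀ ρ ∈ nontrivialZeros, deriv riemannZeta ρ ≠ 0) {k : ℕ}
    (hk : 1 ≤ k) {c : ℝ} (hc : 0 < c) {x : ℂ} (hx : x ≠ 0) (harg : |x.arg| < Real.pi / 2)
    (h1 : ZeroSumConverges (residueRho k x)) (h2 : ZeroSumConverges (residueRho k (1 / x))) :
    zeroSum (residueRho k (1 / x)) = -x ^ (1 / 2 : ℂ) * zeroSum (residueRho k x) ∧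
      (∑' n, uTerm k c (1 / x) n) - x ^ (1 / 2 : ℂ) * ∑' n, uTerm k c x n =
        x ^ (1 / 2 : ℂ) * zeroSum (residueRho k x) := by
  have hx' : 1 / x ≠ 0 := one_div_ne_zero hx
  have harg' := abs_arg_one_div harg
  have e1 := lamIntegral_neg_sub hsimple hk hx harg h1
  -- For 1/x the parameter w becomes -w, so both identities involve the same integrals J(w) and
  -- J(-w); comparing them relates the two zero sums.
  have e2 := lamIntegral_neg_sub hsimple hk hx' harg' h2
  rw [(hasSum_uTerm hk hc hx harg).tsum_eq, (hasSum_uTerm hk hc hx' harg').tsum_eq, cpow_half hx]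
  rw [log_one_div harg] at e2 ⊢
  rw [neg_div, neg_neg] at e2
  rw [neg_div]
  set w := Complex.log x / 2
  have hpi : (Real.pi : ℂ) ≠ 0 := by exact_mod_cast Real.pi_ne_zero
  have hexp : Complex.exp w * Complex.exp (-w) = 1 := by rw [← Complex.exp_add]; simp
  have e3 : lamIntegral k (-w) - Complex.exp w * lamIntegral k w =
      2 * Real.pi * (Complex.exp w * zeroSum (residueRho k x)) := by
    linear_combination Complex.exp w * e1 - lamIntegral k (-w) * hexp
  constructor
  · have : 2 * (Real.pi : ℂ) * zeroSum (residueRho k (1 / x)) =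
        2 * Real.pi * (-Complex.exp w * zeroSum (residueRho k x)) := by
      linear_combination -e2 - e3
    exact mul_left_cancel₀ (mul_ne_zero two_ne_zero hpi) this
  · field_simp
    linear_combination e3

theorem thetaRelation (hsimple : ∀ ρ ∈ nontrivialZeros, deriv riemannZeta ρ ≠ 0) {k : ℕ}
    (hk : 1 ≤ k) {c : ℝ} (hc : 0 < c) : ThetaRelation k c := by
  intro x hx harg h1 h2
  obtain ⟨e1, e2⟩ := zeroSum_and_tsum_one_div hsimple hk hc hx harg h1 h2
  rw [U, U]
  linear_combination e2 + 1 / 2 * e1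

end ThetaZeta

end

noncomputable section

namespace ThetaZeta

open Filter Topology Complex MeasureTheory

/-! ### A Tauberian theorem for Laplace transforms -/

/-- The Fejér kernel `∫₀¹ (1 - τ) cos (τ w) dτ`. -/
def fejer (w : ℝ) : ℝ := ∫ τ in (0 : ℝ)..1, (1 - τ) * Real.cos (τ * w)

theorem fejer_eq {w : ℝ} (hw : w ≠ 0) : fejer w = (1 - Real.cos w) / w ^ 2 := by
  have hd : ∀ τ ∈ Set.uIcc (0 : ℝ) 1, HasDerivAt
      (fun τ : ℝ => (1 - τ) * (Real.sin (τ * w) / w) - Real.cos (τ * w) / w ^ 2)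
      ((1 - τ) * Real.cos (τ * w)) τ := by
    intro τ _
    have h0 : HasDerivAt (fun τ : ℝ => τ * w) w τ := by
      simpa using (hasDerivAt_id τ).mul_const w
    have h1 : HasDerivAt (fun τ : ℝ => 1 - τ) (-1) τ := by
      simpa using (hasDerivAt_id τ).const_sub 1
    have h2 := (h1.mul (h0.sin.div_const w)).sub (h0.cos.div_const (w ^ 2))
    convert! h2 using 1
    field_simp
    ring
  rw [fejer, intervalIntegral.integral_eq_sub_of_hasDerivAt hd
    (Continuous.intervalIntegrable (by fun_prop) _ _)]
  simp
  ring

theorem continuous_fejer : Continuous fejer :=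
  intervalIntegral.continuous_parametric_intervalIntegral_of_continuous'
    (f := fun w τ : ℝ => (1 - τ) * Real.cos (τ * w)) (by fun_prop) 0 1

theorem fejer_nonneg (w : ℝ) : 0 ≤ fejer w := by
  rcases eq_or_ne w 0 with rfl | hw
  · refine intervalIntegral.integral_nonneg zero_le_one fun τ hτ => ?_
    simpa using hτ.2
  · rw [fejer_eq hw]
    have := Real.cos_le_one w
    exact div_nonneg (by linarith) (sq_nonneg w)

theorem fejer_le (w : ℝ) : fejer w ≤ 3 * (1 + w ^ 2)⁻¹ := by
  have h1 : fejer w ≤ 1 := by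
    have : ‖fejer w‖ ≤ 1 * |1 - 0| := by
      refine intervalIntegral.norm_integral_le_of_norm_le_const fun τ hτ => ?_
      rw [Set.uIoc_of_le zero_le_one] at hτ
      rw [norm_mul, Real.norm_eq_abs, Real.norm_eq_abs, abs_of_nonneg (by linarith [hτ.2])]
      exact mul_le_one₀ (by linarith [hτ.1]) (abs_nonneg _) (Real.abs_cos_le_one _)
    simpa using (le_abs_self _).trans this
  have h2 : w ^ 2 * fejer w ≤ 2 := by
    rcases eq_or_ne w 0 with rfl | hw
    · simp
    · rw [fejer_eq hw, mul_div_cancel₀ _ (pow_ne_zero 2 hw)]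
      linarith [Real.neg_one_le_cos w]
  rw [← div_eq_mul_inv, le_div_iff₀ (by positivity)]
  linarith

theorem integrable_fejer : Integrable fejer := by
  refine (integrable_inv_one_add_sq.const_mul 3).mono' continuous_fejer.aestronglyMeasurable
    (ae_of_all _ fun w => ?_)
  rw [Real.norm_eq_abs, abs_of_nonneg (fejer_nonneg w)]
  exact fejer_le w

theorem integral_fejer_pos : 0 < ∫ w, fejer w := by
  rw [integral_pos_iff_support_of_nonneg fejer_nonneg integrable_fejer]
  refine lt_of_lt_of_le ?_ (measure_mono (s := Set.Ioo (0 : ℝ) 1) ?_)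
  · simp
  · intro w hw
    rw [Function.mem_support, fejer_eq hw.1.ne']
    have h1 : Real.cos w < Real.cos 0 :=
      Real.cos_lt_cos_of_nonneg_of_le_pi_div_two le_rfl
        (by linarith [hw.2, Real.pi_gt_three]) hw.1
    rw [Real.cos_zero] at h1
    exact (div_pos (by linarith) (pow_pos hw.1 2)).ne'

theorem integral_one_sub_mul_exp (w : ℝ) :
    (∫ τ in (0 : ℝ)..1, (1 - τ : ℂ) * exp (τ * w * I)).re = fejer w := by
  have hi : IntervalIntegrable (fun τ : ℝ => (1 - τ : ℂ) * exp (τ * w * I)) volume 0 1 :=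
    Continuous.intervalIntegrable (by fun_prop) _ _
  have h := reCLM.intervalIntegral_comp_comm hi
  simp only [reCLM_apply] at h
  rw [← h, fejer]
  refine intervalIntegral.integral_congr fun τ _ => ?_
  have : (1 - τ : ℂ) = ((1 - τ : ℝ) : ℂ) := by push_cast; ring
  simp only [this, re_ofReal_mul]
  rw [← ofReal_mul, exp_ofReal_mul_I_re]

variable {h : ℝ → ℝ} {G : ℂ → ℂ} {C : ℝ}

theorem integrable_mul_exp_neg (hm : Measurable h) (hC : ∀ u, |h u| ≤ C)
    (h0 : ∀ u < 0, h u = 0) {ε : ℝ} (hε : 0 < ε) :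
    Integrable fun u => h u * Real.exp (-(ε * u)) := by
  have h1 : IntegrableOn (fun u => C * Real.exp (-ε * u)) (Set.Ici 0) :=
    ((integrableOn_Ici_iff_integrableOn_Ioi).mpr (integrableOn_exp_mul_Ioi (by linarith) 0)).const_mul C
  refine (h1.integrable_indicator measurableSet_Ici).mono' (by fun_prop) (ae_of_all _ fun u => ?_)
  rcases lt_or_ge u 0 with hu | hu
  · rw [h0 u hu, Set.indicator_of_notMem (by simpa using hu)]
    simp
  · rw [Set.indicator_of_mem (by simpa using hu), norm_mul, Real.norm_eq_abs, Real.norm_eq_abs,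
      Real.abs_exp, neg_mul]
    gcongr
    exact hC u

/-- Fubini: averaging G along a vertical segment against 1 - τ smooths h with the Fejér kernel at
scale 1/l around v. -/
theorem integral_laplace_mul_exp (hm : Measurable h) (hC : ∀ u, |h u| ≤ C)
    (h0 : ∀ u < 0, h u = 0) (hG : ∀ s : ℂ, 0 < s.re → ∫ u : ℝ, (h u : ℂ) * exp (-(s * u)) = G s)
    (v l : ℝ) {ε : ℝ} (hε : 0 < ε) :
    (∫ τ in (0 : ℝ)..1, (1 - τ : ℂ) * exp (-(τ * (l * v) * I)) * G (ε - l * τ * I)).re =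
      ∫ u, h u * Real.exp (-(ε * u)) * fejer (l * (u - v)) := by
  have hint := integrable_mul_exp_neg hm hC h0 hε
  have hintC : Integrable fun u => ((h u * Real.exp (-(ε * u)) : ℝ) : ℂ) := hint.ofReal
  set μ := (volume : Measure ℝ).restrict (Set.Ioc 0 1) with hμ
  have hprod : Integrable (Function.uncurry fun (τ u : ℝ) =>
      (1 - τ : ℂ) * exp (τ * (l * (u - v) : ℝ) * I) * ((h u * Real.exp (-(ε * u)) : ℝ) : ℂ))
      (μ.prod volume) := by
    have h1 : Integrable (fun p : ℝ × ℝ => (1 : ℂ) * ((h p.2 * Real.exp (-(ε * p.2)) : ℝ) : ℂ))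
        (μ.prod volume) := (integrable_const (1 : ℂ)).mul_prod hintC
    refine Integrable.mono' h1.norm ?_ ?_
    · refine Measurable.aestronglyMeasurable ?_
      unfold Function.uncurry
      fun_prop
    · have hae : ∀ᵐ p ∂(μ.prod (volume : Measure ℝ)), p.1 ∈ Set.Ioc (0 : ℝ) 1 :=
        Measure.quasiMeasurePreserving_fst.ae (ae_restrict_mem measurableSet_Ioc)
      filter_upwards [hae] with p hp
      have h2 : ‖(1 - p.1 : ℂ)‖ ≤ 1 := by
        have : (1 - p.1 : ℂ) = ((1 - p.1 : ℝ) : ℂ) := by push_cast; ring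
        rw [this, norm_real, Real.norm_eq_abs, abs_of_nonneg (by linarith [hp.2])]
        linarith [hp.1]
      have h3 : ‖exp (p.1 * (l * (p.2 - v) : ℝ) * I)‖ = 1 := by
        rw [← ofReal_mul, norm_exp_ofReal_mul_I]
      simp only [Function.uncurry, norm_mul, h3, mul_one, one_mul]
      exact mul_le_of_le_one_left (by positivity) h2
  have hswap := integral_integral_swap hprod
  have hL : (∫ τ in (0 : ℝ)..1, (1 - τ : ℂ) * exp (-(τ * (l * v) * I)) * G (ε - l * τ * I)) =
      ∫ u : ℝ, ((h u * Real.exp (-(ε * u)) : ℝ) : ℂ) *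
        ∫ τ in (0 : ℝ)..1, (1 - τ : ℂ) * exp (τ * (l * (u - v) : ℝ) * I) := by
    rw [intervalIntegral.integral_of_le zero_le_one]
    trans ∫ τ, ∫ u, (1 - τ : ℂ) * exp (τ * (l * (u - v) : ℝ) * I) *
        ((h u * Real.exp (-(ε * u)) : ℝ) : ℂ) ∂volume ∂μ
    · refine integral_congr_ae (ae_of_all _ fun τ => ?_)
      simp only
      rw [← hG _ (by simpa using hε), ← integral_const_mul]
      refine integral_congr_ae (ae_of_all _ fun u => ?_)
      simp only
      push_cast
      have : exp (τ * (l * (u - v)) * I) * exp (-(ε * u)) =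
          exp (-(τ * (l * v) * I)) * exp (-((ε - l * τ * I) * u)) := by
        rw [← exp_add, ← exp_add]
        congr 1
        ring
      linear_combination -((1 - τ : ℂ) * h u) * this
    · rw [hswap]
      refine integral_congr_ae (ae_of_all _ fun u => ?_)
      simp only
      rw [integral_mul_const, intervalIntegral.integral_of_le zero_le_one, mul_comm]
  have hbd : Integrable fun u : ℝ => ((h u * Real.exp (-(ε * u)) : ℝ) : ℂ) *
        ∫ τ in (0 : ℝ)..1, (1 - τ : ℂ) * exp (τ * (l * (u - v) : ℝ) * I) := by
    have h4 := hprod.integral_prod_right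
    refine h4.congr (ae_of_all _ fun u => ?_)
    simp only [Function.uncurry]
    rw [integral_mul_const, intervalIntegral.integral_of_le zero_le_one, mul_comm]
  have h5 := reCLM.integral_comp_comm hbd
  simp only [reCLM_apply] at h5
  rw [hL, ← h5]
  refine integral_congr_ae (ae_of_all _ fun u => ?_)
  simp only
  rw [re_ofReal_mul, integral_one_sub_mul_exp]

/-- Let ε → 0: the left side converges by continuity of G up to the boundary, the right side by
domination with C times the Fejér kernel. -/
theorem integral_boundary_mul_exp (hm : Measurable h) (hC : ∀ u, |h u| ≤ C)
    (h0 : ∀ u < 0, h u = 0) (hG : ∀ s : ℂ, 0 < s.re → ∫ u : ℝ, (h u : ℂ) * exp (-(s * u)) = G s)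
    (hc : ContinuousOn G {s | 0 ≤ s.re}) (v : ℝ) {l : ℝ} (hl : 0 < l) :
    (∫ τ in (0 : ℝ)..1, (1 - τ : ℂ) * exp (-(τ * (l * v) * I)) * G (-(l * τ * I))).re =
      ∫ u, h u * fejer (l * (u - v)) := by
  have hK : Integrable fun u => fejer (l * (u - v)) :=
    (integrable_fejer.comp_mul_left' hl.ne').comp_sub_right v
  have hcont : Continuous fun ε : ℝ => ∫ τ in (0 : ℝ)..1,
      (1 - τ : ℂ) * exp (-(τ * (l * v) * I)) * G ((|ε| : ℝ) - l * τ * I) := by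
    refine intervalIntegral.continuous_parametric_intervalIntegral_of_continuous' ?_ 0 1
    unfold Function.uncurry
    refine Continuous.mul (by fun_prop) (hc.comp_continuous (by fun_prop) fun p => ?_)
    simp
  have h1 : Tendsto (fun ε : ℝ => (∫ τ in (0 : ℝ)..1,
      (1 - τ : ℂ) * exp (-(τ * (l * v) * I)) * G ((|ε| : ℝ) - l * τ * I)).re) (𝓝[>] 0)
      (𝓝 (∫ τ in (0 : ℝ)..1, (1 - τ : ℂ) * exp (-(τ * (l * v) * I)) * G (-(l * τ * I))).re) := by
    have := ((continuous_re.comp hcont).tendsto 0).mono_left (nhdsWithin_le_nhds (s := Set.Ioi 0))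
    simpa [Function.comp_def] using this
  have h2 : Tendsto (fun ε : ℝ => ∫ u, h u * Real.exp (-(ε * u)) * fejer (l * (u - v))) (𝓝[>] 0)
      (𝓝 (∫ u, h u * fejer (l * (u - v)))) := by
    refine tendsto_integral_filter_of_dominated_convergence
      (fun u => C * fejer (l * (u - v))) ?_ ?_ (hK.const_mul C) (ae_of_all _ fun u => ?_)
    · refine Eventually.of_forall fun ε => ?_
      have := continuous_fejer.measurable
      exact Measurable.aestronglyMeasurable (by fun_prop)
    · filter_upwards [self_mem_nhdsWithin] with ε hε
      refine ae_of_all _ fun u => ?_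
      rw [norm_mul, Real.norm_eq_abs (fejer _), abs_of_nonneg (fejer_nonneg _)]
      refine mul_le_mul_of_nonneg_right ?_ (fejer_nonneg _)
      rcases lt_or_ge u 0 with hu | hu
      · rw [h0 u hu]
        simpa using (abs_nonneg _).trans (hC 0)
      · rw [norm_mul, Real.norm_eq_abs, Real.norm_eq_abs, Real.abs_exp]
        refine (mul_le_of_le_one_right (abs_nonneg _) ?_).trans (hC u)
        rw [Real.exp_le_one_iff, neg_nonpos]
        exact mul_nonneg (le_of_lt hε) hu
    · have : Continuous fun ε : ℝ => h u * Real.exp (-(ε * u)) * fejer (l * (u - v)) := by fun_prop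
      simpa using (this.tendsto 0).mono_left (nhdsWithin_le_nhds (s := Set.Ioi 0))
  refine tendsto_nhds_unique h1 (h2.congr' ?_)
  filter_upwards [self_mem_nhdsWithin] with ε hε
  rw [← integral_laplace_mul_exp hm hC h0 hG v l hε, abs_of_pos hε]

/-- As v grows, the boundary integral is a Fourier integral at frequency proportional to lv, so it
tends to 0 by Riemann–Lebesgue. -/
theorem tendsto_integral_mul_fejer (hm : Measurable h) (hC : ∀ u, |h u| ≤ C)
    (h0 : ∀ u < 0, h u = 0) (hG : ∀ s : ℂ, 0 < s.re → ∫ u : ℝ, (h u : ℂ) * exp (-(s * u)) = G s)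
    (hc : ContinuousOn G {s | 0 ≤ s.re}) {l : ℝ} (hl : 0 < l) :
    Tendsto (fun v : ℝ => ∫ w, h (w / l + v) * fejer w) atTop (𝓝 0) := by
  have hsub : ∀ v, ∫ w, h (w / l + v) * fejer w = l * ∫ u, h u * fejer (l * (u - v)) := by
    intro v
    rw [← integral_add_right_eq_self (fun u => h u * fejer (l * (u - v))) v]
    have := Measure.integral_comp_mul_left (fun w => h (w / l + v) * fejer w) l
    simp only [mul_div_cancel_left₀ _ hl.ne'] at this
    simp only [add_sub_cancel_right]
    rw [this, abs_of_pos (inv_pos.mpr hl), smul_eq_mul, mul_inv_cancel_left₀ hl.ne']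
  simp only [hsub, ← integral_boundary_mul_exp hm hC h0 hG hc _ hl]
  set f : ℝ → ℂ := Set.indicator (Set.Ioc 0 1) fun τ => (1 - τ : ℂ) * G (-(l * τ * I)) with hf
  have hRL := Real.tendsto_integral_exp_smul_cocompact f
  have hto : Tendsto (fun v : ℝ => l * v / (2 * Real.pi)) atTop (cocompact ℝ) := by
    refine Tendsto.mono_right ?_ atTop_le_cocompact
    exact (tendsto_id.const_mul_atTop hl).atTop_div_const (by positivity)
  have h1 := (continuous_re.tendsto 0).comp (hRL.comp hto)
  rw [zero_re] at h1
  have h2 := h1.const_mul l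
  rw [mul_zero] at h2
  refine h2.congr fun v => ?_
  simp only [Function.comp_apply]
  rw [intervalIntegral.integral_of_le zero_le_one, ← integral_indicator measurableSet_Ioc]
  congr 2
  refine integral_congr_ae (ae_of_all _ fun τ => ?_)
  simp only [hf, Set.indicator_apply]
  split_ifs
  · rw [Circle.smul_def, Real.fourierChar_apply, smul_eq_mul]
    have : (2 * Real.pi * (-(τ * (l * v / (2 * Real.pi)))) : ℝ) = -(τ * (l * v)) := by
      field_simp
    rw [this]
    push_cast
    ring_nf
  · simp

/-- A bounded slowly oscillating function whose Laplace transform extends continuously to the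
closed right half-plane tends to `0`. -/
theorem tendsto_zero_of_laplace (hm : Measurable h) (hC : ∀ u, |h u| ≤ C)
    (h0 : ∀ u < 0, h u = 0) (hG : ∀ s : ℂ, 0 < s.re → ∫ u : ℝ, (h u : ℂ) * exp (-(s * u)) = G s)
    (hc : ContinuousOn G {s | 0 ≤ s.re})
    (hso : ∀ u v, |h u - h v| ≤ |u - v| + C * Real.exp (-min u v)) :
    Tendsto h atTop (𝓝 0) := by
  have hC0 : 0 ≤ C := (abs_nonneg _).trans (hC 0)
  have hK := integrable_fejer
  set c := ∫ w, fejer w with hcdef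
  have hcpos : 0 < c := integral_fejer_pos
  have hminK : ∀ φ : ℝ → ℝ, Measurable φ → (∀ w, 0 ≤ φ w) →
      Integrable fun w => min (2 * C) (φ w) * fejer w := by
    intro φ hφ hφ0
    have := continuous_fejer.measurable
    refine (hK.const_mul (2 * C)).mono' (Measurable.aestronglyMeasurable (by fun_prop))
      (ae_of_all _ fun w => ?_)
    rw [Real.norm_eq_abs, abs_of_nonneg
      (mul_nonneg (le_min (by positivity) (hφ0 w)) (fejer_nonneg w))]
    exact mul_le_mul_of_nonneg_right (min_le_left _ _) (fejer_nonneg w)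
  -- The cap 2C, available because |h| ≤ C, supplies an integrable majorant; |w| or e^{|w|/l} times
  -- the kernel would not be one.
  have hdct : ∀ φ : ℝ → ℝ → ℝ, (∀ l, Measurable (φ l)) → (∀ l w, 0 ≤ φ l w) →
      (∀ w, Tendsto (fun l => φ l w) atTop (𝓝 0)) →
      Tendsto (fun l => ∫ w, min (2 * C) (φ l w) * fejer w) atTop (𝓝 0) := by
    intro φ hφ hφ0 hlim
    have hzero : (0 : ℝ) = ∫ _ : ℝ, 0 := by simp
    rw [hzero]
    refine tendsto_integral_filter_of_dominated_convergence (fun w => 2 * C * fejer w)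
      (Eventually.of_forall fun l => (hminK _ (hφ l) (hφ0 l)).aestronglyMeasurable)
      (Eventually.of_forall fun l => ae_of_all _ fun w => ?_) (hK.const_mul _)
      (ae_of_all _ fun w => ?_)
    · rw [Real.norm_eq_abs, abs_of_nonneg
        (mul_nonneg (le_min (by positivity) (hφ0 l w)) (fejer_nonneg w))]
      exact mul_le_mul_of_nonneg_right (min_le_left _ _) (fejer_nonneg w)
    · have h1 : Tendsto (fun l => min (2 * C) (φ l w) * fejer w) atTop
          (𝓝 (min (2 * C) 0 * fejer w)) := (tendsto_const_nhds.min (hlim w)).mul_const _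
      simpa [min_eq_right (by positivity : (0 : ℝ) ≤ 2 * C)] using h1
  rw [Metric.tendsto_atTop]
  intro ε hε
  -- First l is taken large, so that the kernel concentrates and slow oscillation makes the average
  -- close to h(v); with l fixed, v is then taken large.
  have hA := hdct (fun l w => |w| / |l|) (fun l => by fun_prop) (fun l w => by positivity)
    (fun w => tendsto_const_nhds.div_atTop tendsto_abs_atTop_atTop)
  obtain ⟨l, hlA, hl⟩ := ((hA.eventually (gt_mem_nhds (show 0 < c * ε / 3 by positivity))).and
    (eventually_gt_atTop 0)).exists
  have hB := hdct (fun v w => C * Real.exp (|w| / l - v)) (fun v => by fun_prop)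
    (fun v w => by positivity) (fun w => by
      have h1 : Tendsto (fun v : ℝ => |w| / l - v) atTop atBot :=
        tendsto_atBot_add_const_left _ _ tendsto_neg_atTop_atBot
      simpa using (Real.tendsto_exp_atBot.comp h1).const_mul C)
  have hD := tendsto_integral_mul_fejer hm hC h0 hG hc hl
  have hev := (hB.eventually (gt_mem_nhds (show 0 < c * ε / 3 by positivity))).and
    ((tendsto_zero_iff_abs_tendsto_zero _).mp hD |>.eventually
      (gt_mem_nhds (show 0 < c * ε / 3 by positivity)))
  obtain ⟨N, hN⟩ := eventually_atTop.mp hev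
  refine ⟨N, fun v hv => ?_⟩
  obtain ⟨hvB, hvD⟩ := hN v hv
  simp only [Function.comp_apply] at hvD
  have hfm := continuous_fejer.measurable
  have hi1 : Integrable fun w => h v * fejer w := hK.const_mul _
  have hi2 : Integrable fun w => h (w / l + v) * fejer w := by
    refine (hK.const_mul C).mono' (Measurable.aestronglyMeasurable (by fun_prop))
      (ae_of_all _ fun w => ?_)
    rw [norm_mul, Real.norm_eq_abs, Real.norm_eq_abs, abs_of_nonneg (fejer_nonneg w)]
    exact mul_le_mul_of_nonneg_right (hC _) (fejer_nonneg w)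
  have hiA := hminK (fun w => |w| / |l|) (by fun_prop) fun w => by positivity
  have hiB := hminK (fun w => C * Real.exp (|w| / l - v)) (by fun_prop) fun w => by positivity
  have hmain : |h v * c - ∫ w, h (w / l + v) * fejer w| ≤
      (∫ w, min (2 * C) (|w| / |l|) * fejer w) +
        ∫ w, min (2 * C) (C * Real.exp (|w| / l - v)) * fejer w := by
    rw [hcdef, ← integral_const_mul, ← integral_sub hi1 hi2, ← integral_add hiA hiB,
      ← Real.norm_eq_abs]
    refine norm_integral_le_of_norm_le (hiA.add hiB) (ae_of_all _ fun w => ?_)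
    rw [← sub_mul, norm_mul, Real.norm_eq_abs, Real.norm_eq_abs, abs_of_nonneg (fejer_nonneg w),
      ← add_mul]
    refine mul_le_mul_of_nonneg_right ?_ (fejer_nonneg w)
    have h1 : |h v - h (w / l + v)| ≤ 2 * C := by
      have := abs_sub (h v) (h (w / l + v))
      linarith [hC v, hC (w / l + v)]
    have h2 : |h v - h (w / l + v)| ≤ |w| / |l| + C * Real.exp (|w| / l - v) := by
      refine (hso _ _).trans (add_le_add (le_of_eq ?_) ?_)
      · rw [← abs_div, ← abs_neg]
        congr 1
        ring
      · gcongr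
        have h3 : -(|w| / l) ≤ w / l := by
          rw [← neg_div]
          gcongr
          exact neg_abs_le w
        have h4 : 0 ≤ |w| / l := by positivity
        have : v - |w| / l ≤ min v (w / l + v) := le_min (by linarith) (by linarith)
        linarith
    have h5 : (0 : ℝ) ≤ |w| / |l| := by positivity
    have h6 : 0 ≤ C * Real.exp (|w| / l - v) := by positivity
    rcases min_cases (2 * C) (|w| / |l|) with ⟨h7, -⟩ | ⟨h7, -⟩ <;>
      rcases min_cases (2 * C) (C * Real.exp (|w| / l - v)) with ⟨h8, -⟩ | ⟨h8, -⟩ <;>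
      rw [h7, h8] <;> linarith
  have h9 : |h v * c| < c * ε := by
    have h10 := abs_sub_abs_le_abs_sub (h v * c) (∫ w, h (w / l + v) * fejer w)
    linarith
  rw [abs_mul, abs_of_pos hcpos, mul_comm] at h9
  rw [Real.dist_eq, sub_zero]
  exact lt_of_mul_lt_mul_left h9 hcpos.le

end ThetaZeta

end

noncomputable section

namespace ThetaZeta

open Filter Topology Complex MeasureTheory

/-! ### The series `∑ μ(n)/n` -/

/-- The partial sums of `∑ μ(n)/n`. -/
def moebiusSum (N : ℕ) : ℝ := ∑ n ∈ Finset.Icc 1 N, (ArithmeticFunction.moebius n : ℝ) / n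

theorem moebiusSum_succ (N : ℕ) : moebiusSum (N + 1) =
    moebiusSum N + (ArithmeticFunction.moebius (N + 1) : ℝ) / ((N + 1 : ℕ) : ℝ) :=
  Finset.sum_Icc_succ_top (by omega) _

theorem abs_moebius_le_one_real (n : ℕ) : |(ArithmeticFunction.moebius n : ℝ)| ≤ 1 := by
  exact_mod_cast ArithmeticFunction.abs_moebius_le_one (n := n)

theorem sum_moebius_mul_div {N : ℕ} (hN : N ≠ 0) :
    ∑ n ∈ Finset.Icc 1 N, (ArithmeticFunction.moebius n : ℝ) * ((N / n : ℕ) : ℝ) = 1 := by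
  have h := ArithmeticFunction.sum_Ioc_mul_zeta_eq_sum ArithmeticFunction.moebius N
  rw [ArithmeticFunction.moebius_mul_coe_zeta] at h
  have h1 : Finset.Ioc 0 N = Finset.Icc 1 N := rfl
  have h2 : ∑ n ∈ Finset.Ioc 0 N, (1 : ArithmeticFunction ℤ) n = 1 := by
    rw [Finset.sum_eq_single 1]
    · simp
    · intro b _ hb
      exact ArithmeticFunction.one_apply_ne hb
    · intro h3
      exact absurd (Finset.mem_Ioc.mpr ⟨one_pos, Nat.one_le_iff_ne_zero.mpr hN⟩) h3
  rw [h2, h1] at h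
  have h4 := congrArg (Int.cast : ℤ → ℝ) h.symm
  simpa only [Int.cast_sum, Int.cast_mul, Int.cast_natCast, Int.cast_one] using h4

/-- N ∑ μ(n)/n differs from ∑ μ(n)⌊N/n⌋ = 1 by at most N, since each of the N fractional parts is at
most 1. -/
theorem abs_moebiusSum_le (N : ℕ) : |moebiusSum N| ≤ 2 := by
  rcases eq_or_ne N 0 with rfl | hN
  · simp [moebiusSum]
  have hN0 : (1 : ℝ) ≤ N := by exact_mod_cast Nat.one_le_iff_ne_zero.mpr hN
  have h1 : |N * moebiusSum N - 1| ≤ N := by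
    rw [← sum_moebius_mul_div hN, moebiusSum, Finset.mul_sum, ← Finset.sum_sub_distrib]
    refine (Finset.abs_sum_le_sum_abs _ _).trans ?_
    have h2 : ∀ n ∈ Finset.Icc 1 N, |(N : ℝ) * ((ArithmeticFunction.moebius n : ℝ) / n) -
        (ArithmeticFunction.moebius n : ℝ) * ((N / n : ℕ) : ℝ)| ≤ 1 := by
      intro n _
      have h3 : (N : ℝ) * ((ArithmeticFunction.moebius n : ℝ) / n) -
          (ArithmeticFunction.moebius n : ℝ) * ((N / n : ℕ) : ℝ) =
          ArithmeticFunction.moebius n * ((N : ℝ) / n - ((N / n : ℕ) : ℝ)) := by ring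
      rw [h3, abs_mul, ← Nat.floor_div_eq_div (K := ℝ)]
      have h4 := Nat.floor_le (show (0 : ℝ) ≤ (N : ℝ) / n by positivity)
      have h5 := Nat.lt_floor_add_one ((N : ℝ) / n)
      refine mul_le_one₀ (abs_moebius_le_one_real n) (abs_nonneg _) ?_
      rw [abs_of_nonneg (by linarith)]
      linarith
    simpa using Finset.sum_le_sum h2
  have h6 := abs_le.mp h1
  rw [abs_le]
  constructor <;> nlinarith

theorem abs_moebiusSum_sub_le {A B : ℕ} (hA : 1 ≤ A) (hAB : A ≤ B) :
    |moebiusSum A - moebiusSum B| ≤ Real.log B - Real.log A := by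
  induction B, hAB using Nat.le_induction with
  | base => simp
  | succ B hAB ih =>
    have hB : (0 : ℝ) < B := by exact_mod_cast hA.trans hAB
    have h1 : 1 / ((B + 1 : ℕ) : ℝ) ≤ Real.log ((B + 1 : ℕ) : ℝ) - Real.log B := by
      have h2 := Real.one_sub_inv_le_log_of_pos (x := ((B + 1 : ℕ) : ℝ) / B) (by positivity)
      rw [Real.log_div (by positivity) hB.ne'] at h2
      refine le_trans (le_of_eq ?_) h2
      push_cast
      field_simp
      ring
    have h3 : |(ArithmeticFunction.moebius (B + 1) : ℝ) / ((B + 1 : ℕ) : ℝ)| ≤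
        1 / ((B + 1 : ℕ) : ℝ) := by
      rw [abs_div, Nat.abs_cast]
      gcongr
      exact abs_moebius_le_one_real _
    rw [moebiusSum_succ]
    have h4 := abs_sub (moebiusSum A - moebiusSum B)
      ((ArithmeticFunction.moebius (B + 1) : ℝ) / ((B + 1 : ℕ) : ℝ))
    rw [sub_sub] at h4
    linarith

/-- The increments are at most 1/(n+1) ≤ log(n+1) - log n, which gives |u - v|; rounding e^u down
costs a further O(e^{-u}). -/
theorem abs_moebiusSum_exp_sub_le (u v : ℝ) :
    |moebiusSum ⌊Real.exp u⌋₊ - moebiusSum ⌊Real.exp v⌋₊| ≤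
      |u - v| + 2 * Real.exp (-min u v) := by
  wlog huv : u ≤ v generalizing u v
  · have := this v u (le_of_not_ge huv)
    rwa [abs_sub_comm, abs_sub_comm u v, min_comm]
  rw [min_eq_left huv, abs_sub_comm u v, abs_of_nonneg (sub_nonneg.mpr huv)]
  rcases lt_or_ge u 0 with hu | hu
  · have h1 : ⌊Real.exp u⌋₊ = 0 := Nat.floor_eq_zero.mpr (Real.exp_lt_one_iff.mpr hu)
    have h2 : moebiusSum 0 = 0 := by simp [moebiusSum]
    rw [h1, h2, zero_sub, abs_neg]
    have h3 : 1 ≤ Real.exp (-u) := Real.one_le_exp (by linarith)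
    have := abs_moebiusSum_le ⌊Real.exp v⌋₊
    linarith
  · have hA : 1 ≤ ⌊Real.exp u⌋₊ := Nat.le_floor (by simpa using Real.one_le_exp hu)
    have hAB : ⌊Real.exp u⌋₊ ≤ ⌊Real.exp v⌋₊ := Nat.floor_mono (Real.exp_le_exp.mpr huv)
    refine (abs_moebiusSum_sub_le hA hAB).trans ?_
    set A := ⌊Real.exp u⌋₊ with hAdef
    have hA' : (1 : ℝ) ≤ A := by exact_mod_cast hA
    have hB' : (0 : ℝ) < ⌊Real.exp v⌋₊ := by exact_mod_cast hA.trans hAB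
    have h1 : Real.log ⌊Real.exp v⌋₊ ≤ v := by
      rw [Real.log_le_iff_le_exp hB']
      exact Nat.floor_le (Real.exp_pos v).le
    have h2 : Real.exp u < A + 1 := Nat.lt_floor_add_one _
    have h3 : u ≤ Real.log A + (A : ℝ)⁻¹ := by
      have h4 : u ≤ Real.log (A + 1) := by
        rw [Real.le_log_iff_exp_le (by positivity)]
        exact h2.le
      have h5 := Real.log_le_sub_one_of_pos (x := ((A : ℝ) + 1) / A) (by positivity)
      rw [Real.log_div (by positivity) (by positivity), add_div, div_self (by positivity),
        one_div] at h5
      linarith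
    have h6 : (A : ℝ)⁻¹ ≤ 2 * Real.exp (-u) := by
      rw [Real.exp_neg, ← div_eq_mul_inv, inv_eq_one_div,
        div_le_div_iff₀ (by positivity) (Real.exp_pos u)]
      linarith
    linarith

/-- Abel summation of the series for 1/ζ(s+1), with the substitution t = e^u. The transform is
1/(sζ(s+1)), and `riemannZeta₁` absorbs the factor s. -/
theorem hasLaplace_moebiusSum {s : ℂ} (hs : 0 < s.re) :
    ∫ u : ℝ, (moebiusSum ⌊Real.exp u⌋₊ : ℂ) * exp (-(s * u)) = (riemannZeta₁ (s + 1))⁻¹ := by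
  have hs0 : s ≠ 0 := by
    rintro rfl
    simp at hs
  have hs1 : 1 < (s + 1).re := by simpa using hs
  set f : ℕ → ℂ := fun n => (ArithmeticFunction.moebius n : ℂ) / n with hf
  have hterm : LSeries.term f s = LSeries.term (fun n => (ArithmeticFunction.moebius n : ℂ)) (s + 1) := by
    funext n
    rcases eq_or_ne n 0 with rfl | hn
    · rw [LSeries.term_zero, LSeries.term_zero]
    · rw [LSeries.term_of_ne_zero hn, LSeries.term_of_ne_zero hn,
        cpow_add _ _ (Nat.cast_ne_zero.mpr hn), cpow_one, hf, div_div, mul_comm]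
  have hS : LSeriesSummable f s := by
    rw [LSeriesSummable, hterm]
    exact ArithmeticFunction.LSeriesSummable_moebius_iff.mpr hs1
  have hL : LSeries f s = (riemannZeta (s + 1))⁻¹ := by
    have h := ArithmeticFunction.LSeries_zeta_mul_Lseries_moebius hs1
    rw [ArithmeticFunction.LSeries_zeta_eq_riemannZeta hs1] at h
    rw [LSeries, hterm]
    exact eq_inv_of_mul_eq_one_right h
  have hsum : ∀ N : ℕ, ∑ k ∈ Finset.Icc 1 N, f k = (moebiusSum N : ℂ) := by
    intro N
    simp [moebiusSum, hf]
  have hI := LSeries_eq_mul_integral f le_rfl hs hS (by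
    refine Asymptotics.IsBigO.of_bound 2 (Eventually.of_forall fun N => ?_)
    rw [hsum, norm_real, Real.rpow_zero, norm_one, mul_one]
    exact abs_moebiusSum_le N)
  simp only [hsum] at hI
  rw [hL, riemannZeta_eq_inv_sub_mul (by simpa using hs0), add_sub_cancel_right, mul_inv,
    inv_inv] at hI
  have hI' := mul_left_cancel₀ hs0 hI
  rw [hI']
  have himg : Real.exp '' Set.Ioi 0 = Set.Ioi 1 := by
    ext t
    constructor
    · rintro ⟨u, hu, rfl⟩
      exact Real.one_lt_exp_iff.mpr hu
    · intro ht
      exact ⟨Real.log t, Real.log_pos ht, Real.exp_log (zero_lt_one.trans ht)⟩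
  rw [← himg, integral_image_eq_integral_abs_deriv_smul measurableSet_Ioi
    (fun u _ => (Real.hasDerivAt_exp u).hasDerivWithinAt) Real.exp_injective.injOn,
    ← integral_Ici_eq_integral_Ioi, ← setIntegral_eq_integral_of_forall_compl_eq_zero
      (s := Set.Ici (0 : ℝ))]
  · refine setIntegral_congr_fun measurableSet_Ici fun u _ => ?_
    rw [Real.abs_exp, real_smul, cpow_def_of_ne_zero (by simp), ← ofReal_log (Real.exp_pos u).le,
      Real.log_exp, ofReal_exp, mul_left_comm, ← exp_add]
    ring_nf
  · intro u hu
    have h1 : ⌊Real.exp u⌋₊ = 0 := Nat.floor_eq_zero.mpr (Real.exp_lt_one_iff.mpr (by simpa using hu))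
    simp [h1, moebiusSum]

theorem riemannZeta₁_ne_zero {s : ℂ} (hs : 1 ≤ s.re) : riemannZeta₁ s ≠ 0 := by
  rcases eq_or_ne s 1 with rfl | h1
  · simp
  · intro h
    apply riemannZeta_ne_zero_of_one_le_re hs
    rw [riemannZeta_eq_inv_sub_mul h1, h, mul_zero]

/-- The prime number theorem in the form `∑ μ(n)/n = 0`. -/
theorem tendsto_moebiusSum : Tendsto moebiusSum atTop (𝓝 0) := by
  have hm : Measurable fun u : ℝ => moebiusSum ⌊Real.exp u⌋₊ :=
    (measurable_from_top (f := moebiusSum)).comp (Nat.measurable_floor.comp Real.measurable_exp)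
  have h := tendsto_zero_of_laplace (G := fun s => (riemannZeta₁ (s + 1))⁻¹) hm
    (fun u => abs_moebiusSum_le _)
    (fun u hu => by
      rw [Nat.floor_eq_zero.mpr (Real.exp_lt_one_iff.mpr hu)]
      simp [moebiusSum])
    (fun s hs => hasLaplace_moebiusSum hs)
    -- The prime number theorem enters here: ζ does not vanish on Re s = 1, and `riemannZeta₁`
    -- equals 1 at the pole of ζ.
    (ContinuousOn.inv₀ (differentiable_riemannZeta₁.continuous.comp
      (continuous_id.add continuous_const)).continuousOn fun s hs =>
        riemannZeta₁_ne_zero (by simpa using hs)) abs_moebiusSum_exp_sub_le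
  refine (h.comp (Real.tendsto_log_atTop.comp tendsto_natCast_atTop_atTop)).congr' ?_
  filter_upwards [eventually_gt_atTop 0] with N hN
  simp [Real.exp_log (show (0 : ℝ) < N by exact_mod_cast hN)]

end ThetaZeta

end

noncomputable section

namespace ThetaZeta

open Filter Topology Complex MeasureTheory

/-! ### The Hardy–Littlewood–Ramanujan identity -/

/-- Mellin inversion of e^{-x}, whose Mellin transform is Γ. -/
theorem steenV_one {c : ℝ} (hc : 0 < c) {z : ℝ} (hz : 0 < z) :
    steenV c (fun _ : Fin 1 => (0 : ℂ)) z = Real.exp (-z) := by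
  have hmel : ∀ y : ℝ, mellin (fun x => ((Real.exp (-x) : ℝ) : ℂ)) (c + y * I) =
      Gamma (c + y * I) := by
    intro y
    rw [← GammaIntegral_eq_mellin, Gamma_eq_integral (by simpa using hc)]
  have hconv : MellinConvergent (fun x => ((Real.exp (-x) : ℝ) : ℂ)) c := by
    have h := GammaIntegral_convergent (s := c) (by simpa using hc)
    refine h.congr_fun (fun x _ => ?_) measurableSet_Ioi
    simp only [smul_eq_mul]
    rw [mul_comm]
  have hcont : Continuous fun y : ℝ => Gamma (c + y * I) := by
    refine continuous_iff_continuousAt.mpr fun y => ?_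
    refine ContinuousAt.comp (f := fun y : ℝ => (c : ℂ) + y * I) ?_ (by fun_prop)
    refine (differentiableAt_Gamma _ fun m h => ?_).continuousAt
    have := congrArg re h
    simp only [add_re, ofReal_re, mul_re, I_re, mul_zero, ofReal_im, I_im, mul_one, sub_self,
      add_zero, neg_re, natCast_re] at this
    have : (0 : ℝ) ≤ m := Nat.cast_nonneg m
    linarith
  have hvert : VerticalIntegrable (mellin fun x => ((Real.exp (-x) : ℝ) : ℂ)) c := by
    rw [VerticalIntegrable]
    simp only [hmel]
    refine ((integrable_exp_neg_mul_abs (show 0 < Real.pi / 4 by positivity)).const_mul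
      ((1 / Real.cos (Real.pi / 4)) ^ c * Real.Gamma c)).mono' hcont.aestronglyMeasurable
      (ae_of_all _ fun y => ?_)
    simpa using norm_Gamma_le_of_re_pos (t := y) (show 0 ≤ Real.pi / 4 by positivity)
      (by linarith [Real.pi_pos]) hc
  have h := mellinInv_mellin_eq c (fun x => ((Real.exp (-x) : ℝ) : ℂ)) hz hconv hvert
    (by fun_prop)
  rw [← h, mellinInv, steenV, real_smul, ofReal_div, ofReal_one, ofReal_mul, ofReal_ofNat]
  congr 1
  refine integral_congr_ae (ae_of_all _ fun y => ?_)
  simp only [Finset.univ_unique, Finset.prod_singleton, add_zero, smul_eq_mul, hmel]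
  rw [mul_comm]

theorem residueZero_one {w : ℂ} (hw : w ≠ 0) : residueZero 1 w = 2 := by
  have hg : ContinuousAt (fun s : ℂ => 2 * Gamma (s / 2 + 1) * w ^ (-s)) 0 := by
    refine ContinuousAt.mul (continuousAt_const.mul ?_) ?_
    · refine ContinuousAt.comp (f := fun s : ℂ => s / 2 + 1) (g := Gamma) ?_ (by fun_prop)
      refine (differentiableAt_Gamma _ fun m h => ?_).continuousAt
      have := congrArg re h
      simp only [zero_div, zero_add, one_re, neg_re, natCast_re] at this
      have : (0 : ℝ) ≤ m := Nat.cast_nonneg m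
      linarith
    · exact ContinuousAt.const_cpow (by fun_prop) (Or.inl hw)
  have h1 : Tendsto (iteratedDeriv 0 fun s : ℂ => s ^ 1 * Gamma (s / 2) ^ 1 * w ^ (-s)) (𝓝[≠] 0)
      (𝓝 2) := by
    have h2 := hg.tendsto.mono_left (nhdsWithin_le_nhds (s := {0}ᶜ))
    simp only [zero_div, zero_add, Gamma_one, neg_zero, cpow_zero, mul_one] at h2
    refine h2.congr' ?_
    filter_upwards [self_mem_nhdsWithin] with s hs
    have hs0 : s ≠ 0 := hs
    rw [iteratedDeriv_zero, Gamma_add_one _ (div_ne_zero hs0 two_ne_zero)]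
    ring
  rw [residueZero, h1.limUnder_eq]
  simp

theorem uTerm_one {c : ℝ} (hc : 0 < c) {x : ℝ} (hx : 0 < x) (n : ℕ) :
    uTerm 1 c ((x / Real.pi : ℝ) : ℂ) n = (((ArithmeticFunction.moebius n : ℝ) / n *
      (2 * Real.exp (-x / (n : ℝ) ^ 2) - 2) : ℝ) : ℂ) := by
  rcases eq_or_ne n 0 with rfl | hn
  · simp [uTerm_zero]
  have hn' : (0 : ℝ) < n := by exact_mod_cast Nat.pos_of_ne_zero hn
  have hpi : (Real.pi : ℂ) ≠ 0 := by exact_mod_cast Real.pi_ne_zero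
  have hx' : ((x / Real.pi : ℝ) : ℂ) ≠ 0 := by
    exact_mod_cast (div_pos hx Real.pi_pos).ne'
  have h1 : (Real.pi : ℂ) ^ 1 * ((x / Real.pi : ℝ) : ℂ) / (n : ℂ) ^ 2 =
      ((x / (n : ℝ) ^ 2 : ℝ) : ℂ) := by
    push_cast
    field_simp
  rw [uTerm, h1, steenV_one hc (by positivity), residueZero_one (div_ne_zero (mul_ne_zero
    (cpow_ne_zero_iff.mpr (Or.inl hpi)) (sqrt_ne_zero hx')) (by exact_mod_cast hn)), mu, pow_one,
    neg_div]
  push_cast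
  rfl

/-- The terms of the absolutely convergent series are twice (μ(n)/n)(e^{-x/n²} - 1); since ∑ μ(n)/n
= 0 conditionally, the -1 may be dropped from the partial sums in the limit. -/
theorem exists_hasMoebiusExpSum {c : ℝ} (hc : 0 < c) {x : ℝ} (hx : 0 < x) :
    ∃ A : ℝ, HasMoebiusExpSum x A ∧
      ∑' n, uTerm 1 c ((x / Real.pi : ℝ) : ℂ) n = 2 * (A : ℂ) := by
  set a : ℕ → ℝ := fun n => (ArithmeticFunction.moebius n : ℝ) / n *
    (2 * Real.exp (-x / (n : ℝ) ^ 2) - 2) with ha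
  have hy : 0 < x / Real.pi := div_pos hx Real.pi_pos
  have hU : uTerm 1 c ((x / Real.pi : ℝ) : ℂ) = fun n => (a n : ℂ) := funext (uTerm_one hc hx)
  have hs : Summable fun n => (a n : ℂ) := by
    rw [← hU]
    exact (hasSum_uTerm le_rfl hc (by exact_mod_cast hy.ne')
      (by rw [arg_ofReal_of_nonneg hy.le]; simpa using Real.pi_pos)).summable
  have hs' : Summable a := by exact_mod_cast hs
  refine ⟨(∑' n, a n) / 2, ?_, ?_⟩
  · have h1 := (tendsto_add_atTop_iff_nat 1).mpr hs'.hasSum.tendsto_sum_nat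
    have h2 := (h1.div_const 2).add tendsto_moebiusSum
    rw [add_zero] at h2
    refine h2.congr fun N => ?_
    rw [Finset.sum_range_succ', show a 0 = 0 by simp [ha], add_zero, moebiusSum,
      Finset.sum_div, Finset.range_eq_Ico, Finset.sum_Ico_add' (fun n => a n / 2) 0 N 1,
      zero_add, Finset.Ico_add_one_right_eq_Icc, ← Finset.sum_add_distrib]
    refine Finset.sum_congr rfl fun n _ => ?_
    simp only [ha]
    ring
  · rw [hU]
    push_cast
    ring

/-- The pole is simple: (s - ρ)/ζ(1-s) is an inverse difference quotient of ζ(1-s), and the chain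
rule supplies the sign. -/
theorem residueRho_one (hsimple : ∀ ρ ∈ nontrivialZeros, deriv riemannZeta ρ ≠ 0) {x : ℂ}
    (hx : x ≠ 0) {ρ : ℂ} (hρ : ρ ∈ nontrivialZeros) :
    residueRho 1 x ρ = -((Real.pi : ℂ) ^ (-ρ / 2) * Gamma (ρ / 2) * (x ^ (1 / 2 : ℂ)) ^ (-ρ) /
      deriv riemannZeta (1 - ρ)) := by
  have hpi : (Real.pi : ℂ) ≠ 0 := by exact_mod_cast Real.pi_ne_zero
  have hρ' := one_sub_mem_nontrivialZeros hρ
  have hd : HasDerivAt (fun s : ℂ => riemannZeta (1 - s)) (-deriv riemannZeta (1 - ρ)) ρ := by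
    have h1 := (differentiableAt_riemannZeta (ne_one_of_mem_nontrivialZeros hρ')).hasDerivAt
    simpa using h1.comp_const_sub 1 ρ
  have h2 := (hasDerivAt_iff_tendsto_slope.mp hd).inv₀ (neg_ne_zero.mpr (hsimple _ hρ'))
  have hG : ContinuousAt (fun s : ℂ => Gamma (s / 2)) ρ := by
    refine ContinuousAt.comp (f := fun s : ℂ => s / 2) (g := Gamma) ?_ (by fun_prop)
    refine (differentiableAt_Gamma _ fun m h => ?_).continuousAt
    have h3 := congrArg re h
    simp only [div_ofNat_re, neg_re, natCast_re] at h3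
    have h4 := hρ.2.1
    have : (0 : ℝ) ≤ m := Nat.cast_nonneg m
    linarith
  have hg : ContinuousAt (fun s : ℂ => (Real.pi : ℂ) ^ (-s / 2) * Gamma (s / 2) *
      (x ^ (1 / 2 : ℂ)) ^ (-s)) ρ :=
    ((ContinuousAt.const_cpow (by fun_prop) (Or.inl hpi)).mul hG).mul
      (ContinuousAt.const_cpow (by fun_prop) (Or.inl (sqrt_ne_zero hx)))
  have h5 := (hg.tendsto.mono_left (nhdsWithin_le_nhds (s := {ρ}ᶜ))).mul h2
  rw [residueRho, Tendsto.limUnder_eq (h5.congr fun s => ?_)]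
  · simp only [Nat.sub_self, Nat.factorial_zero, Nat.cast_one, div_one, one_mul, inv_neg]
    ring
  · rw [Nat.sub_self, iteratedDeriv_zero, slope_def_field, hρ'.1, sub_zero, inv_div, pow_one,
      pow_one, pow_one, Nat.cast_one, one_mul]
    ring

theorem sum_zerosUpTo_one_sub (f : ℂ → ℂ) (T : ℝ) :
    ∑ ρ ∈ zerosUpTo T, f (1 - ρ) = ∑ ρ ∈ zerosUpTo T, f ρ := by
  have h : ∀ ρ ∈ zerosUpTo T, 1 - ρ ∈ zerosUpTo T := fun ρ hρ => by
    rw [mem_zerosUpTo] at hρ ⊢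
    exact ⟨one_sub_mem_nontrivialZeros hρ.1, by simpa using hρ.2⟩
  exact Finset.sum_nbij' (fun ρ => 1 - ρ) (fun ρ => 1 - ρ) h h (fun ρ _ => sub_sub_cancel 1 ρ)
    (fun ρ _ => sub_sub_cancel 1 ρ) fun ρ _ => rfl

/-- Reindexing by ρ ↦ 1 - ρ turns Γ((1-ρ)/2)/ζ'(ρ) into Γ(ρ/2)/ζ'(1-ρ); the powers of π and of π/x
merge into (π/√x)^{-ρ}, leaving one factor π/√x outside. -/
theorem hasZeroSum_of_residueRho_one
    (hsimple : ∀ ρ ∈ nontrivialZeros, deriv riemannZeta ρ ≠ 0) {x : ℝ} (hx : 0 < x)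
    (h : ZeroSumConverges (residueRho 1 ((Real.pi / x : ℝ) : ℂ))) :
    HasZeroSum (fun ρ => ((Real.pi / Real.sqrt x : ℝ) : ℂ) ^ ρ *
      (Gamma ((1 - ρ) / 2) / deriv riemannZeta ρ))
      (-((Real.pi / Real.sqrt x : ℝ) : ℂ) * zeroSum (residueRho 1 ((Real.pi / x : ℝ) : ℂ))) := by
  have hpi : (Real.pi : ℂ) ≠ 0 := by exact_mod_cast Real.pi_ne_zero
  have hpx : 0 < Real.pi / x := div_pos Real.pi_pos hx
  have hq : 0 < Real.pi / Real.sqrt x := div_pos Real.pi_pos (Real.sqrt_pos.mpr hx)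
  have hpx' : ((Real.pi / x : ℝ) : ℂ) ≠ 0 := by exact_mod_cast hpx.ne'
  have hq' : ((Real.pi / Real.sqrt x : ℝ) : ℂ) ≠ 0 := by exact_mod_cast hq.ne'
  refine (h.hasZeroSum.const_mul (-((Real.pi / Real.sqrt x : ℝ) : ℂ))).congr fun T => ?_
  rw [← sum_zerosUpTo_one_sub fun ρ => ((Real.pi / Real.sqrt x : ℝ) : ℂ) ^ ρ *
    (Gamma ((1 - ρ) / 2) / deriv riemannZeta ρ), Finset.mul_sum]
  refine Finset.sum_congr rfl fun ρ hρ => ?_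
  rw [residueRho_one hsimple hpx' (mem_zerosUpTo.mp hρ).1]
  have hlog : Complex.log ((Real.pi / Real.sqrt x : ℝ) : ℂ) =
      Complex.log Real.pi / 2 + Complex.log ((Real.pi / x : ℝ) : ℂ) / 2 := by
    rw [← ofReal_log hq.le, ← ofReal_log hpx.le, ← ofReal_log Real.pi_pos.le,
      Real.log_div Real.pi_ne_zero (Real.sqrt_pos.mpr hx).ne', Real.log_div Real.pi_ne_zero hx.ne',
      Real.log_sqrt hx.le]
    push_cast
    ring
  have h1 : (Real.pi : ℂ) ^ (-ρ / 2) * (((Real.pi / x : ℝ) : ℂ) ^ (1 / 2 : ℂ)) ^ (-ρ) =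
      ((Real.pi / Real.sqrt x : ℝ) : ℂ) ^ (-ρ) := by
    rw [cpow_def_of_ne_zero hpi, cpow_def_of_ne_zero (sqrt_ne_zero hpx'), log_sqrt,
      cpow_def_of_ne_zero hq', hlog, ← exp_add]
    ring_nf
  rw [sub_sub_cancel, sub_eq_add_neg, cpow_add _ _ hq', cpow_one, ← h1]
  ring

theorem hlrIdentity (hsimple : ∀ ρ ∈ nontrivialZeros, deriv riemannZeta ρ ≠ 0)
    (hconv : ∀ x : ℝ, 0 < x → ZeroSumConverges (residueRho 1 (x : ℂ))) {x : ℝ} (hx : 0 < x) :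
    HLRIdentity x := by
  have hy : 0 < x / Real.pi := div_pos hx Real.pi_pos
  have hy' : 0 < Real.pi / x := div_pos Real.pi_pos hx
  -- The theta relation is used at x/π, whose inverse π/x is (π²/x)/π; this yields the exponents x
  -- and π²/x. The choice c = 1 below is arbitrary.
  have hone : 1 / ((x / Real.pi : ℝ) : ℂ) = ((Real.pi / x : ℝ) : ℂ) := by
    rw [← one_div_div x Real.pi]
    push_cast
    rfl
  obtain ⟨A, hA, hA2⟩ := exists_hasMoebiusExpSum one_pos hx
  obtain ⟨B, hB, hB2⟩ := exists_hasMoebiusExpSum one_pos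
    (show 0 < Real.pi ^ 2 / x by positivity)
  have hdiv : Real.pi ^ 2 / x / Real.pi = Real.pi / x := by
    field_simp
  rw [hdiv] at hB2
  obtain ⟨e1, e2⟩ := zeroSum_and_tsum_one_div hsimple le_rfl one_pos (x := ((x / Real.pi : ℝ) : ℂ))
    (by exact_mod_cast hy.ne')
    (by rw [arg_ofReal_of_nonneg hy.le]; simpa using Real.pi_pos) (hconv _ hy)
    (by rw [hone]; exact hconv _ hy')
  rw [hone] at e1 e2
  rw [hA2, hB2] at e2
  refine ⟨A, B, _, hA, hB, hasZeroSum_of_residueRho_one hsimple hx (hconv _ hy'), ?_⟩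
  have hsqrt : ((x / Real.pi : ℝ) : ℂ) ^ (1 / 2 : ℂ) = ((Real.sqrt (x / Real.pi) : ℝ) : ℂ) := by
    rw [Real.sqrt_eq_rpow, ofReal_cpow hy.le]
    norm_num
  rw [hsqrt] at e1 e2
  rw [e1]
  rw [Real.sqrt_div hx.le] at e2 ⊢
  rw [Real.sqrt_div Real.pi_pos.le]
  have hp0 : ((Real.sqrt Real.pi : ℝ) : ℂ) ≠ 0 := by
    exact_mod_cast (Real.sqrt_pos.mpr Real.pi_pos).ne'
  have hr0 : ((Real.sqrt x : ℝ) : ℂ) ≠ 0 := by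
    exact_mod_cast (Real.sqrt_pos.mpr hx).ne'
  have hp2 : (Real.pi : ℂ) = ((Real.sqrt Real.pi : ℝ) : ℂ) ^ 2 := by
    exact_mod_cast (Real.sq_sqrt Real.pi_pos.le).symm
  push_cast at e2 ⊢
  generalize zeroSum (residueRho 1 _) = Z at e2 ⊢
  rw [hp2]
  generalize ((Real.sqrt Real.pi : ℝ) : ℂ) = p at *
  generalize ((Real.sqrt x : ℝ) : ℂ) = r at *
  field_simp at e2 ⊢
  linear_combination (-1) * e2

end ThetaZeta

end

/-! ### The theorem -/

theorem mainTheorem6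
    (hsimple : ∀ ρ ∈ ThetaZeta.nontrivialZeros, deriv riemannZeta ρ ≠ 0) :
    (∀ k : ℕ, 1 ≤ k →
      (∀ x : ℝ, 0 < x → ThetaZeta.ZeroSumConverges (ThetaZeta.residueRho k (x : ℂ))) →
      ∀ c : ℝ, 0 < c →
        (∀ x : ℂ, x ≠ 0 → |x.arg| < Real.pi / 2 → Summable (ThetaZeta.uTerm k c x)) ∧
        (ThetaZeta.FunctionalEquation k ↔ ThetaZeta.ThetaRelation k c)) ∧
    ((∀ x : ℝ, 0 < x → ThetaZeta.ZeroSumConverges (ThetaZeta.residueRho 1 (x : ℂ))) →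
      (ThetaZeta.FunctionalEquation 1 ↔ ∀ x : ℝ, 0 < x → ThetaZeta.HLRIdentity x)) :=
  ⟨fun k hk _ _ hc => ⟨fun _ hx harg => (ThetaZeta.hasSum_uTerm hk hc hx harg).summable,
      fun _ => ThetaZeta.thetaRelation hsimple hk hc, fun _ => ThetaZeta.functionalEquation k⟩,
    fun hconv => ⟨fun _ _ hx => ThetaZeta.hlrIdentity hsimple hconv hx,
      fun _ => ThetaZeta.functionalEquation 1⟩⟩
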